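/- Let $k$ be an algebraically closed field of characteristic $0$, let $X=\operatorname{Spec}\mathcal O$ be a smooth affine algebraic variety over $k$, and let $\mathcal D$ be the ring of $k$-linear differential operators on $\mathcal O=\Gamma(X,\mathcal O_X)$. Let $\mathtt{DG}\mathcal D\mathtt M$ be the category of chain complexes, in degrees $\ge 0$, of left $\mathcal D$-modules. It is symmetric monoidal for the tensor product $\otimes=\otimes_{\mathcal O}$ of complexes (vector fields act on $M\otimes_{\mathcal O}N$ by $\theta(m\otimes n)=\theta m\otimes n+m\otimes\theta n$), with unit $\mathcal O$ in degree $0$ and the symmetry with the usual sign. Let $\mathcal A$ be a differential graded $\mathcal D$-algebra, i.e. a commutative monoid in $\mathtt{DG}\mathcal D\mathtt M$, and let $\mathtt{Mod}(\mathcal A)$ be the category of $\mathcal A$-modules in $\mathtt{DG}\mathcal D\mathtt M$. In $\mathtt{Mod}(\mathcal A)$, the weak equivalences are the morphisms that induce isomorphisms in homology, the fibrations are the morphisms that are surjective in all degrees $>0$, and the cofibrations are the morphisms that have the left lifting property with respect to all fibrations that are weak equivalences; an $\mathcal A$-module $M$ is cofibrant if $0\to M$ is a cofibration. For $\mathcal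 A$-modules $P$ and $M$, let $P\otimes_{\mathcal A}M$ be the $\mathcal A$-module $P\otimes M$ modulo the relations $p\otimes am=(-1)^{|a||p|}\,ap\otimes m$. Then, for every cofibrant $\mathcal A$-module $M$, the functor $$-\otimes_{\mathcal A}M:\mathtt{Mod}(\mathcal A)\to\mathtt{Mod}(\mathcal A)$$ preserves weak equivalences: if $f:P\to Q$ is a weak equivalence of $\mathcal A$-modules, then so is $f\otimes_{\mathcal A}M:P\otimes_{\mathcal A}M\to Q\otimes_{\mathcal A}M$. (This is condition HAC3 of a homotopical algebraic context.) -/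

import Mathlib

open CategoryTheory TensorProduct

universe u v

noncomputable section

namespace DGD

section DifferentialOperators

variable (k : Type u) (O : Type u) [Field k] [CommRing O] [Algebra k O]

/-- The `k`-linear differential operators on `O` of order `< n` (an `O`-submodule of `End_k(O)`):
only `0` has order `< 0`, and `P` has order `< n + 1` iff all commutators `[P, f]` with (the
multiplication by) a function `f` have order `< n`. -/
def diffOpLT : ℕ → Submodule O (Module.End k O)
  | 0 => ⊥
  | n + 1 =>
    { carrier := {P | ∀ f : O, P * Algebra.lmul k O f - Algebra.lmul k O f * P ∈ diffOpLT n}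
      add_mem' := fun {P Q} hP hQ f => by
        have := (diffOpLT n).add_mem (hP f) (hQ f)
        convert this using 1
        noncomm_ring
      zero_mem' := fun f => by simp
      smul_mem' := fun g P hP f => by
        have := (diffOpLT n).smul_mem g (hP f)
        convert this using 1
        ext x
        simp
        ring }

theorem mem_diffOpLT_succ {n : ℕ} {P : Module.End k O} : P ∈ diffOpLT k O (n + 1) ↔
    ∀ f : O, P * Algebra.lmul k O f - Algebra.lmul k O f * P ∈ diffOpLT k O n := Iff.rfl

theorem diffOpLT_le_succ (n : ℕ) : diffOpLT k O n ≤ diffOpLT k O (n + 1) := by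
  induction n with
  | zero => exact bot_le
  | succ n ih => exact fun P hP f => ih (hP f)

theorem diffOpLT_mono : Monotone (diffOpLT k O) := monotone_nat_of_le_succ (diffOpLT_le_succ k O)

theorem lmul_mem_diffOpLT (f : O) : Algebra.lmul k O f ∈ diffOpLT k O 1 := by
  intro g
  have : Algebra.lmul k O f * Algebra.lmul k O g - Algebra.lmul k O g * Algebra.lmul k O f = 0 := by
    rw [← map_mul, ← map_mul, mul_comm, sub_self]
  rw [this]
  exact zero_mem _

theorem mul_lmul_mem_diffOpLT {n : ℕ} {P : Module.End k O} (hP : P ∈ diffOpLT k O n) (f : O) :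
    P * Algebra.lmul k O f ∈ diffOpLT k O n := by
  cases n with
  | zero =>
    rw [show P = 0 from hP, zero_mul]
    exact zero_mem _
  | succ n =>
    have h1 := diffOpLT_le_succ k O n (hP f)
    have h2 : Algebra.lmul k O f * P ∈ diffOpLT k O (n + 1) := (diffOpLT k O (n + 1)).smul_mem f hP
    simpa using add_mem h1 h2

theorem mul_mem_diffOpLT (N : ℕ) : ∀ (m n : ℕ), m + n ≤ N → ∀ {P Q : Module.End k O},
    P ∈ diffOpLT k O (m + 1) → Q ∈ diffOpLT k O (n + 1) → P * Q ∈ diffOpLT k O (m + n + 1) := by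
  induction N with
  | zero =>
    intro m n h P Q hP hQ f
    obtain ⟨rfl, rfl⟩ : m = 0 ∧ n = 0 := by omega
    have h1 : P * Algebra.lmul k O f - Algebra.lmul k O f * P = 0 := hP f
    have h2 : Q * Algebra.lmul k O f - Algebra.lmul k O f * Q = 0 := hQ f
    have : P * Q * Algebra.lmul k O f - Algebra.lmul k O f * (P * Q) = 0 := by
      rw [mul_assoc, sub_eq_zero.1 h2, ← mul_assoc, sub_eq_zero.1 h1, mul_assoc, sub_self]
    rw [this]
    exact zero_mem _
  | succ N ih =>
    intro m n h P Q hP hQ f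
    have e : P * Q * Algebra.lmul k O f - Algebra.lmul k O f * (P * Q) =
        P * (Q * Algebra.lmul k O f - Algebra.lmul k O f * Q) +
        (P * Algebra.lmul k O f - Algebra.lmul k O f * P) * Q := by
      simp only [mul_sub, sub_mul, mul_assoc]
      abel
    rw [e]
    refine add_mem ?_ ?_
    · cases n with
      | zero =>
        rw [show Q * Algebra.lmul k O f - Algebra.lmul k O f * Q = 0 from hQ f, mul_zero]
        exact zero_mem _
      | succ n => exact ih m n (by omega) hP (hQ f)
    · cases m with
      | zero =>
        rw [show P * Algebra.lmul k O f - Algebra.lmul k O f * P = 0 from hP f, zero_mul]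
        exact zero_mem _
      | succ m =>
        have := ih m n (by omega) (hP f) hQ
        rwa [show m + 1 + n = m + n + 1 by omega]

/-- The ring `𝒟` of (`k`-linear, Grothendieck) differential operators of finite order on `O`. -/
def diffOp : Subalgebra k (Module.End k O) where
  carrier := {P | ∃ n, P ∈ diffOpLT k O n}
  mul_mem' := by
    rintro P Q ⟨m, hm⟩ ⟨n, hn⟩
    exact ⟨_, mul_mem_diffOpLT k O _ m n le_rfl (diffOpLT_le_succ k O m hm)
      (diffOpLT_le_succ k O n hn)⟩
  add_mem' := by
    rintro P Q ⟨m, hm⟩ ⟨n, hn⟩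
    exact ⟨max m n, add_mem (diffOpLT_mono k O (le_max_left m n) hm)
      (diffOpLT_mono k O (le_max_right m n) hn)⟩
  algebraMap_mem' c := ⟨1, by
    have := lmul_mem_diffOpLT k O (algebraMap k O c)
    rwa [AlgHom.commutes] at this⟩

/-- The ring `𝒟` of differential operators on `O`, as a type. -/
def D : Type u := diffOp k O

instance : Ring (D k O) := inferInstanceAs (Ring (diffOp k O))
instance : Algebra k (D k O) := inferInstanceAs (Algebra k (diffOp k O))

/-- The underlying operator of an element of `𝒟`. -/
def toEnd : D k O →ₐ[k] Module.End k O := (diffOp k O).val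

theorem toEnd_injective : Function.Injective (toEnd k O) := Subtype.val_injective

theorem exists_order (P : D k O) : ∃ n, toEnd k O P ∈ diffOpLT k O n := P.2

/-- Functions, as differential operators of order `0`. -/
def fn : O →ₐ[k] D k O :=
  (Algebra.lmul k O).codRestrict (diffOp k O) fun f => ⟨1, lmul_mem_diffOpLT k O f⟩

variable {k O}

@[simp] theorem toEnd_fn (f : O) : toEnd k O (fn k O f) = Algebra.lmul k O f := rfl

theorem der_comm (θ : Derivation k O O) (f : O) :
    (θ : Module.End k O) * Algebra.lmul k O f - Algebra.lmul k O f * θ =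
      Algebra.lmul k O (θ f) := by
  ext x
  simp
  ring

/-- Vector fields, as differential operators of order `≤ 1`. -/
def vf (θ : Derivation k O O) : D k O :=
  (⟨θ, 2, fun f => by rw [der_comm]; exact lmul_mem_diffOpLT k O _⟩ : diffOp k O)

@[simp] theorem toEnd_vf (θ : Derivation k O O) : toEnd k O (vf θ) = (θ : Module.End k O) := rfl

/-- A finite system of functions `x j` and of vector fields `θ j` such that
`d f = ∑ j, θ j f • d (x j)` for every function `f`. -/
theorem exists_dual_basis [Algebra.Smooth k O] : ∃ (r : ℕ) (x : Fin r → O)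
    (θ : Fin r → Derivation k O O), ∀ {M : Type u} [AddCommGroup M] [Module O M] [Module k M]
      [IsScalarTower k O M] (δ : Derivation k O M) (f : O), δ f = ∑ j, θ j f • δ (x j) := by
  have hfin : Module.Finite O (Ω[O⁄k]) := inferInstance
  have hproj : Module.Projective O (Ω[O⁄k]) := inferInstance
  have hspan := KaehlerDifferential.span_range_derivation k O
  have hfg : (Submodule.span O (Set.range (KaehlerDifferential.D k O))).FG := by
    rw [hspan]; exact Module.finite_def.1 hfin
  obtain ⟨s, hs, hs'⟩ := (Submodule.fg_span_iff_fg_span_finset_subset _).1 hfg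
  rw [hspan] at hs'
  let e := s.equivFin
  choose y hy using fun ω : s => hs ω.2
  let x : Fin s.card → O := fun j => y (e.symm j)
  let p : (Fin s.card → O) →ₗ[O] Ω[O⁄k] :=
    Fintype.linearCombination O (fun j => KaehlerDifferential.D k O (x j))
  have hp : Function.Surjective p := by
    rw [← LinearMap.range_eq_top, Fintype.range_linearCombination, hs']
    congr 1
    ext ω
    constructor
    · rintro ⟨j, rfl⟩
      simp only [x, hy]
      exact (e.symm j).2
    · intro h
      exact ⟨e ⟨ω, h⟩, by simp [x, hy]⟩
  obtain ⟨q, hq⟩ := Module.projective_lifting_property p LinearMap.id hp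
  refine ⟨s.card, x, fun j => ((LinearMap.proj j ∘ₗ q).compDer (KaehlerDifferential.D k O)), ?_⟩
  intro M _ _ _ _ δ f
  have h1 := LinearMap.congr_fun hq (KaehlerDifferential.D k O f)
  have h2 := congrArg δ.liftKaehlerDifferential h1
  simp only [LinearMap.comp_apply, LinearMap.id_apply, p, Fintype.linearCombination_apply, map_sum,
    map_smul, Derivation.liftKaehlerDifferential_comp_D] at h2
  exact h2.symm

variable (k O) in
/-- Operators on which functions and vector fields act subject to the usual relations
`[θ, f] = θ(f)`, `(f θ) = f ∘ θ` and `[θ, η] = ⁅θ, η⁆`. -/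
structure VFRep (R : Type*) [Ring R] where
  c : O →+* R
  t : Derivation k O O →+ R
  t_c : ∀ θ f, t θ * c f = c f * t θ + c (θ f)
  t_smul : ∀ (f : O) θ, t (f • θ) = c f * t θ
  t_lie : ∀ θ η, t θ * t η = t η * t θ + t ⁅θ, η⁆

namespace VFRep

variable {R : Type*} [Ring R] (ρ : VFRep k O R)

/-- Sums of words `f θ₁ ⋯ θₘ` with `m ≤ n`. -/
def words : ℕ → AddSubgroup R
  | 0 => (ρ.c : O →+ R).range
  | n + 1 => words n ⊔ AddSubgroup.closure {y | ∃ w ∈ words n, ∃ θ, y = w * ρ.t θ}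

theorem words_le_succ (n : ℕ) : ρ.words n ≤ ρ.words (n + 1) := le_sup_left

theorem words_mono : Monotone ρ.words := monotone_nat_of_le_succ ρ.words_le_succ

theorem mul_t_mem {n : ℕ} {w : R} (hw : w ∈ ρ.words n) (θ : Derivation k O O) :
    w * ρ.t θ ∈ ρ.words (n + 1) :=
  AddSubgroup.mem_sup_right (AddSubgroup.subset_closure ⟨w, hw, θ, rfl⟩)

theorem c_mem (f : O) (n : ℕ) : ρ.c f ∈ ρ.words n :=
  ρ.words_mono (Nat.zero_le n) ⟨f, rfl⟩

theorem words_induction {n : ℕ} {p : R → Prop} (h0 : ∀ w ∈ ρ.words n, p w)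
    (h1 : ∀ w ∈ ρ.words n, ∀ θ, p (w * ρ.t θ)) (ha : ∀ v w, p v → p w → p (v + w))
    (hn : ∀ v, p v → p (-v)) (v : R) (hv : v ∈ ρ.words (n + 1)) : p v := by
  obtain ⟨v, hv', w, hw, rfl⟩ := AddSubgroup.mem_sup.1 hv
  clear hv
  refine ha _ _ (h0 v hv') ?_
  induction hw using AddSubgroup.closure_induction with
  | mem x hx => obtain ⟨w, hw, θ, rfl⟩ := hx; exact h1 w hw θ
  | zero => exact h0 0 (zero_mem _)
  | add x y _ _ hx hy => exact ha _ _ hx hy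
  | neg x _ hx => exact hn _ hx

theorem c_mul_mem (n : ℕ) (f : O) : ∀ w ∈ ρ.words n, ρ.c f * w ∈ ρ.words n := by
  induction n with
  | zero => rintro _ ⟨g, rfl⟩; exact ⟨f * g, by simp⟩
  | succ n ih =>
    refine ρ.words_induction (fun w hw => ρ.words_le_succ n (ih w hw)) (fun w hw θ => ?_)
      (fun v w hv hw => ?_) (fun v hv => ?_)
    · rw [← mul_assoc]; exact ρ.mul_t_mem (ih w hw) θ
    · rw [mul_add]; exact add_mem hv hw
    · rw [mul_neg]; exact neg_mem hv

theorem mul_c_mem (n : ℕ) : ∀ w ∈ ρ.words n, ∀ f : O, w * ρ.c f ∈ ρ.words n := by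
  induction n with
  | zero => rintro _ ⟨g, rfl⟩ f; exact ⟨g * f, by simp⟩
  | succ n ih =>
    refine ρ.words_induction (fun w hw f => ρ.words_le_succ n (ih w hw f)) (fun w hw θ f => ?_)
      (fun v w hv hw f => ?_) (fun v hv f => ?_)
    · rw [mul_assoc, ρ.t_c, mul_add, ← mul_assoc]
      exact add_mem (ρ.mul_t_mem (ih w hw f) θ) (ρ.words_le_succ n (ih w hw _))
    · rw [add_mul]; exact add_mem (hv f) (hw f)
    · rw [neg_mul]; exact neg_mem (hv f)

theorem mul_mem_words (m n : ℕ) : ∀ w ∈ ρ.words n, ∀ v ∈ ρ.words m, v * w ∈ ρ.words (m + n) := by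
  induction n with
  | zero => rintro _ ⟨g, rfl⟩ v hv; exact ρ.mul_c_mem m v hv g
  | succ n ih =>
    refine ρ.words_induction (fun w hw v hv => ρ.words_le_succ _ (ih w hw v hv))
      (fun w hw θ v hv => ?_) (fun w w' hw hw' v hv => ?_) (fun w hw v hv => ?_)
    · rw [← mul_assoc]; exact ρ.mul_t_mem (ih w hw v hv) θ
    · rw [mul_add]; exact add_mem (hw v hv) (hw' v hv)
    · rw [mul_neg]; exact neg_mem (hw v hv)

theorem comm_zero (f : O) : ∀ w ∈ ρ.words 0, w * ρ.c f - ρ.c f * w = 0 := by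
  rintro _ ⟨g, rfl⟩
  simp [← map_mul, mul_comm]

theorem comm_mem (n : ℕ) (f : O) : ∀ w ∈ ρ.words (n + 1), w * ρ.c f - ρ.c f * w ∈ ρ.words n := by
  induction n with
  | zero =>
    refine ρ.words_induction (fun w hw => ?_) (fun w hw θ => ?_) (fun w w' hw hw' => ?_)
      (fun w hw => ?_)
    · rw [ρ.comm_zero f w hw]; exact zero_mem _
    · have : w * ρ.t θ * ρ.c f - ρ.c f * (w * ρ.t θ) =
          (w * ρ.c f - ρ.c f * w) * ρ.t θ + w * ρ.c (θ f) := by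
        rw [mul_assoc, ρ.t_c, mul_add, sub_mul, mul_assoc, mul_assoc]; abel
      rw [this, ρ.comm_zero f w hw, zero_mul, zero_add]
      exact ρ.mul_c_mem 0 w hw _
    · convert add_mem hw hw' using 1; simp only [add_mul, mul_add]; abel
    · convert neg_mem hw using 1; simp only [neg_mul, mul_neg]; abel
  | succ n ih =>
    refine ρ.words_induction (fun w hw => ?_) (fun w hw θ => ?_) (fun w w' hw hw' => ?_)
      (fun w hw => ?_)
    · exact ρ.words_le_succ n (ih w hw)
    · have : w * ρ.t θ * ρ.c f - ρ.c f * (w * ρ.t θ) =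
          (w * ρ.c f - ρ.c f * w) * ρ.t θ + w * ρ.c (θ f) := by
        rw [mul_assoc, ρ.t_c, mul_add, sub_mul, mul_assoc, mul_assoc]; abel
      rw [this]
      exact add_mem (ρ.mul_t_mem (ih w hw) θ) (ρ.mul_c_mem _ w hw _)
    · convert add_mem hw hw' using 1; simp only [add_mul, mul_add]; abel
    · convert neg_mem hw using 1; simp only [neg_mul, mul_neg]; abel

/-- Euler's relation for words of length `n`, up to shorter words. -/
theorem euler {r : ℕ} {x : Fin r → O} {θ : Fin r → Derivation k O O}
    (hx : ∀ δ : Derivation k O O, δ = ∑ j, δ (x j) • θ j) (n : ℕ) : ∀ w ∈ ρ.words (n + 1),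
    ((n + 1 : ℕ) : R) * w - ∑ j, (w * ρ.c (x j) - ρ.c (x j) * w) * ρ.t (θ j) ∈ ρ.words n := by
  have key : ∀ (w : R) (η : Derivation k O O),
      ∑ j, (w * ρ.t η * ρ.c (x j) - ρ.c (x j) * (w * ρ.t η)) * ρ.t (θ j) =
        (∑ j, (w * ρ.c (x j) - ρ.c (x j) * w) * ρ.t (θ j)) * ρ.t η +
        (∑ j, (w * ρ.c (x j) - ρ.c (x j) * w) * ρ.t ⁅η, θ j⁆) + w * ρ.t η := by
    intro w η
    have h := congrArg ρ.t (hx η)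
    rw [map_sum] at h
    simp only [ρ.t_smul] at h
    have h' : w * ρ.t η = ∑ j, w * (ρ.c (η (x j)) * ρ.t (θ j)) := by
      rw [← Finset.mul_sum, ← h]
    conv_rhs => rw [Finset.sum_mul, ← Finset.sum_add_distrib, h', ← Finset.sum_add_distrib]
    refine Finset.sum_congr rfl fun j _ => ?_
    have h1 : w * ρ.t η * ρ.c (x j) - ρ.c (x j) * (w * ρ.t η) =
        (w * ρ.c (x j) - ρ.c (x j) * w) * ρ.t η + w * ρ.c (η (x j)) := by
      rw [mul_assoc, ρ.t_c, mul_add, sub_mul, mul_assoc, mul_assoc]; abel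
    rw [h1, add_mul, mul_assoc _ (ρ.t η), ρ.t_lie, mul_add, mul_assoc, mul_assoc]
  have radd : ∀ v w : R, ∑ j, ((v + w) * ρ.c (x j) - ρ.c (x j) * (v + w)) * ρ.t (θ j) =
      ∑ j, (v * ρ.c (x j) - ρ.c (x j) * v) * ρ.t (θ j) +
      ∑ j, (w * ρ.c (x j) - ρ.c (x j) * w) * ρ.t (θ j) := by
    intro v w
    rw [← Finset.sum_add_distrib]
    refine Finset.sum_congr rfl fun j _ => ?_
    rw [← add_mul]; congr 1; simp only [add_mul, mul_add]; abel
  have rneg : ∀ v : R, ∑ j, ((-v) * ρ.c (x j) - ρ.c (x j) * (-v)) * ρ.t (θ j) =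
      -∑ j, (v * ρ.c (x j) - ρ.c (x j) * v) * ρ.t (θ j) := by
    intro v
    rw [← Finset.sum_neg_distrib]
    refine Finset.sum_congr rfl fun j _ => ?_
    rw [← neg_mul]; congr 1; simp only [neg_mul, mul_neg]; abel
  have natmem : ∀ (m n : ℕ), ∀ w ∈ ρ.words n, (m : R) * w ∈ ρ.words n := by
    intro m n w hw
    rw [← nsmul_eq_mul]; exact AddSubgroup.nsmul_mem _ hw m
  induction n with
  | zero =>
    refine ρ.words_induction (fun w hw => ?_) (fun w hw η => ?_) (fun w w' hw hw' => ?_)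
      (fun w hw => ?_)
    · refine sub_mem (natmem _ _ _ hw) (sum_mem fun j _ => ?_)
      rw [ρ.comm_zero _ w hw, zero_mul]; exact zero_mem _
    · rw [key]
      simp only [ρ.comm_zero _ w hw, zero_mul, Finset.sum_const_zero, zero_add, Nat.cast_one,
        one_mul, sub_self]
      exact zero_mem _
    · rw [radd]; convert add_mem hw hw' using 1; rw [mul_add]; abel
    · rw [rneg]; convert neg_mem hw using 1; rw [mul_neg]; abel
  | succ n ih =>
    refine ρ.words_induction (fun w hw => ?_) (fun w hw η => ?_) (fun w w' hw hw' => ?_)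
      (fun w hw => ?_)
    · refine sub_mem (natmem _ _ _ hw) (sum_mem fun j _ => ?_)
      exact ρ.mul_t_mem (ρ.comm_mem n _ w hw) _
    · rw [key]
      have e : ((n + 1 + 1 : ℕ) : R) * (w * ρ.t η) -
          ((∑ j, (w * ρ.c (x j) - ρ.c (x j) * w) * ρ.t (θ j)) * ρ.t η +
          (∑ j, (w * ρ.c (x j) - ρ.c (x j) * w) * ρ.t ⁅η, θ j⁆) + w * ρ.t η) =
          (((n + 1 : ℕ) : R) * w - ∑ j, (w * ρ.c (x j) - ρ.c (x j) * w) * ρ.t (θ j)) * ρ.t η -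
          ∑ j, (w * ρ.c (x j) - ρ.c (x j) * w) * ρ.t ⁅η, θ j⁆ := by
        push_cast
        simp only [add_mul, sub_mul, mul_assoc, one_mul]
        abel
      rw [e]
      exact sub_mem (ρ.mul_t_mem (ih w hw) η)
        (sum_mem fun j _ => ρ.mul_t_mem (ρ.comm_mem n _ w hw) _)
    · rw [radd]; convert add_mem hw hw' using 1; rw [mul_add]; abel
    · rw [rneg]; convert neg_mem hw using 1; rw [mul_neg]; abel

variable (k O) in
/-- The tautological representation in `𝒟`. -/
@[simps] def taut : VFRep k O (D k O) where
  c := (fn k O : O →+* D k O)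
  t := { toFun := vf
         map_zero' := toEnd_injective k O (by ext; rfl)
         map_add' := fun _ _ => toEnd_injective k O (by ext; rfl) }
  t_c θ f := toEnd_injective k O (by
    have := der_comm θ f
    rw [sub_eq_iff_eq_add] at this
    simpa [add_comm] using this)
  t_smul f θ := toEnd_injective k O (by ext; rfl)
  t_lie θ η := toEnd_injective k O (by
    ext x
    simp [Ring.lie_def])

/-- The diagonal representation in a product. -/
@[simps] def prod {S : Type*} [Ring S] (σ : VFRep k O S) : VFRep k O (R × S) where
  c := ρ.c.prod σ.c
  t := ρ.t.prod σ.t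
  t_c θ f := Prod.ext (ρ.t_c θ f) (σ.t_c θ f)
  t_smul f θ := Prod.ext (ρ.t_smul f θ) (σ.t_smul f θ)
  t_lie θ η := Prod.ext (ρ.t_lie θ η) (σ.t_lie θ η)

theorem fst_zero [CharZero k] [Algebra.Smooth k O] (n : ℕ) :
    ∀ w ∈ ((taut k O).prod ρ).words n, w.1 = 0 → w = 0 := by
  obtain ⟨r, x, θ, h⟩ := exists_dual_basis (k := k) (O := O)
  have hx : ∀ δ : Derivation k O O, δ = ∑ j, δ (x j) • θ j := by
    intro δ
    ext f
    let ev : Derivation k O O →+ O :=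
      { toFun := fun δ => δ f, map_zero' := rfl, map_add' := fun _ _ => rfl }
    rw [h δ f, show (∑ j, δ (x j) • θ j) f = ev (∑ j, δ (x j) • θ j) from rfl, map_sum]
    exact Finset.sum_congr rfl fun j _ => by simp [ev, mul_comm]
  induction n with
  | zero =>
    rintro _ ⟨f, rfl⟩ hf
    have h0 : f = 0 := by
      have := congrArg (fun P : D k O => toEnd k O P 1) hf
      simpa using this
    rw [h0, map_zero]
  | succ n ih =>
    intro w hw h0
    set σ := (taut k O).prod ρ
    have hc : ∀ f, w * σ.c f - σ.c f * w = 0 := fun f =>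
      ih _ (σ.comm_mem n f w hw) (by rw [Prod.fst_sub, Prod.fst_mul, Prod.fst_mul, h0]; simp)
    have h1 := σ.euler hx n w hw
    simp only [hc, zero_mul, Finset.sum_const_zero] at h1
    rw [sub_zero] at h1
    have h2 := ih _ h1 (by simp [h0])
    have h3 : σ.c (algebraMap k O ((n + 1 : ℕ) : k)⁻¹) * (((n + 1 : ℕ) : D k O × R)) = 1 := by
      rw [← map_natCast σ.c, ← map_mul, ← map_natCast (algebraMap k O), ← map_mul,
        inv_mul_cancel₀ (Nat.cast_ne_zero.2 (Nat.succ_ne_zero n)), map_one, map_one]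
    calc w = σ.c (algebraMap k O ((n + 1 : ℕ) : k)⁻¹) * (((n + 1 : ℕ) : D k O × R)) * w := by
          rw [h3, one_mul]
      _ = 0 := by rw [mul_assoc, h2, mul_zero]

end VFRep

/-- Derivation `f ↦ [P, f]` modulo operators of lower order. -/
theorem comm_sub_sum_mem {r : ℕ} {x : Fin r → O} {θ : Fin r → Derivation k O O}
    (h : ∀ {M : Type u} [AddCommGroup M] [Module O M] [Module k M]
      [IsScalarTower k O M] (δ : Derivation k O M) (f : O), δ f = ∑ j, θ j f • δ (x j))
    {n : ℕ} {P : Module.End k O} (hP : P ∈ diffOpLT k O (n + 2)) (f : O) :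
    (P * Algebra.lmul k O f - Algebra.lmul k O f * P) -
      ∑ j, θ j f • (P * Algebra.lmul k O (x j) - Algebra.lmul k O (x j) * P) ∈
      diffOpLT k O n := by
  let q := (diffOpLT k O n).mkQ
  let δ : Derivation k O (Module.End k O ⧸ diffOpLT k O n) := Derivation.mk'
    ((q.restrictScalars k) ∘ₗ (LinearMap.mulLeft k P - LinearMap.mulRight k P) ∘ₗ
      (Algebra.lmul k O).toLinearMap) (by
      intro a b
      simp only [LinearMap.comp_apply, LinearMap.restrictScalars_apply, ← map_smul, ← map_add]
      rw [← sub_eq_zero, ← map_sub]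
      refine (Submodule.Quotient.mk_eq_zero _).2 ?_
      convert hP a b using 1
      ext y
      simp
      ring_nf)
  have hδ : ∀ g, δ g = q (P * Algebra.lmul k O g - Algebra.lmul k O g * P) := fun g => rfl
  have := h δ f
  simp only [hδ] at this
  rw [← sub_eq_zero] at this
  simp only [← map_smul, ← map_sum, ← map_sub] at this
  exact (Submodule.Quotient.mk_eq_zero _).1 this

theorem euler_sub_mem {r : ℕ} {x : Fin r → O} {θ : Fin r → Derivation k O O}
    (h : ∀ {M : Type u} [AddCommGroup M] [Module O M] [Module k M]
      [IsScalarTower k O M] (δ : Derivation k O M) (f : O), δ f = ∑ j, θ j f • δ (x j))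
    (m : ℕ) : ∀ P ∈ diffOpLT k O (m + 1), (m : Module.End k O) * P -
      ∑ j, (P * Algebra.lmul k O (x j) - Algebra.lmul k O (x j) * P) * (θ j : Module.End k O) ∈
      diffOpLT k O m := by
  induction m with
  | zero =>
    intro P hP
    have : ∀ f, P * Algebra.lmul k O f - Algebra.lmul k O f * P = 0 := hP
    simp only [this, zero_mul, Finset.sum_const_zero, Nat.cast_zero, sub_zero]
    exact zero_mem _
  | succ m ih =>
    intro P hP f
    set L := Algebra.lmul k O with hL
    have h1 := ih _ (hP f)
    have h2 := comm_sub_sum_mem h hP f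
    have h3 : ∑ j, ((P * L (x j) - L (x j) * P) * L (θ j f) -
        L (θ j f) * (P * L (x j) - L (x j) * P)) ∈ diffOpLT k O m :=
      sum_mem fun j _ => hP (x j) (θ j f)
    have h4 := sub_mem (add_mem h1 h2) h3
    convert h4 using 1
    have hs : ∀ (g : O) (Q : Module.End k O), g • Q = L g * Q := fun g Q => rfl
    have e : ∀ j, (P * L (x j) - L (x j) * P) * (θ j : Module.End k O) * L f -
        L f * ((P * L (x j) - L (x j) * P) * (θ j : Module.End k O)) =
        ((P * L f - L f * P) * L (x j) - L (x j) * (P * L f - L f * P)) * (θ j : Module.End k O) +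
        θ j f • (P * L (x j) - L (x j) * P) + ((P * L (x j) - L (x j) * P) * L (θ j f) -
        L (θ j f) * (P * L (x j) - L (x j) * P)) := by
      intro j
      have e1 := sub_eq_iff_eq_add.1 (der_comm (θ j) f)
      have c : L f * L (x j) = L (x j) * L f := by rw [← map_mul, ← map_mul, mul_comm]
      have e2 : ((P * L f - L f * P) * L (x j) - L (x j) * (P * L f - L f * P)) =
          (P * L (x j) - L (x j) * P) * L f - L f * (P * L (x j) - L (x j) * P) := by
        simp only [sub_mul, mul_sub, mul_assoc, c]
        simp only [← mul_assoc, c]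
        abel
      rw [mul_assoc, e1, e2, hs]
      simp only [mul_add, sub_mul, mul_assoc]
      abel
    have e' := Finset.sum_congr (rfl : (Finset.univ : Finset (Fin r)) = Finset.univ)
      (fun j _ => e j)
    simp only [Finset.sum_add_distrib] at e'
    rw [Finset.sum_sub_distrib, ← Finset.sum_mul, ← Finset.mul_sum] at e'
    have hm := (Nat.cast_commute m (L f)).eq
    calc _ = (m : Module.End k O) * (P * L f - L f * P) + (P * L f - L f * P) -
          ((∑ j, (P * L (x j) - L (x j) * P) * (θ j : Module.End k O)) * L f -
          L f * ∑ j, (P * L (x j) - L (x j) * P) * (θ j : Module.End k O)) := by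
            push_cast
            simp only [add_mul, one_mul, sub_mul, mul_sub, mul_add]
            rw [← mul_assoc (L f), ← hm, mul_assoc, mul_assoc]
            abel
      _ = _ := by rw [e']; abel

/-- In characteristic zero, over a smooth algebra, functions and vector fields generate `𝒟`. -/
theorem mem_words [CharZero k] [Algebra.Smooth k O] (n : ℕ) : ∀ P : D k O,
    toEnd k O P ∈ diffOpLT k O (n + 1) → P ∈ (VFRep.taut k O).words n := by
  obtain ⟨r, x, θ, h⟩ := exists_dual_basis (k := k) (O := O)
  induction n with
  | zero =>
    intro P hP
    refine ⟨toEnd k O P 1, toEnd_injective k O ?_⟩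
    ext f
    have h0 : toEnd k O P * Algebra.lmul k O f - Algebra.lmul k O f * toEnd k O P = 0 := hP f
    have h1 := LinearMap.congr_fun h0 1
    have h2 : toEnd k O P f - f * toEnd k O P 1 = 0 := by simpa using h1
    rw [sub_eq_zero.1 h2]
    exact mul_comm _ _
  | succ n ih =>
    intro P hP
    have h1 := euler_sub_mem h (n + 1) _ hP
    set τ := VFRep.taut k O
    let Q : D k O := ((n + 1 : ℕ) : D k O) * P - ∑ j, (P * τ.c (x j) - τ.c (x j) * P) * τ.t (θ j)
    have hQ : toEnd k O Q ∈ diffOpLT k O (n + 1) := by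
      convert h1 using 1
      simp only [Q, map_sub, map_mul, map_sum, map_natCast]
      rfl
    have h2 : ∀ j, P * τ.c (x j) - τ.c (x j) * P ∈ τ.words n := fun j => ih _ (by
      have := hP (x j)
      rw [map_sub, map_mul, map_mul]
      exact this)
    have h3 : ((n + 1 : ℕ) : D k O) * P ∈ τ.words (n + 1) := by
      have := add_mem (τ.words_le_succ n (ih Q hQ)) (sum_mem fun j _ => τ.mul_t_mem (h2 j) (θ j) :
        ∑ j, (P * τ.c (x j) - τ.c (x j) * P) * τ.t (θ j) ∈ τ.words (n + 1))
      rwa [sub_add_cancel] at this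
    have h4 := τ.c_mul_mem _ (algebraMap k O ((n + 1 : ℕ) : k)⁻¹) _ h3
    rwa [← mul_assoc, ← map_natCast τ.c, ← map_mul, ← map_natCast (algebraMap k O), ← map_mul,
      inv_mul_cancel₀ (Nat.cast_ne_zero.2 (Nat.succ_ne_zero n)), map_one, map_one, one_mul] at h4

theorem exists_mem_words [CharZero k] [Algebra.Smooth k O] (P : D k O) :
    ∃ n, P ∈ (VFRep.taut k O).words n := by
  obtain ⟨n, hn⟩ := exists_order k O P
  exact ⟨n, mem_words n P (diffOpLT_le_succ k O n hn)⟩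

/-- Induction principle: functions and vector fields generate `𝒟`. -/
theorem D_induction [CharZero k] [Algebra.Smooth k O] {p : D k O → Prop}
    (hf : ∀ f, p (fn k O f)) (hv : ∀ θ, p (vf θ)) (ha : ∀ P Q, p P → p Q → p (P + Q))
    (hm : ∀ P Q, p P → p Q → p (P * Q)) (P : D k O) : p P := by
  obtain ⟨n, hn⟩ := exists_mem_words P
  induction n generalizing P with
  | zero => obtain ⟨f, rfl⟩ := hn; exact hf f
  | succ n ih =>
    refine (VFRep.taut k O).words_induction (p := p) ih (fun w hw θ => hm _ _ (ih w hw) (hv θ)) ha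
      (fun v hpv => ?_) P hn
    have := hm _ _ (hf (-1)) hpv
    rwa [map_neg, map_one, neg_one_mul] at this

namespace VFRep

variable {R : Type*} [Ring R] (ρ : VFRep k O R) [CharZero k] [Algebra.Smooth k O]

theorem exists_lift (P : D k O) : ∃ r : R, ∃ n, (P, r) ∈ ((taut k O).prod ρ).words n := by
  refine D_induction (p := fun P => ∃ r : R, ∃ n, (P, r) ∈ ((taut k O).prod ρ).words n)
    (fun f => ⟨ρ.c f, 0, f, rfl⟩) (fun θ => ⟨ρ.t θ, 1, ?_⟩) ?_ ?_ P
  · have := ((taut k O).prod ρ).mul_t_mem (((taut k O).prod ρ).c_mem 1 0) θ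
    rwa [map_one, one_mul] at this
  · rintro P Q ⟨r, m, hm⟩ ⟨s, n, hn⟩
    exact ⟨r + s, max m n, add_mem (words_mono _ (le_max_left m n) hm)
      (words_mono _ (le_max_right m n) hn)⟩
  · rintro P Q ⟨r, m, hm⟩ ⟨s, n, hn⟩
    exact ⟨r * s, m + n, mul_mem_words _ m n _ hn _ hm⟩

theorem lift_unique {P : D k O} {r s : R} {m n : ℕ} (hr : (P, r) ∈ ((taut k O).prod ρ).words m)
    (hs : (P, s) ∈ ((taut k O).prod ρ).words n) : r = s := by
  have h := ρ.fst_zero (max m n) _ (sub_mem (words_mono _ (le_max_left m n) hr)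
      (words_mono _ (le_max_right m n) hs)) (by simp)
  exact sub_eq_zero.1 (congrArg Prod.snd h)

/-- The action of `𝒟` determined by compatible actions of functions and of vector fields. -/
def lift : D k O →+* R where
  toFun P := (ρ.exists_lift P).choose
  map_one' := by
    obtain ⟨n, hn⟩ := (ρ.exists_lift 1).choose_spec
    exact ρ.lift_unique hn (show ((1 : D k O), (1 : R)) ∈ ((taut k O).prod ρ).words 0 from
      ⟨1, by simp⟩)
  map_zero' := by
    obtain ⟨n, hn⟩ := (ρ.exists_lift 0).choose_spec
    exact ρ.lift_unique hn (show ((0 : D k O), (0 : R)) ∈ ((taut k O).prod ρ).words 0 from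
      zero_mem _)
  map_add' P Q := by
    obtain ⟨m, hm⟩ := (ρ.exists_lift P).choose_spec
    obtain ⟨n, hn⟩ := (ρ.exists_lift Q).choose_spec
    obtain ⟨l, hl⟩ := (ρ.exists_lift (P + Q)).choose_spec
    exact ρ.lift_unique hl (add_mem (words_mono _ (le_max_left m n) hm)
      (words_mono _ (le_max_right m n) hn))
  map_mul' P Q := by
    obtain ⟨m, hm⟩ := (ρ.exists_lift P).choose_spec
    obtain ⟨n, hn⟩ := (ρ.exists_lift Q).choose_spec
    obtain ⟨l, hl⟩ := (ρ.exists_lift (P * Q)).choose_spec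
    exact ρ.lift_unique hl (mul_mem_words _ m n _ hn _ hm)

@[simp] theorem lift_fn (f : O) : ρ.lift (fn k O f) = ρ.c f := by
  obtain ⟨n, hn⟩ := (ρ.exists_lift (fn k O f)).choose_spec
  exact ρ.lift_unique hn (show (fn k O f, ρ.c f) ∈ ((taut k O).prod ρ).words 0 from ⟨f, rfl⟩)

@[simp] theorem lift_vf (θ : Derivation k O O) : ρ.lift (vf θ) = ρ.t θ := by
  obtain ⟨n, hn⟩ := (ρ.exists_lift (vf θ)).choose_spec
  have := ((taut k O).prod ρ).mul_t_mem (((taut k O).prod ρ).c_mem 1 0) θ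
  rw [map_one, one_mul] at this
  exact ρ.lift_unique hn this

end VFRep

end DifferentialOperators

section Modules

variable {k : Type u} {O : Type u} [Field k] [CommRing O] [Algebra k O]

/-- A `𝒟`-module is in particular an `O`-module. -/
instance (M : ModuleCat.{u} (D k O)) : Module O M :=
  Module.compHom M (fn k O : O →+* D k O)

theorem fn_smul {M : ModuleCat.{u} (D k O)} (f : O) (m : M) : fn k O f • m = f • m := rfl

theorem map_smulO {M N : ModuleCat.{u} (D k O)} (φ : M →ₗ[D k O] N) (f : O) (m : M) :
    φ (f • m) = f • φ m := φ.map_smul (fn k O f) m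

theorem vf_smul_smul {M : ModuleCat.{u} (D k O)} (θ : Derivation k O O) (f : O) (m : M) :
    vf θ • f • m = f • vf θ • m + θ f • m := by
  have := congrArg (· • m) ((VFRep.taut k O).t_c θ f)
  simp only [mul_smul, add_smul] at this
  exact this

variable (k O) in
/-- The `𝒟`-module `O`. -/
def funMod : ModuleCat.{u} (D k O) :=
  letI : Module (D k O) O := Module.compHom O (toEnd k O : D k O →+* Module.End k O)
  ModuleCat.of (D k O) O

section Tens

variable (M N : ModuleCat.{u} (D k O))

/-- The action of a vector field on `M ⊗[O] N`: `θ (m ⊗ n) = θ m ⊗ n + m ⊗ θ n`. -/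
def tensVF (θ : Derivation k O O) : M ⊗[O] N →+ M ⊗[O] N :=
  TensorProduct.liftAddHom
    (AddMonoidHom.mk' (fun m => AddMonoidHom.mk' (fun n => (vf θ • m) ⊗ₜ[O] n + m ⊗ₜ[O] (vf θ • n))
      (fun n n' => by simp only [smul_add, tmul_add]; abel))
      (fun m m' => by ext n; simp only [smul_add, add_tmul, AddMonoidHom.mk'_apply,
        AddMonoidHom.add_apply]; abel))
    (fun f m n => by
      simp only [AddMonoidHom.mk'_apply, vf_smul_smul, add_tmul, tmul_add, smul_tmul, tmul_smul]
      abel)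

theorem tensVF_tmul (θ : Derivation k O O) (m : M) (n : N) :
    tensVF M N θ (m ⊗ₜ[O] n) = (vf θ • m) ⊗ₜ[O] n + m ⊗ₜ[O] (vf θ • n) := rfl

variable {M N} in
theorem tens_hom_ext {T : Type*} [AddCommMonoid T] {φ ψ : M ⊗[O] N →+ T}
    (h : ∀ m n, φ (m ⊗ₜ[O] n) = ψ (m ⊗ₜ[O] n)) : φ = ψ := by
  ext x
  induction x with
  | zero => rw [map_zero, map_zero]
  | tmul m n => exact h m n
  | add x y hx hy => rw [map_add, map_add, hx, hy]

/-- On `M ⊗[O] N`, functions act as usual, and vector fields by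
`θ (m ⊗ n) = θ m ⊗ n + m ⊗ θ n`. -/
def tensRep : VFRep k O (AddMonoid.End (M ⊗[O] N)) where
  c := Module.toAddMonoidEnd O (M ⊗[O] N)
  t := AddMonoidHom.mk' (tensVF M N) (fun θ η => tens_hom_ext fun m n => by
    have : vf (θ + η) = vf θ + vf η := (VFRep.taut k O).t.map_add θ η
    change tensVF M N (θ + η) (m ⊗ₜ[O] n) = tensVF M N θ (m ⊗ₜ[O] n) + tensVF M N η (m ⊗ₜ[O] n)
    simp only [tensVF_tmul, this, add_smul, add_tmul, tmul_add]
    abel)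
  t_c θ f := tens_hom_ext fun m n => by
    change tensVF M N θ (f • (m ⊗ₜ[O] n)) = f • (tensVF M N θ (m ⊗ₜ[O] n)) + θ f • (m ⊗ₜ[O] n)
    rw [TensorProduct.smul_tmul']
    simp only [tensVF_tmul, vf_smul_smul, add_tmul, smul_add, TensorProduct.smul_tmul']
    abel
  t_smul f θ := tens_hom_ext fun m n => by
    change tensVF M N (f • θ) (m ⊗ₜ[O] n) = f • (tensVF M N θ (m ⊗ₜ[O] n))
    have : vf (f • θ) = fn k O f * vf θ := (VFRep.taut k O).t_smul f θ
    simp only [tensVF_tmul, this, mul_smul, fn_smul, smul_add, TensorProduct.smul_tmul', tmul_smul]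
  t_lie θ η := tens_hom_ext fun m n => by
    change tensVF M N θ (tensVF M N η (m ⊗ₜ[O] n)) =
      tensVF M N η (tensVF M N θ (m ⊗ₜ[O] n)) + tensVF M N ⁅θ, η⁆ (m ⊗ₜ[O] n)
    have h : vf θ * vf η = vf η * vf θ + vf ⁅θ, η⁆ := (VFRep.taut k O).t_lie θ η
    simp only [tensVF_tmul, map_add, ← mul_smul, h, add_smul, add_tmul, tmul_add]
    abel

variable [CharZero k] [Algebra.Smooth k O]

/-- An additive map that commutes with functions and with vector fields is `𝒟`-linear. -/
def mkLinear {M N : ModuleCat.{u} (D k O)} (φ : M →+ N) (hf : ∀ (f : O) m, φ (f • m) = f • φ m)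
    (hv : ∀ (θ : Derivation k O O) m, φ (vf θ • m) = vf θ • φ m) : M →ₗ[D k O] N :=
  { φ with
    map_smul' := fun P => by
      refine D_induction (p := fun P => ∀ m, φ (P • m) = P • φ m) hf hv ?_ ?_ P
      · intro P Q hP hQ m
        rw [add_smul, map_add, hP, hQ, add_smul]
      · intro P Q hP hQ m
        rw [mul_smul, hP, hQ, mul_smul] }

/-- The tensor product over `O` of two `𝒟`-modules, as a `𝒟`-module. -/
def tens : ModuleCat.{u} (D k O) :=
  letI : Module (D k O) (M ⊗[O] N) := Module.compHom _ (tensRep M N).lift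
  ModuleCat.of (D k O) (M ⊗[O] N)

variable {M N}

/-- Pure tensors. -/
def tmul : M →+ N →+ tens M N :=
  AddMonoidHom.mk' (fun m => AddMonoidHom.mk' (fun n => (m ⊗ₜ[O] n : M ⊗[O] N)) (tmul_add m))
    (fun m m' => by ext n; exact add_tmul m m' n)

theorem tmul_smul_left (f : O) (m : M) (n : N) : tmul (f • m) n = f • tmul m n := by
  change (f • m) ⊗ₜ[O] n = (tensRep M N).lift (fn k O f) (m ⊗ₜ[O] n)
  rw [VFRep.lift_fn]
  rfl

theorem tmul_smul_right (f : O) (m : M) (n : N) : tmul m (f • n) = f • tmul m n := by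
  rw [← tmul_smul_left]
  exact (smul_tmul f m n).symm

theorem vf_tmul (θ : Derivation k O O) (m : M) (n : N) :
    vf θ • tmul m n = tmul (vf θ • m) n + tmul m (vf θ • n) := by
  change (tensRep M N).lift (vf θ) (m ⊗ₜ[O] n) = (vf θ • m) ⊗ₜ[O] n + m ⊗ₜ[O] (vf θ • n)
  rw [VFRep.lift_vf]
  rfl

theorem tens_induction {p : tens M N → Prop} (h0 : p 0) (ht : ∀ m n, p (tmul m n))
    (ha : ∀ x y, p x → p y → p (x + y)) (x : tens M N) : p x :=
  TensorProduct.induction_on (motive := p) x h0 ht ha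

/-- Additive maps out of the tensor product. -/
def tensLiftAdd {T : Type*} [AddCommGroup T] (b : M →+ N →+ T)
    (hb : ∀ (f : O) m n, b (f • m) n = b m (f • n)) : tens M N →+ T :=
  (TensorProduct.liftAddHom b hb : M ⊗[O] N →+ T)

@[simp] theorem tensLiftAdd_tmul {T : Type*} [AddCommGroup T] (b : M →+ N →+ T)
    (hb : ∀ (f : O) m n, b (f • m) n = b m (f • n)) (m : M) (n : N) :
    tensLiftAdd b hb (tmul m n) = b m n := rfl

/-- `𝒟`-linear maps out of the tensor product. -/
def tensLift {T : ModuleCat.{u} (D k O)} (b : M →+ N →+ T)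
    (h₁ : ∀ (f : O) m n, b (f • m) n = f • b m n) (h₂ : ∀ (f : O) m n, b m (f • n) = f • b m n)
    (hv : ∀ (θ : Derivation k O O) m n, vf θ • b m n = b (vf θ • m) n + b m (vf θ • n)) :
    tens M N →ₗ[D k O] T :=
  mkLinear (tensLiftAdd b fun f m n => by rw [h₁, h₂])
    (fun f x => by
      induction x using tens_induction with
      | h0 => simp
      | ht m n => rw [← tmul_smul_left, tensLiftAdd_tmul, tensLiftAdd_tmul, h₁]
      | ha x y hx hy => rw [smul_add, map_add, hx, hy, map_add, smul_add])
    (fun θ x => by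
      induction x using tens_induction with
      | h0 => simp
      | ht m n => rw [vf_tmul, map_add, tensLiftAdd_tmul, tensLiftAdd_tmul, tensLiftAdd_tmul, hv]
      | ha x y hx hy => rw [smul_add, map_add, hx, hy, map_add, smul_add])

@[simp] theorem tensLift_tmul {T : ModuleCat.{u} (D k O)} (b : M →+ N →+ T) (h₁ h₂ hv) (m : M)
    (n : N) : tensLift (T := T) b h₁ h₂ hv (tmul m n) = b m n := rfl

theorem tens_ext {T : Type*} [AddCommGroup T] {φ ψ : tens M N →+ T}
    (h : ∀ m n, φ (tmul m n) = ψ (tmul m n)) : φ = ψ := by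
  ext x
  induction x using tens_induction with
  | h0 => simp
  | ht m n => exact h m n
  | ha x y hx hy => rw [map_add, map_add, hx, hy]

/-- The tensor product of two `𝒟`-linear maps. -/
def tensMap {M' N' : ModuleCat.{u} (D k O)} (φ : M →ₗ[D k O] M') (ψ : N →ₗ[D k O] N') :
    tens M N →ₗ[D k O] tens M' N' :=
  tensLift ((tmul.comp φ.toAddMonoidHom).compl₂ ψ.toAddMonoidHom)
    (fun f m n => by
      change tmul (φ (f • m)) (ψ n) = f • tmul (φ m) (ψ n)
      rw [map_smulO, tmul_smul_left])
    (fun f m n => by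
      change tmul (φ m) (ψ (f • n)) = f • tmul (φ m) (ψ n)
      rw [map_smulO, tmul_smul_right])
    (fun θ m n => by
      change vf θ • tmul (φ m) (ψ n) = tmul (φ (vf θ • m)) (ψ n) + tmul (φ m) (ψ (vf θ • n))
      rw [φ.map_smul, ψ.map_smul, vf_tmul])

@[simp] theorem tensMap_tmul {M' N' : ModuleCat.{u} (D k O)} (φ : M →ₗ[D k O] M')
    (ψ : N →ₗ[D k O] N') (m : M) (n : N) : tensMap φ ψ (tmul m n) = tmul (φ m) (ψ n) := rfl

end Tens

/-! ### Complexes of `𝒟`-modules and their tensor product -/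

variable (k O) in
/-- Differential graded `𝒟`-modules: chain complexes of `𝒟`-modules in degrees `≥ 0`. -/
abbrev DGDM := ChainComplex (ModuleCat.{u} (D k O)) ℕ

theorem d_zero_left (K : DGDM k O) (i : ℕ) (x : K.X 0) : (K.d 0 i).hom x = 0 := by
  rw [K.shape 0 i (by simp)]; rfl

theorem d_d (K : DGDM k O) (i j l : ℕ) (x : K.X i) : (K.d j l).hom ((K.d i j).hom x) = 0 := by
  rw [← LinearMap.comp_apply, ← ModuleCat.hom_comp, K.d_comp_d]; rfl

theorem hom_d {K L : DGDM k O} (f : K ⟶ L) (i j : ℕ) (x : K.X i) :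
    (L.d i j).hom ((f.f i).hom x) = (f.f j).hom ((K.d i j).hom x) := by
  rw [← LinearMap.comp_apply, ← ModuleCat.hom_comp, f.comm, ModuleCat.hom_comp,
    LinearMap.comp_apply]

theorem neg_one_pow_pred {i : ℕ} (hi : 0 < i) : (-1 : ℤ) ^ i = -(-1 : ℤ) ^ (i - 1) := by
  obtain ⟨i, rfl⟩ := Nat.exists_eq_succ_of_ne_zero hi.ne'
  simp [pow_succ]

section Complexes

variable [CharZero k] [Algebra.Smooth k O] (K L : DGDM k O)

/-- The degree `n` part `⨁_{i + j = n} Kᵢ ⊗ Lⱼ` of the tensor product of two complexes. -/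
def tensX (n : ℕ) : ModuleCat.{u} (D k O) :=
  ModuleCat.of (D k O) (DirectSum {p : ℕ × ℕ // p.1 + p.2 = n} fun p => tens (K.X p.1.1) (L.X p.1.2))

variable {K L}

/-- The inclusion of a summand `Kᵢ ⊗ Lⱼ → (K ⊗ L)ₙ` for `i + j = n`. -/
def incl' {i j n : ℕ} (h : i + j = n) : tens (K.X i) (L.X j) →ₗ[D k O] tensX K L n :=
  DirectSum.lof (D k O) {p : ℕ × ℕ // p.1 + p.2 = n} (fun p => tens (K.X p.1.1) (L.X p.1.2))
      ⟨(i, j), h⟩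

/-- The inclusion `Kᵢ ⊗ Lⱼ → (K ⊗ L)ₙ` for `i + j = n`, and `0` if `i + j ≠ n`. -/
def incl (i j n : ℕ) : tens (K.X i) (L.X j) →ₗ[D k O] tensX K L n :=
  if h : i + j = n then incl' h else 0

/-- The element `x ⊗ y` of `(K ⊗ L)ₙ`, where `i = |x|`, `j = |y|` and `i + j = n`
(and `0` if `i + j ≠ n`). -/
def elt (i j n : ℕ) : K.X i →+ L.X j →+ tensX K L n :=
  tmul.compr₂ (incl i j n).toAddMonoidHom

theorem incl_tmul (i j n : ℕ) (x : K.X i) (y : L.X j) : incl i j n (tmul x y) = elt i j n x y := rfl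

theorem elt_eq {i j n : ℕ} (h : i + j = n) (x : K.X i) (y : L.X j) :
    elt i j n x y = incl' h (tmul x y) := by
  rw [← incl_tmul, incl, dif_pos h]

theorem elt_of_ne {i j n : ℕ} (h : i + j ≠ n) (x : K.X i) (y : L.X j) : elt i j n x y = 0 := by
  rw [← incl_tmul, incl, dif_neg h]; rfl

theorem elt_smul_left (i j n : ℕ) (f : O) (x : K.X i) (y : L.X j) :
    elt i j n (f • x) y = f • elt i j n x y := by
  rw [← incl_tmul, tmul_smul_left, map_smulO]; rfl

theorem elt_smul_right (i j n : ℕ) (f : O) (x : K.X i) (y : L.X j) :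
    elt i j n x (f • y) = f • elt i j n x y := by
  rw [← incl_tmul, tmul_smul_right, map_smulO]; rfl

theorem vf_elt (i j n : ℕ) (θ : Derivation k O O) (x : K.X i) (y : L.X j) :
    vf θ • elt i j n x y = elt i j n (vf θ • x) y + elt i j n x (vf θ • y) := by
  rw [← incl_tmul, ← map_smul, vf_tmul, map_add]; rfl

theorem tensX_induction {n : ℕ} {p : tensX K L n → Prop} (h0 : p 0)
    (ht : ∀ i j, i + j = n → ∀ x y, p (elt i j n x y)) (ha : ∀ x y, p x → p y → p (x + y))
    (z : tensX K L n) : p z := by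
  refine DirectSum.induction_on (motive := p) z h0 ?_ ha
  rintro ⟨⟨i, j⟩, h⟩ x
  change p (incl' h x)
  induction x using tens_induction with
  | h0 => rw [map_zero]; exact h0
  | ht x y => rw [← elt_eq]; exact ht i j h x y
  | ha x y hx hy => rw [map_add]; exact ha _ _ hx hy

theorem tensX_ext {n : ℕ} {T : Type*} [AddCommGroup T] {φ ψ : tensX K L n →+ T}
    (h : ∀ i j, i + j = n → ∀ x y, φ (elt i j n x y) = ψ (elt i j n x y)) : φ = ψ := by
  refine AddMonoidHom.ext fun z => ?_
  induction z using tensX_induction with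
  | h0 => rw [map_zero, map_zero]
  | ht i j hij x y => exact h i j hij x y
  | ha x y hx hy => rw [map_add, map_add, hx, hy]

theorem tensX_hom_ext {n : ℕ} {T : ModuleCat.{u} (D k O)} {φ ψ : tensX K L n ⟶ T}
    (h : ∀ i j, i + j = n → ∀ x y, φ.hom (elt i j n x y) = ψ.hom (elt i j n x y)) : φ = ψ :=
  ModuleCat.hom_ext (LinearMap.ext fun z => DFunLike.congr_fun
    (tensX_ext (φ := φ.hom.toAddMonoidHom) (ψ := ψ.hom.toAddMonoidHom) h) z)

/-- Additive maps out of `(K ⊗ L)ₙ`. -/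
def tensXLiftAdd (n : ℕ) {T : Type*} [AddCommGroup T] (b : ∀ i j, K.X i →+ L.X j →+ T)
    (hb : ∀ i j (f : O) x y, b i j (f • x) y = b i j x (f • y)) : tensX K L n →+ T :=
  DirectSum.toAddMonoid fun p => tensLiftAdd (b p.1.1 p.1.2) (hb p.1.1 p.1.2)

theorem tensXLiftAdd_elt {n : ℕ} {T : Type*} [AddCommGroup T] (b : ∀ i j, K.X i →+ L.X j →+ T)
    (hb : ∀ i j (f : O) x y, b i j (f • x) y = b i j x (f • y)) {i j : ℕ} (h : i + j = n)
    (x : K.X i) (y : L.X j) : tensXLiftAdd n b hb (elt i j n x y) = b i j x y := by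
  rw [elt_eq h]
  exact (DirectSum.toAddMonoid_of _ _ _).trans (tensLiftAdd_tmul _ _ _ _)

/-- `𝒟`-linear maps out of `(K ⊗ L)ₙ`, given on the summands. -/
def tensXDesc (n : ℕ) {T : ModuleCat.{u} (D k O)} (φ : ∀ i j, tens (K.X i) (L.X j) →ₗ[D k O] T) :
    tensX K L n →ₗ[D k O] T :=
  DirectSum.toModule (D k O) _ T fun p => φ p.1.1 p.1.2

theorem tensXDesc_elt {n : ℕ} {T : ModuleCat.{u} (D k O)}
    (φ : ∀ i j, tens (K.X i) (L.X j) →ₗ[D k O] T) {i j : ℕ} (h : i + j = n)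
    (x : K.X i) (y : L.X j) : tensXDesc n φ (elt i j n x y) = φ i j (tmul x y) := by
  rw [elt_eq h]
  exact DirectSum.toModule_lof _ _ _

variable (K L) in
/-- The differential `d (x ⊗ y) = d x ⊗ y + (-1)^|x| x ⊗ d y` of the tensor product. -/
def tensD (n n' : ℕ) : tensX K L n →ₗ[D k O] tensX K L n' :=
  tensXDesc n fun i j =>
    incl (i - 1) j n' ∘ₗ tensMap (K.d i (i - 1)).hom LinearMap.id +
    (-1 : ℤ) ^ i • (incl i (j - 1) n' ∘ₗ tensMap LinearMap.id (L.d j (j - 1)).hom)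

theorem tensD_elt' {n n' : ℕ} {i j : ℕ} (h : i + j = n) (x : K.X i) (y : L.X j) :
    tensD K L n n' (elt i j n x y) = elt (i - 1) j n' ((K.d i (i - 1)).hom x) y +
      (-1 : ℤ) ^ i • elt i (j - 1) n' x ((L.d j (j - 1)).hom y) := by
  rw [tensD, tensXDesc_elt _ h]
  rfl

theorem elt_d_left {i j n' : ℕ} (h : n' + 1 ≠ i + j) (x : K.X i) (y : L.X j) :
    elt (i - 1) j n' ((K.d i (i - 1)).hom x) y = 0 := by
  rcases Nat.eq_zero_or_pos i with rfl | hi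
  · rw [d_zero_left, map_zero, AddMonoidHom.zero_apply]
  · exact elt_of_ne (by omega) _ _

theorem elt_d_right {i j n' : ℕ} (h : n' + 1 ≠ i + j) (x : K.X i) (y : L.X j) :
    elt i (j - 1) n' x ((L.d j (j - 1)).hom y) = 0 := by
  rcases Nat.eq_zero_or_pos j with rfl | hj
  · rw [d_zero_left, map_zero]
  · exact elt_of_ne (by omega) _ _

theorem tensD_elt {n n' : ℕ} (h' : n' + 1 = n) (i j : ℕ) (x : K.X i) (y : L.X j) :
    tensD K L n n' (elt i j n x y) = elt (i - 1) j n' ((K.d i (i - 1)).hom x) y +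
      (-1 : ℤ) ^ i • elt i (j - 1) n' x ((L.d j (j - 1)).hom y) := by
  by_cases h : i + j = n
  · exact tensD_elt' h x y
  · rw [elt_of_ne h, map_zero, elt_d_left (by omega), elt_d_right (by omega), smul_zero, add_zero]

variable (K L) in
/-- The tensor product (over `O`) of two complexes of `𝒟`-modules. -/
def tensorObj : DGDM k O where
  X := tensX K L
  d n n' := ModuleCat.ofHom (tensD K L n n')
  shape n n' h := by
    have h : n' + 1 ≠ n := h
    refine tensX_hom_ext fun i j hij x y => ?_
    change tensD K L n n' (elt i j n x y) = 0
    rw [tensD_elt' hij, elt_d_left (by omega), elt_d_right (by omega), smul_zero, add_zero]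
  d_comp_d' n n' n'' h h' := by
    have h : n' + 1 = n := h
    have h' : n'' + 1 = n' := h'
    refine tensX_hom_ext fun i j hij x y => ?_
    change tensD K L n' n'' (tensD K L n n' (elt i j n x y)) = 0
    rw [tensD_elt h, map_add, map_zsmul, tensD_elt h', tensD_elt h', d_d, d_d, map_zero,
      AddMonoidHom.zero_apply, zero_add, map_zero, smul_zero, add_zero]
    rcases Nat.eq_zero_or_pos i with rfl | hi
    · simp only [d_zero_left, map_zero, AddMonoidHom.zero_apply, smul_zero, add_zero]
    · rw [neg_one_pow_pred hi, neg_smul, add_neg_cancel]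

/-- The degree `n` component of a morphism out of a tensor product. -/
def homX {N : DGDM k O} (φ : tensorObj K L ⟶ N) (n : ℕ) : tensX K L n →ₗ[D k O] N.X n :=
  (φ.f n).hom

theorem d_homX {N : DGDM k O} (φ : tensorObj K L ⟶ N) (n n' : ℕ) (z : tensX K L n) :
    (N.d n n').hom (homX φ n z) = homX φ n' (tensD K L n n' z) :=
  hom_d φ n n' z

/-- Morphisms out of a tensor product, from their components. -/
def mkHomX {N : DGDM k O} (φ : ∀ n, tensX K L n →ₗ[D k O] N.X n)
    (h : ∀ n n', n' + 1 = n → ∀ i j, i + j = n → ∀ x y,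
      (N.d n n').hom (φ n (elt i j n x y)) = φ n' (tensD K L n n' (elt i j n x y))) :
    tensorObj K L ⟶ N where
  f n := ModuleCat.ofHom (φ n)
  comm' n n' hn := tensX_hom_ext (φ := ModuleCat.ofHom (φ n) ≫ N.d n n')
    (ψ := ModuleCat.ofHom (tensD K L n n') ≫ ModuleCat.ofHom (φ n')) (h n n' hn)

theorem homX_mkHomX {N : DGDM k O} (φ : ∀ n, tensX K L n →ₗ[D k O] N.X n) (h) (n : ℕ) :
    homX (mkHomX φ h) n = φ n := rfl

/-- The bilinear maps `Kᵢ × Lⱼ → Nₙ`, `i + j = n`, that make up a morphism `K ⊗ L ⟶ N`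
(and `0` if `i + j ≠ n`). -/
def bilin {N : DGDM k O} (φ : tensorObj K L ⟶ N) (i j n : ℕ) : K.X i →+ L.X j →+ N.X n :=
  (elt i j n).compr₂ (homX φ n).toAddMonoidHom

theorem bilin_apply {N : DGDM k O} (φ : tensorObj K L ⟶ N) (i j n : ℕ) (x : K.X i) (y : L.X j) :
    bilin φ i j n x y = homX φ n (elt i j n x y) := rfl

theorem bilin_of_ne {N : DGDM k O} (φ : tensorObj K L ⟶ N) {i j n : ℕ} (h : i + j ≠ n) (x : K.X i)
    (y : L.X j) : bilin φ i j n x y = 0 := by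
  rw [bilin_apply, elt_of_ne h, map_zero]

theorem bilin_smul_left {N : DGDM k O} (φ : tensorObj K L ⟶ N) (i j n : ℕ) (f : O) (x : K.X i)
    (y : L.X j) : bilin φ i j n (f • x) y = f • bilin φ i j n x y := by
  rw [bilin_apply, elt_smul_left, map_smulO]; rfl

theorem bilin_smul_right {N : DGDM k O} (φ : tensorObj K L ⟶ N) (i j n : ℕ) (f : O) (x : K.X i)
    (y : L.X j) : bilin φ i j n x (f • y) = f • bilin φ i j n x y := by
  rw [bilin_apply, elt_smul_right, map_smulO]; rfl

theorem vf_bilin {N : DGDM k O} (φ : tensorObj K L ⟶ N) (i j n : ℕ) (θ : Derivation k O O)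
    (x : K.X i) (y : L.X j) :
    vf θ • bilin φ i j n x y = bilin φ i j n (vf θ • x) y + bilin φ i j n x (vf θ • y) := by
  rw [bilin_apply, ← map_smul, vf_elt, map_add]; rfl

theorem d_bilin {N : DGDM k O} (φ : tensorObj K L ⟶ N) {n n' : ℕ} (h : n' + 1 = n) (i j : ℕ)
    (x : K.X i) (y : L.X j) :
    (N.d n n').hom (bilin φ i j n x y) = bilin φ (i - 1) j n' ((K.d i (i - 1)).hom x) y +
      (-1 : ℤ) ^ i • bilin φ i (j - 1) n' x ((L.d j (j - 1)).hom y) := by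
  rw [bilin_apply, d_homX, tensD_elt h, map_add, map_zsmul]
  rfl

theorem tensorObj_hom_ext {N : DGDM k O} {φ ψ : tensorObj K L ⟶ N}
    (h : ∀ i j n, i + j = n → ∀ x y, bilin φ i j n x y = bilin ψ i j n x y) : φ = ψ :=
  HomologicalComplex.hom_ext _ _ fun n => tensX_hom_ext fun i j hij x y => h i j n hij x y

/-- Morphisms out of the tensor product of two complexes, from bilinear data. -/
def tensorLift {N : DGDM k O} (b : ∀ i j n, K.X i →+ L.X j →+ N.X n)
    (h₁ : ∀ i j n (f : O) x y, b i j n (f • x) y = f • b i j n x y)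
    (h₂ : ∀ i j n (f : O) x y, b i j n x (f • y) = f • b i j n x y)
    (hv : ∀ i j n (θ : Derivation k O O) x y,
      vf θ • b i j n x y = b i j n (vf θ • x) y + b i j n x (vf θ • y))
    (hd : ∀ i j n n', i + j = n → n' + 1 = n → ∀ x y, (N.d n n').hom (b i j n x y) =
      b (i - 1) j n' ((K.d i (i - 1)).hom x) y +
      (-1 : ℤ) ^ i • b i (j - 1) n' x ((L.d j (j - 1)).hom y)) : tensorObj K L ⟶ N :=
  mkHomX (fun n => tensXDesc n fun i j => tensLift (b i j n) (h₁ i j n) (h₂ i j n) (hv i j n))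
    (fun n n' h i j hij x y => by
      rw [tensXDesc_elt _ hij, tensLift_tmul, hd i j n n' hij h, tensD_elt h, map_add, map_zsmul]
      congr 1
      · rcases Nat.eq_zero_or_pos i with rfl | hi
        · simp only [d_zero_left, map_zero, AddMonoidHom.zero_apply]
        · rw [tensXDesc_elt _ (by omega), tensLift_tmul]
      · congr 1
        rcases Nat.eq_zero_or_pos j with rfl | hj
        · simp only [d_zero_left, map_zero]
        · rw [tensXDesc_elt _ (by omega), tensLift_tmul])

theorem bilin_tensorLift {N : DGDM k O} (b : ∀ i j n, K.X i →+ L.X j →+ N.X n) (h₁ h₂ hv hd)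
    {i j n : ℕ} (h : i + j = n) (x : K.X i) (y : L.X j) :
    bilin (tensorLift (N := N) b h₁ h₂ hv hd) i j n x y = b i j n x y := by
  rw [bilin_apply, tensorLift, homX_mkHomX, tensXDesc_elt _ h, tensLift_tmul]

/-- The degree `n` part of the tensor product of two chain maps. -/
def tensXMap {K' L' : DGDM k O} (f : K ⟶ K') (g : L ⟶ L') (n : ℕ) :
    tensX K L n →ₗ[D k O] tensX K' L' n :=
  tensXDesc n fun i j => incl i j n ∘ₗ tensMap (f.f i).hom (g.f j).hom

theorem tensXMap_elt {K' L' : DGDM k O} (f : K ⟶ K') (g : L ⟶ L') (i j n : ℕ) (x : K.X i)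
    (y : L.X j) : tensXMap f g n (elt i j n x y) = elt i j n ((f.f i).hom x) ((g.f j).hom y) := by
  by_cases h : i + j = n
  · rw [tensXMap, tensXDesc_elt _ h]; rfl
  · rw [elt_of_ne h, elt_of_ne h, map_zero]

theorem tensXMap_d {K' L' : DGDM k O} (f : K ⟶ K') (g : L ⟶ L') {n n' : ℕ} (h : n' + 1 = n)
    (i j : ℕ) (x : K.X i) (y : L.X j) : tensD K' L' n n' (tensXMap f g n (elt i j n x y)) =
      tensXMap f g n' (tensD K L n n' (elt i j n x y)) := by
  rw [tensXMap_elt, tensD_elt h, tensD_elt h, map_add, map_zsmul, tensXMap_elt, tensXMap_elt,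
    hom_d, hom_d]

/-- The tensor product `x ⊗ y ↦ f x ⊗ g y` of two chain maps. -/
def tensorMap {K' L' : DGDM k O} (f : K ⟶ K') (g : L ⟶ L') : tensorObj K L ⟶ tensorObj K' L' :=
  mkHomX (N := tensorObj K' L') (tensXMap f g) (fun _ _ h i j _ x y => tensXMap_d f g h i j x y)

theorem homX_tensorMap {K' L' : DGDM k O} (f : K ⟶ K') (g : L ⟶ L') (n : ℕ) :
    homX (tensorMap f g) n = tensXMap f g n := rfl

end Complexes

/-! ### Differential graded `𝒟`-algebras and their modules -/

variable [CharZero k] [Algebra.Smooth k O]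

theorem d_bilin' {K L N : DGDM k O} (φ : tensorObj K L ⟶ N) {i j n : ℕ} (h : i + j = n)
    (x : K.X i) (y : L.X j) :
    (N.d n (n - 1)).hom (bilin φ i j n x y) = bilin φ (i - 1) j (n - 1) ((K.d i (i - 1)).hom x) y +
      (-1 : ℤ) ^ i • bilin φ i (j - 1) (n - 1) x ((L.d j (j - 1)).hom y) := by
  rcases Nat.eq_zero_or_pos n with rfl | hn
  · obtain ⟨rfl, rfl⟩ : i = 0 ∧ j = 0 := by omega
    simp only [d_zero_left, map_zero, AddMonoidHom.zero_apply, smul_zero, add_zero]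
  · exact d_bilin φ (by omega) i j x y

variable (k O) in
/-- The unit function, as an element of the `𝒟`-module `O`. -/
def funOne : funMod k O := (1 : O)

variable (k O) in
/-- Differential graded `𝒟`-algebras, i.e. commutative monoids in the symmetric monoidal category
of complexes `(DGDM k O, ⊗, O)`: a complex `A` with morphisms `A ⊗ A ⟶ A` and `O ⟶ A` that satisfy
associativity, unitality and graded commutativity. (A morphism of complexes from `O`, placed in
degree `0`, to a complex in nonnegative degrees is a `𝒟`-linear map to the degree `0` part.) -/
structure DGAlg where
  /-- the underlying complex -/
  cx : DGDM k O
  /-- the multiplication -/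
  mul : tensorObj cx cx ⟶ cx
  /-- the unit -/
  one : funMod k O ⟶ cx.X 0
  mul_assoc : ∀ {i j l p q n : ℕ}, i + j = p → j + l = q → p + l = n →
    ∀ (a : cx.X i) (b : cx.X j) (c : cx.X l),
      bilin mul p l n (bilin mul i j p a b) c = bilin mul i q n a (bilin mul j l q b c)
  one_mul : ∀ {i : ℕ} (a : cx.X i), bilin mul 0 i i (one.hom (funOne k O)) a = a
  mul_comm : ∀ {i j n : ℕ}, i + j = n → ∀ (a : cx.X i) (b : cx.X j),
    bilin mul i j n a b = (-1 : ℤ) ^ (i * j) • bilin mul j i n b a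

/-- Modules in `DGDM k O` over a differential graded `𝒟`-algebra `A`: a complex `M` with a morphism
`A ⊗ M ⟶ M` that satisfies associativity and unitality. -/
structure DGMod (A : DGAlg k O) where
  /-- the underlying complex -/
  cx : DGDM k O
  /-- the action -/
  act : tensorObj A.cx cx ⟶ cx
  mul_act : ∀ {i j l p q n : ℕ}, i + j = p → j + l = q → p + l = n →
    ∀ (a : A.cx.X i) (b : A.cx.X j) (x : cx.X l),
      bilin act p l n (bilin A.mul i j p a b) x = bilin act i q n a (bilin act j l q b x)
  one_act : ∀ {i : ℕ} (x : cx.X i), bilin act 0 i i (A.one.hom (funOne k O)) x = x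

namespace DGMod

variable {A : DGAlg k O}

/-- The action `Aᵢ × Mⱼ → Mₙ`, `i + j = n`. -/
abbrev sm (M : DGMod A) (i j n : ℕ) : A.cx.X i →+ M.cx.X j →+ M.cx.X n := bilin M.act i j n

/-- Morphisms of `A`-modules: chain maps that commute with the actions of `A`. -/
@[ext] structure Hom (M N : DGMod A) where
  /-- the underlying chain map -/
  hom : M.cx ⟶ N.cx
  act_hom : ∀ {i j n : ℕ}, i + j = n → ∀ (a : A.cx.X i) (x : M.cx.X j),
    (hom.f n).hom (M.sm i j n a x) = N.sm i j n a ((hom.f j).hom x)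

instance : Category (DGMod A) where
  Hom := Hom
  id M := ⟨𝟙 M.cx, fun _ _ _ => rfl⟩
  comp f g := ⟨f.hom ≫ g.hom, fun h a x => by
    change (g.hom.f _).hom ((f.hom.f _).hom _) = _
    rw [f.act_hom h, g.act_hom h]; rfl⟩

@[ext] theorem hom_ext {M N : DGMod A} {f g : M ⟶ N} (h : f.hom = g.hom) : f = g := Hom.ext h

@[simp] theorem id_hom (M : DGMod A) : (𝟙 M : M ⟶ M).hom = 𝟙 M.cx := rfl

@[simp] theorem comp_hom {M N P : DGMod A} (f : M ⟶ N) (g : N ⟶ P) :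
    (f ≫ g).hom = f.hom ≫ g.hom := rfl

variable (A) in
/-- The forgetful functor from `A`-modules to complexes of `𝒟`-modules. -/
def forget : DGMod A ⥤ DGDM k O where
  obj M := M.cx
  map f := f.hom

section TensorOver

variable (P M : DGMod A)

/-- The `𝒟`-submodule of `(P ⊗ M)ₙ` generated by the differences
`p ⊗ a m - (-1)^(|a||p|) a p ⊗ m`. -/
def rel (n : ℕ) : Submodule (D k O) (tensX P.cx M.cx n) :=
  Submodule.span (D k O) {z | ∃ (i j l : ℕ) (a : A.cx.X i) (p : P.cx.X j) (m : M.cx.X l),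
    z = elt j (i + l) n p (M.sm i l (i + l) a m) -
      (-1 : ℤ) ^ (i * j) • elt (i + j) l n (P.sm i j (i + j) a p) m}

variable {P M} in
theorem rel_mem {i j l q r n : ℕ} (hq : i + l = q) (hr : i + j = r) (a : A.cx.X i) (p : P.cx.X j)
    (m : M.cx.X l) : elt j q n p (M.sm i l q a m) -
      (-1 : ℤ) ^ (i * j) • elt r l n (P.sm i j r a p) m ∈ rel P M n := by
  subst hq hr
  exact Submodule.subset_span ⟨i, j, l, a, p, m, rfl⟩

theorem rel_le_comap (n n' : ℕ) : rel P M n ≤ (rel P M n').comap (tensD P.cx M.cx n n') := by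
  by_cases h : n' + 1 = n
  swap
  · have : tensD P.cx M.cx n n' = 0 := congrArg ModuleCat.Hom.hom
      ((tensorObj P.cx M.cx).shape n n' h)
    rw [this]
    exact fun z _ => (rel P M n').zero_mem
  refine Submodule.span_le.2 ?_
  rintro _ ⟨i, j, l, a, p, m, rfl⟩
  obtain ⟨q, hq⟩ : ∃ q, i + l = q := ⟨_, rfl⟩
  obtain ⟨r, hr⟩ : ∃ r, i + j = r := ⟨_, rfl⟩
  rw [hq, hr]
  change tensD P.cx M.cx n n' _ ∈ rel P M n'
  rw [map_sub, map_zsmul, tensD_elt h, tensD_elt h, d_bilin' _ hq, d_bilin' _ hr]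
  set da := (A.cx.d i (i - 1)).hom a with hda
  set dp := (P.cx.d j (j - 1)).hom p with hdp
  set dm := (M.cx.d l (l - 1)).hom m with hdm
  have G1 : elt (j - 1) q n' dp (M.sm i l q a m) -
      ((-1 : ℤ) ^ (i * j) * (-1 : ℤ) ^ i) • elt (r - 1) l n' (P.sm i (j - 1) (r - 1) a dp) m ∈
      rel P M n' := by
    rcases Nat.eq_zero_or_pos j with rfl | hj
    · rw [hdp, d_zero_left]
      simp only [map_zero, AddMonoidHom.zero_apply, smul_zero, sub_zero]
      exact zero_mem _
    · have := rel_mem (P := P) (M := M) (n := n') hq (show i + (j - 1) = r - 1 by omega) a dp m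
      have e : (-1 : ℤ) ^ (i * j) * (-1 : ℤ) ^ i = (-1 : ℤ) ^ (i * (j - 1)) := by
        obtain ⟨j, rfl⟩ := Nat.exists_eq_succ_of_ne_zero hj.ne'
        rw [Nat.succ_sub_one, Nat.mul_succ, pow_add, mul_assoc, ← pow_add, ← two_mul, pow_mul]
        simp
      rwa [e]
  have G2 : (-1 : ℤ) ^ j • elt j (q - 1) n' p (M.sm (i - 1) l (q - 1) da m) -
      (-1 : ℤ) ^ (i * j) • elt (r - 1) l n' (P.sm (i - 1) j (r - 1) da p) m ∈ rel P M n' := by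
    rcases Nat.eq_zero_or_pos i with rfl | hi
    · rw [hda, d_zero_left]
      simp only [map_zero, AddMonoidHom.zero_apply, smul_zero, sub_zero]
      exact zero_mem _
    · have := (rel P M n').smul_of_tower_mem ((-1 : ℤ) ^ j)
        (rel_mem (P := P) (M := M) (n := n') (show i - 1 + l = q - 1 by omega)
          (show i - 1 + j = r - 1 by omega) da p m)
      have e : (-1 : ℤ) ^ j * (-1 : ℤ) ^ ((i - 1) * j) = (-1 : ℤ) ^ (i * j) := by
        obtain ⟨i, rfl⟩ := Nat.exists_eq_succ_of_ne_zero hi.ne'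
        rw [Nat.succ_sub_one, Nat.succ_mul, pow_add, _root_.mul_comm]
      rwa [smul_sub, smul_smul, e] at this
  have G3 : ((-1 : ℤ) ^ j * (-1 : ℤ) ^ i) • elt j (q - 1) n' p (M.sm i (l - 1) (q - 1) a dm) -
      ((-1 : ℤ) ^ (i * j) * (-1 : ℤ) ^ r) • elt r (l - 1) n' (P.sm i j r a p) dm ∈ rel P M n' := by
    rcases Nat.eq_zero_or_pos l with rfl | hl
    · rw [hdm, d_zero_left]
      simp only [map_zero, smul_zero, sub_zero]
      exact zero_mem _
    · have := (rel P M n').smul_of_tower_mem ((-1 : ℤ) ^ j * (-1 : ℤ) ^ i)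
        (rel_mem (P := P) (M := M) (n := n') (show i + (l - 1) = q - 1 by omega) hr a p dm)
      rw [smul_sub, smul_smul] at this
      convert this using 3
      rw [← hr, pow_add]; ring
  convert add_mem (add_mem G1 G2) G3 using 1
  simp only [map_add, map_zsmul, AddMonoidHom.add_apply, AddMonoidHom.zsmul_apply, smul_add, mul_smul]
  abel

/-- The degree `n` part of `P ⊗_A M`. -/
def overX (n : ℕ) : ModuleCat.{u} (D k O) :=
  ModuleCat.of (D k O) (tensX P.cx M.cx n ⧸ rel P M n)

variable {P M}

/-- The projection `(P ⊗ M)ₙ → (P ⊗_A M)ₙ`. -/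
def proj (n : ℕ) : tensX P.cx M.cx n →ₗ[D k O] overX P M n := (rel P M n).mkQ

theorem proj_surjective (n : ℕ) : Function.Surjective (proj (P := P) (M := M) n) :=
  Submodule.mkQ_surjective _

theorem proj_eq_zero {n : ℕ} {z : tensX P.cx M.cx n} (hz : z ∈ rel P M n) :
    proj n z = 0 := (Submodule.Quotient.mk_eq_zero _).2 hz

/-- The element `x ⊗ y` of `(P ⊗_A M)ₙ`. -/
def qelt (i j n : ℕ) : P.cx.X i →+ M.cx.X j →+ overX P M n :=
  (elt i j n).compr₂ (proj n).toAddMonoidHom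

theorem qelt_apply (i j n : ℕ) (x : P.cx.X i) (y : M.cx.X j) :
    qelt i j n x y = proj n (elt i j n x y) := rfl

theorem qelt_act {i j l q r n : ℕ} (hq : i + l = q) (hr : i + j = r) (a : A.cx.X i) (p : P.cx.X j)
    (m : M.cx.X l) : qelt j q n p (M.sm i l q a m) =
      (-1 : ℤ) ^ (i * j) • qelt r l n (P.sm i j r a p) m := by
  rw [← sub_eq_zero, qelt_apply, qelt_apply, ← map_zsmul, ← map_sub]
  exact proj_eq_zero (rel_mem hq hr a p m)

theorem overX_induction {n : ℕ} {p : overX P M n → Prop} (h0 : p 0)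
    (ht : ∀ i j, i + j = n → ∀ x y, p (qelt i j n x y)) (ha : ∀ x y, p x → p y → p (x + y))
    (z : overX P M n) : p z := by
  obtain ⟨z, rfl⟩ := proj_surjective n z
  induction z using tensX_induction with
  | h0 => rwa [map_zero]
  | ht i j h x y => exact ht i j h x y
  | ha x y hx hy => rw [map_add]; exact ha _ _ hx hy

theorem overX_ext {n : ℕ} {T : Type*} [AddCommGroup T] {φ ψ : overX P M n →+ T}
    (h : ∀ i j, i + j = n → ∀ x y, φ (qelt i j n x y) = ψ (qelt i j n x y)) : φ = ψ := by
  refine AddMonoidHom.ext fun z => ?_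
  induction z using overX_induction with
  | h0 => rw [map_zero, map_zero]
  | ht i j hij x y => exact h i j hij x y
  | ha x y hx hy => rw [map_add, map_add, hx, hy]

theorem overX_hom_ext {n : ℕ} {T : ModuleCat.{u} (D k O)} {φ ψ : overX P M n ⟶ T}
    (h : ∀ i j, i + j = n → ∀ x y, φ.hom (qelt i j n x y) = ψ.hom (qelt i j n x y)) : φ = ψ :=
  ModuleCat.hom_ext (LinearMap.ext fun z => DFunLike.congr_fun
    (overX_ext (φ := φ.hom.toAddMonoidHom) (ψ := ψ.hom.toAddMonoidHom) h) z)

variable (P M) in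
/-- The differential of `P ⊗_A M`, induced by that of `P ⊗ M`. -/
def overD (n n' : ℕ) : overX P M n →ₗ[D k O] overX P M n' :=
  Submodule.mapQ _ _ (tensD P.cx M.cx n n') (rel_le_comap P M n n')

theorem overD_proj (n n' : ℕ) (z : tensX P.cx M.cx n) :
    overD P M n n' (proj n z) = proj n' (tensD P.cx M.cx n n' z) := rfl

theorem overD_qelt {n n' : ℕ} (h : n' + 1 = n) (i j : ℕ) (x : P.cx.X i) (y : M.cx.X j) :
    overD P M n n' (qelt i j n x y) = qelt (i - 1) j n' ((P.cx.d i (i - 1)).hom x) y +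
      (-1 : ℤ) ^ i • qelt i (j - 1) n' x ((M.cx.d j (j - 1)).hom y) := by
  rw [qelt_apply, overD_proj, tensD_elt h, map_add, map_zsmul]; rfl

variable (P M) in
/-- The complex `P ⊗_A M`: the quotient of `P ⊗ M` by the relations
`p ⊗ a m = (-1)^(|a||p|) a p ⊗ m`. -/
def overCx : DGDM k O where
  X := overX P M
  d n n' := ModuleCat.ofHom (overD P M n n')
  shape n n' h := ModuleCat.hom_ext (LinearMap.ext fun z => by
    obtain ⟨z, rfl⟩ := proj_surjective n z
    have : tensD P.cx M.cx n n' = 0 := congrArg ModuleCat.Hom.hom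
      ((tensorObj P.cx M.cx).shape n n' h)
    exact (overD_proj n n' z).trans (by rw [this, LinearMap.zero_apply, map_zero]; rfl))
  d_comp_d' n n' n'' _ _ := ModuleCat.hom_ext (LinearMap.ext fun z => by
    obtain ⟨z, rfl⟩ := proj_surjective n z
    change overD P M n' n'' (overD P M n n' (proj n z)) = 0
    have : tensD P.cx M.cx n' n'' (tensD P.cx M.cx n n' z) = 0 :=
      d_d (tensorObj P.cx M.cx) n n' n'' z
    rw [overD_proj, overD_proj, this, map_zero])

end TensorOver

section OverAct

variable {P M : DGMod A}

theorem qelt_of_ne {i j n : ℕ} (h : i + j ≠ n) (x : P.cx.X i) (y : M.cx.X j) :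
    qelt i j n x y = 0 := by
  rw [qelt_apply, elt_of_ne h, map_zero]

theorem qelt_smul_left (i j n : ℕ) (f : O) (x : P.cx.X i) (y : M.cx.X j) :
    qelt i j n (f • x) y = f • qelt i j n x y := by
  rw [qelt_apply, elt_smul_left, map_smulO]; rfl

theorem qelt_smul_right (i j n : ℕ) (f : O) (x : P.cx.X i) (y : M.cx.X j) :
    qelt i j n x (f • y) = f • qelt i j n x y := by
  rw [qelt_apply, elt_smul_right, map_smulO]; rfl

theorem vf_qelt (i j n : ℕ) (θ : Derivation k O O) (x : P.cx.X i) (y : M.cx.X j) :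
    vf θ • qelt i j n x y = qelt i j n (vf θ • x) y + qelt i j n x (vf θ • y) := by
  rw [qelt_apply, ← map_smul, vf_elt, map_add]; rfl

variable (P M) in
/-- The map `(x, y) ↦ a x ⊗ y`, `Pᵣ × Mₛ → (P ⊗_A M)ₙ`, for `a : Aᵢ` and `n = i + r + s`. -/
def preBil (i n : ℕ) (a : A.cx.X i) (r s : ℕ) : P.cx.X r →+ M.cx.X s →+ overX P M n :=
  (qelt (i + r) s n).comp (P.sm i r (i + r) a)

theorem preBil_apply (i n : ℕ) (a : A.cx.X i) (r s : ℕ) (x : P.cx.X r) (y : M.cx.X s) :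
    preBil P M i n a r s x y = qelt (i + r) s n (P.sm i r (i + r) a x) y := rfl

theorem preBil_balanced (i n : ℕ) (a : A.cx.X i) (r s : ℕ) (f : O) (x : P.cx.X r)
    (y : M.cx.X s) : preBil P M i n a r s (f • x) y = preBil P M i n a r s x (f • y) := by
  rw [preBil_apply, preBil_apply, bilin_smul_right, qelt_smul_left, qelt_smul_right]

variable (P M) in
/-- The action of `a : Aᵢ` on the first factor, `(P ⊗ M)ⱼ → (P ⊗_A M)ₙ`, `n = i + j`. -/
def preAct (i j n : ℕ) : A.cx.X i →+ tensX P.cx M.cx j →+ overX P M n :=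
  AddMonoidHom.mk' (fun a => tensXLiftAdd j (preBil P M i n a) (preBil_balanced i n a))
    (fun a a' => tensX_ext fun r s h x y => by
      rw [AddMonoidHom.add_apply, tensXLiftAdd_elt _ _ h, tensXLiftAdd_elt _ _ h,
        tensXLiftAdd_elt _ _ h, preBil_apply, preBil_apply, preBil_apply, map_add,
        AddMonoidHom.add_apply, map_add, AddMonoidHom.add_apply])

theorem preAct_elt {i j n r s t : ℕ} (h : r + s = j) (ht : i + r = t) (a : A.cx.X i)
    (x : P.cx.X r) (y : M.cx.X s) :
    preAct P M i j n a (elt r s j x y) = qelt t s n (P.sm i r t a x) y := by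
  subst ht
  exact tensXLiftAdd_elt (preBil P M i n a) (preBil_balanced i n a) h x y

theorem preAct_fn_left (i j n : ℕ) (f : O) (a : A.cx.X i) (z : tensX P.cx M.cx j) :
    preAct P M i j n (f • a) z = f • preAct P M i j n a z := by
  induction z using tensX_induction with
  | h0 => rw [map_zero, map_zero, smul_zero]
  | ht r s h x y =>
    rw [preAct_elt h rfl, preAct_elt h rfl, bilin_smul_left, qelt_smul_left]
  | ha x y hx hy => rw [map_add, map_add, hx, hy, smul_add]

theorem preAct_fn_right (i j n : ℕ) (f : O) (a : A.cx.X i) (z : tensX P.cx M.cx j) :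
    preAct P M i j n a (f • z) = f • preAct P M i j n a z := by
  induction z using tensX_induction with
  | h0 => rw [smul_zero, map_zero, smul_zero]
  | ht r s h x y =>
    rw [← elt_smul_left, preAct_elt h rfl, preAct_elt h rfl, bilin_smul_right, qelt_smul_left]
  | ha x y hx hy => rw [smul_add, map_add, map_add, hx, hy, smul_add]

theorem vf_preAct (i j n : ℕ) (θ : Derivation k O O) (a : A.cx.X i) (z : tensX P.cx M.cx j) :
    vf θ • preAct P M i j n a z =
      preAct P M i j n (vf θ • a) z + preAct P M i j n a (vf θ • z) := by
  induction z using tensX_induction with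
  | h0 => simp only [map_zero, smul_zero, add_zero]
  | ht r s h x y =>
    rw [vf_elt, map_add, preAct_elt h rfl, preAct_elt h rfl, preAct_elt h rfl, preAct_elt h rfl,
      vf_qelt, vf_bilin, map_add, AddMonoidHom.add_apply, add_assoc]
  | ha x y hx hy =>
    simp only [map_add, smul_add, hx, hy]
    abel

theorem preAct_rel {i j n : ℕ} (z : tensX P.cx M.cx j) (hz : z ∈ rel P M j) :
    ∀ a : A.cx.X i, preAct P M i j n a z = 0 := by
  induction hz using Submodule.span_induction with
  | zero => exact fun a => map_zero _
  | add x y _ _ hx hy => exact fun a => by rw [map_add, hx, hy, add_zero]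
  | smul T x _ hx =>
    have key : ∀ T : D k O, ∀ x : tensX P.cx M.cx j, (∀ a : A.cx.X i, preAct P M i j n a x = 0) →
        ∀ a : A.cx.X i, preAct P M i j n a (T • x) = 0 := by
      intro T
      refine D_induction (p := fun T => ∀ x : tensX P.cx M.cx j,
        (∀ a : A.cx.X i, preAct P M i j n a x = 0) →
        ∀ a : A.cx.X i, preAct P M i j n a (T • x) = 0) ?_ ?_ ?_ ?_ T
      · intro f x hx a
        rw [fn_smul, preAct_fn_right, hx, smul_zero]
      · intro θ x hx a
        have := vf_preAct i j n θ a x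
        rw [hx, hx, smul_zero, zero_add] at this
        exact this.symm
      · intro S T hS hT x hx a
        rw [add_smul, map_add, hS x hx, hT x hx, add_zero]
      · intro S T hS hT x hx a
        rw [mul_smul]
        exact hS _ (hT x hx) a
    exact key T x hx
  | mem z hz =>
    obtain ⟨i', j', l, b, p, m, rfl⟩ := hz
    intro a
    by_cases h : i' + j' + l = j
    swap
    · rw [elt_of_ne (by omega), elt_of_ne h, smul_zero, sub_zero, map_zero]
    have h₁ : j' + (i' + l) = j := by omega
    have e₁ : (i + i') + j' = i + (i' + j') := by omega
    have e₂ : i' + (i + j') = i + (i' + j') := by omega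
    have e₃ : i' + i = i + i' := by omega
    rw [map_sub, map_zsmul, preAct_elt h₁ rfl, preAct_elt h rfl, qelt_act rfl e₂,
      ← P.mul_act e₃ rfl e₁, ← P.mul_act rfl rfl e₁, A.mul_comm e₃, map_zsmul,
      AddMonoidHom.zsmul_apply]
    rw [map_zsmul (qelt (i + (i' + j')) l n), AddMonoidHom.zsmul_apply, smul_smul]
    have e : (-1 : ℤ) ^ (i' * (i + j')) * (-1 : ℤ) ^ (i' * i) = (-1 : ℤ) ^ (i' * j') := by
      rw [mul_add, pow_add, mul_right_comm, ← pow_add, ← two_mul, pow_mul]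
      simp
    rw [e, sub_self]

variable (P M) in
/-- The action of `a : Aᵢ` on `P ⊗_A M`, `(P ⊗_A M)ⱼ → (P ⊗_A M)ₙ`, `n = i + j`. -/
def preAct' (i j n : ℕ) : A.cx.X i →+ overX P M j →+ overX P M n :=
  AddMonoidHom.mk' (fun a => QuotientAddGroup.lift (rel P M j).toAddSubgroup (preAct P M i j n a)
    fun z hz => preAct_rel z hz a)
    (fun a a' => overX_ext fun r s h x y => by
      change preAct P M i j n (a + a') (elt r s j x y) =
        preAct P M i j n a (elt r s j x y) + preAct P M i j n a' (elt r s j x y)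
      rw [map_add, AddMonoidHom.add_apply])

theorem preAct'_proj (i j n : ℕ) (a : A.cx.X i) (z : tensX P.cx M.cx j) :
    preAct' P M i j n a (proj j z) = preAct P M i j n a z := rfl

theorem preAct'_qelt {i j n r s t : ℕ} (h : r + s = j) (ht : i + r = t) (a : A.cx.X i)
    (x : P.cx.X r) (y : M.cx.X s) :
    preAct' P M i j n a (qelt r s j x y) = qelt t s n (P.sm i r t a x) y := by
  rw [qelt_apply, preAct'_proj, preAct_elt h ht]

variable (P M) in
/-- The action `a (x ⊗ y) = a x ⊗ y` of `A` on `P ⊗_A M`. -/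
def overAct : tensorObj A.cx (overCx P M) ⟶ overCx P M :=
  tensorLift (K := A.cx) (L := overCx P M) (N := overCx P M) (preAct' P M)
    (fun i j n f a z => by
      obtain ⟨z, rfl⟩ := proj_surjective j z
      exact preAct_fn_left i j n f a z)
    (fun i j n f a z => by
      obtain ⟨z, rfl⟩ := proj_surjective j z
      exact preAct_fn_right i j n f a z)
    (fun i j n θ a z => by
      obtain ⟨z, rfl⟩ := proj_surjective j z
      exact vf_preAct i j n θ a z)
    (fun i j n n' h h' a z => by
      change overD P M n n' (preAct' P M i j n a z) =
        preAct' P M (i - 1) j n' ((A.cx.d i (i - 1)).hom a) z +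
        (-1 : ℤ) ^ i • preAct' P M i (j - 1) n' a (overD P M j (j - 1) z)
      induction z using overX_induction with
      | h0 => simp only [map_zero, smul_zero, add_zero]
      | ha x y hx hy =>
        simp only [map_add, smul_add, hx, hy]
        abel
      | ht r s hrs x y =>
        obtain ⟨t, ht⟩ : ∃ t, i + r = t := ⟨_, rfl⟩
        rw [preAct'_qelt hrs ht, overD_qelt h', d_bilin' _ ht, map_add, AddMonoidHom.add_apply]
        have E₁ : preAct' P M (i - 1) j n' ((A.cx.d i (i - 1)).hom a) (qelt r s j x y) =
            qelt (t - 1) s n' (P.sm (i - 1) r (t - 1) ((A.cx.d i (i - 1)).hom a) x) y := by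
          rcases Nat.eq_zero_or_pos i with rfl | hi
          · simp only [d_zero_left, map_zero, AddMonoidHom.zero_apply]
          · exact preAct'_qelt hrs (by omega) _ x y
        have E₂ : preAct' P M i (j - 1) n' a (overD P M j (j - 1) (qelt r s j x y)) =
            qelt (t - 1) s n' (P.sm i (r - 1) (t - 1) a ((P.cx.d r (r - 1)).hom x)) y +
            (-1 : ℤ) ^ r • qelt t (s - 1) n' (P.sm i r t a x) ((M.cx.d s (s - 1)).hom y) := by
          rcases Nat.eq_zero_or_pos j with rfl | hj
          · obtain ⟨rfl, rfl⟩ : r = 0 ∧ s = 0 := by omega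
            have := (overCx P M).shape 0 (0 - 1) (by simp)
            have : overD P M 0 (0 - 1) = 0 := congrArg ModuleCat.Hom.hom this
            rw [this, LinearMap.zero_apply, map_zero, d_zero_left, d_zero_left]
            simp only [map_zero, AddMonoidHom.zero_apply, smul_zero, add_zero]
          · rw [overD_qelt (by omega), map_add, map_zsmul]
            congr 1
            · rcases Nat.eq_zero_or_pos r with rfl | hr
              · simp only [d_zero_left, map_zero, AddMonoidHom.zero_apply]
              · exact preAct'_qelt (by omega) (by omega) _ _ _
            · congr 1
              rcases Nat.eq_zero_or_pos s with rfl | hs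
              · simp only [d_zero_left, map_zero]
              · exact preAct'_qelt (by omega) ht _ _ _
        rw [E₁, E₂, smul_add, smul_smul, ← pow_add, ht, add_assoc, map_zsmul,
          AddMonoidHom.zsmul_apply])

theorem bilin_overAct {i j n : ℕ} (h : i + j = n) (a : A.cx.X i) (z : overX P M j) :
    bilin (K := A.cx) (L := overCx P M) (N := overCx P M) (overAct P M) i j n a z =
      preAct' P M i j n a z :=
  bilin_tensorLift (K := A.cx) (L := overCx P M) (N := overCx P M) _ _ _ _ _ h a z

variable (P M) in
/-- The tensor product `P ⊗_A M` of two `A`-modules. -/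
def tensorOver : DGMod A where
  cx := overCx P M
  act := overAct P M
  mul_act := by
    intro i j l p q n hp hq hn a b z
    refine (bilin_overAct hn _ z).trans (Eq.trans ?_ (bilin_overAct (by omega) a _).symm)
    refine Eq.trans ?_ (congrArg (preAct' P M i q n a) (bilin_overAct hq b z).symm)
    change overX P M l at z
    induction z using overX_induction with
    | h0 => simp only [map_zero]; rfl
    | ha x y hx hy => simp only [map_add, hx, hy]; rfl
    | ht r s h x y =>
      rw [preAct'_qelt h rfl, preAct'_qelt h rfl, preAct'_qelt (by omega) (show _ = p + r by omega),
        P.mul_act hp rfl rfl]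
  one_act := by
    intro i z
    refine (bilin_overAct (zero_add i) _ z).trans ?_
    change overX P M i at z
    induction z using overX_induction with
    | h0 => simp only [map_zero]; rfl
    | ha x y hx hy => simp only [map_add, hx, hy]; rfl
    | ht r s h x y => rw [preAct'_qelt h (zero_add r), P.one_act]

end OverAct

section Functor

variable {P P' : DGMod A} (f : P ⟶ P') (M : DGMod A)

theorem rel_le_comap_map (n : ℕ) :
    rel P M n ≤ (rel P' M n).comap (tensXMap f.hom (𝟙 M.cx) n) := by
  refine Submodule.span_le.2 ?_
  rintro _ ⟨i, j, l, a, p, m, rfl⟩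
  change tensXMap f.hom (𝟙 M.cx) n _ ∈ rel P' M n
  rw [map_sub, map_zsmul, tensXMap_elt, tensXMap_elt, f.act_hom rfl]
  exact rel_mem rfl rfl a ((f.hom.f j).hom p) m

/-- The degree `n` part of `f ⊗_A M`. -/
def overMapX (n : ℕ) : overX P M n →ₗ[D k O] overX P' M n :=
  Submodule.mapQ _ _ (tensXMap f.hom (𝟙 M.cx) n) (rel_le_comap_map f M n)

theorem overMapX_qelt (i j n : ℕ) (x : P.cx.X i) (y : M.cx.X j) :
    overMapX f M n (qelt i j n x y) = qelt i j n ((f.hom.f i).hom x) y := by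
  change proj n (tensXMap f.hom (𝟙 M.cx) n (elt i j n x y)) = _
  rw [tensXMap_elt]
  rfl

/-- The map `f ⊗_A M`, `x ⊗ y ↦ f x ⊗ y`, as a map of complexes. -/
def overMapCx : overCx P M ⟶ overCx P' M where
  f n := ModuleCat.ofHom (overMapX f M n)
  comm' n n' h := by
    have h : n' + 1 = n := h
    refine overX_hom_ext (φ := ModuleCat.ofHom (overMapX f M n) ≫ (overCx P' M).d n n')
      (ψ := (overCx P M).d n n' ≫ ModuleCat.ofHom (overMapX f M n')) fun i j hij x y => ?_
    change overD P' M n n' (overMapX f M n (qelt i j n x y)) =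
      overMapX f M n' (overD P M n n' (qelt i j n x y))
    rw [overMapX_qelt, overD_qelt h, overD_qelt h, map_add, map_zsmul, overMapX_qelt,
      overMapX_qelt, hom_d]

/-- The morphism of `A`-modules `f ⊗_A M`. -/
def overMap : tensorOver P M ⟶ tensorOver P' M where
  hom := overMapCx f M
  act_hom := by
    intro i j n h a z
    change overX P M j at z
    refine (congrArg (overMapX f M n) (bilin_overAct h a z)).trans
      (Eq.trans ?_ (bilin_overAct h a (overMapX f M j z)).symm)
    induction z using overX_induction with
    | h0 => simp only [map_zero]
    | ha x y hx hy => simp only [map_add, hx, hy]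
    | ht r s hrs x y =>
      rw [overMapX_qelt, preAct'_qelt hrs rfl, preAct'_qelt hrs rfl, overMapX_qelt, f.act_hom rfl]

/-- The functor `- ⊗_A M` on `A`-modules. -/
def tensorRight : DGMod A ⥤ DGMod A where
  obj P := tensorOver P M
  map f := overMap f M
  map_id P := hom_ext (HomologicalComplex.hom_ext _ _ fun n => overX_hom_ext
    fun i j _ x y => overMapX_qelt (𝟙 P) M i j n x y)
  map_comp {P P' P''} f g := hom_ext (HomologicalComplex.hom_ext _ _ fun n => overX_hom_ext
    fun i j _ x y => by
      change overMapX (f ≫ g) M n (qelt i j n x y) =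
        overMapX g M n (overMapX f M n (qelt i j n x y))
      rw [overMapX_qelt, overMapX_qelt, overMapX_qelt]
      rfl)

end Functor

/-! ### Homotopical structure on `A`-modules -/

section Homotopical

open Limits HomotopicalAlgebra

variable (A)

/-- The zero complex. -/
def zeroCx : DGDM k O where
  X _ := ModuleCat.of (D k O) PUnit.{u + 1}
  d _ _ := 0

instance (n : ℕ) : Subsingleton ((zeroCx : DGDM k O).X n) :=
  inferInstanceAs (Subsingleton PUnit.{u + 1})

/-- The zero module. -/
def zeroMod : DGMod A where
  cx := zeroCx
  act := 0
  mul_act _ _ _ _ _ _ := Subsingleton.elim _ _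
  one_act _ := Subsingleton.elim _ _

/-- The zero module is an initial object. -/
def zeroModIsInitial : IsInitial (zeroMod A) :=
  IsInitial.ofUniqueHom
    (fun M => ⟨0, fun {i j n} _ a _ => (map_zero (M.sm i j n a)).symm⟩)
    (fun M f => hom_ext (HomologicalComplex.hom_ext _ _ fun n => ModuleCat.hom_ext
      (LinearMap.ext fun x => by
        have hx : x = (0 : (zeroMod A).cx.X n) :=
          Subsingleton.elim (α := (zeroCx : DGDM k O).X n) _ _
        rw [hx]
        exact map_zero (f.hom.f n).hom)))

instance : HasInitial (DGMod A) := (zeroModIsInitial A).hasInitial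

/-- A morphism of `A`-modules is a weak equivalence if it is a quasi-isomorphism, i.e. if it
induces isomorphisms in homology. -/
instance : CategoryWithWeakEquivalences (DGMod A) where
  weakEquivalences :=
    (HomologicalComplex.quasiIso (ModuleCat.{u} (D k O)) (ComplexShape.down ℕ)).inverseImage
      (forget A)

/-- A morphism of `A`-modules is a fibration if it is surjective in all positive degrees. -/
instance : CategoryWithFibrations (DGMod A) where
  fibrations _ _ f := ∀ n : ℕ, 0 < n → Function.Surjective (f.hom.f n).hom

/-- A morphism of `A`-modules is a cofibration if it has the left lifting property with respect
to the trivial fibrations. -/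
instance : CategoryWithCofibrations (DGMod A) where
  cofibrations := (trivialFibrations (DGMod A)).llp

end Homotopical
end DGMod
end Modules
end DGD

end

/-!
The functor `- ⊗_A M` is studied through its dual. Let `I` be the `𝒟`-module of characters
`𝒟 → ℚ/ℤ`. For an `A`-module `N` and `m ≥ 0`, the `O`-linear maps `N → I[m]` form an `A`-module
`Hom(N, I[m])`, with good truncation in degree `0`, and a `𝒟`-linear map `(N ⊗_A M)ₘ → I` that
vanishes on the boundaries is the same thing as a morphism of `A`-modules `M → Hom(N, I[m])`.

Take for `N` the mapping cone of the weak equivalence `f : P → Q`. It is acyclic, and `I` is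
injective over `O`, because `𝒟` is flat as a right `O`-module (`flat_rightD`, `charMod_injective`);
hence `H = Hom(N, I[m])` is acyclic (`isExact_fiber_homTotalPre`). The projection from the path
module of `H` to `H` is therefore a trivial fibration, so that every morphism from the cofibrant
module `M` to `H` lifts to it, i.e. is homotopic to zero (`TotalMod.IsExact.exists_nullhomotopy`).
Back on the tensor product, every cocycle on the mapping cone of `f ⊗_A M` with values in `I` is a
coboundary, so it kills the cycles (`cocycle_eq_zero`). As the characters of an abelian group
separate its elements, and as they extend to `𝒟`-linear maps to `I`, the cycles of this cone are
boundaries (`exists_overCone_boundary`), and `f ⊗_A M` is a quasi-isomorphism.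

Flatness of `𝒟` comes from Euler's relation: the map `P ↦ ∑ θⱼ [P, xⱼ]` is multiplication by `m` on
operators of order `m`, up to lower order. In characteristic `0` this makes the operators of order
`≤ m` a retract of a finite sum of copies of those of order `≤ m - 1`, hence a projective module.

Two choices keep degrees out of the types. An internal hom lives inside the product of all
`Hom_O(Nᵢ, I)`, where the differential and the action of `A` are defined without reference to
degrees, and its graded pieces are submodules (`TotalMod`). The mapping cone of `f` does not
appear as a module; the maps out of it are the homotopy fiber of the map
`Hom(Q, I[m]) → Hom(P, I[m])`, and the path module is the homotopy fiber of the identity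
(`TotalMod.fiber`).
-/

noncomputable section

/-! ### Flatness of differential operators over functions -/

namespace DGD

section RightModule

variable (k O : Type u) [Field k] [CommRing O] [Algebra k O]

/-- The ring `𝒟`, as an `O`-module by multiplication on the right, `f • P = P f`. -/
def RightD : Type u := D k O

instance : AddCommGroup (RightD k O) := inferInstanceAs (AddCommGroup (D k O))

variable {k O} in
/-- The right `O`-module `𝒟` has the same elements as the ring `𝒟`. -/
def toRightD : D k O ≃+ RightD k O := AddEquiv.refl _

instance : Module O (RightD k O) where
  smul f P := toRightD (toRightD.symm P * fn k O f)
  one_smul P := (congrArg (toRightD.symm P * ·) (map_one (fn k O))).trans (mul_one _)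
  mul_smul f g P := by
    change toRightD.symm P * fn k O (f * g) = toRightD.symm P * fn k O g * fn k O f
    rw [mul_comm f g, map_mul, mul_assoc]
  smul_zero f := zero_mul (fn k O f)
  smul_add f P Q := add_mul (toRightD.symm P) (toRightD.symm Q) (fn k O f)
  add_smul f g P := by
    change toRightD.symm P * fn k O (f + g) =
      toRightD.symm P * fn k O f + toRightD.symm P * fn k O g
    rw [map_add, mul_add]
  zero_smul P := by
    change toRightD.symm P * fn k O 0 = 0
    rw [map_zero, mul_zero]

variable {k O}

theorem toRightD_mul_fn (P : D k O) (f : O) : toRightD (P * fn k O f) = f • toRightD P := rfl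

variable (k O) in
/-- The operators of order `< n`, as a submodule of the right `O`-module `𝒟`. -/
def rightOrderLT (n : ℕ) : Submodule O (RightD k O) where
  carrier := {P | toEnd k O (toRightD.symm P) ∈ diffOpLT k O n}
  add_mem' {P Q} hP hQ := by
    exact add_mem (S := Submodule O (Module.End k O)) hP hQ
  zero_mem' := by
    change toEnd k O (toRightD.symm 0) ∈ diffOpLT k O n
    rw [map_zero, map_zero]
    exact zero_mem _
  smul_mem' f P hP := by
    have := mul_lmul_mem_diffOpLT k O hP f
    rwa [← toEnd_fn, ← map_mul] at this

theorem toRightD_mem {n : ℕ} {P : D k O} :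
    toRightD P ∈ rightOrderLT k O n ↔ toEnd k O P ∈ diffOpLT k O n := Iff.rfl

theorem rightOrderLT_mono : Monotone (rightOrderLT k O) := fun _ _ h _ hP =>
  diffOpLT_mono k O h hP

/-- The commutator with a vector field does not raise the order. -/
theorem der_commutator_mem_diffOpLT (θ : Derivation k O O) (n : ℕ) :
    ∀ Q ∈ diffOpLT k O n, (θ : Module.End k O) * Q - Q * (θ : Module.End k O) ∈
      diffOpLT k O n := by
  induction n with
  | zero =>
    intro Q hQ
    rw [show Q = 0 from hQ, mul_zero, zero_mul, sub_self]
    exact zero_mem _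
  | succ n ih =>
    intro Q hQ f
    have e := sub_eq_iff_eq_add.1 (der_comm θ f)
    have h := sub_mem (ih _ (hQ f)) (hQ (θ f))
    set L := Algebra.lmul k O
    set t : Module.End k O := (θ : Module.End k O)
    convert h using 1
    have e1 : ∀ x, t * (L f * x) = L (θ f) * x + L f * (t * x) := fun x => by
      rw [← mul_assoc, e, add_mul, mul_assoc]
    have e2 : t * L f = L (θ f) + L f * t := e
    simp only [sub_mul, mul_sub, mul_assoc, e1, e2, mul_add]
    abel

/-- The commutator `[P, f]` with a function lowers the order; it is linear for the right
`O`-module structure. -/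
def commFn (n : ℕ) (f : O) : rightOrderLT k O (n + 1) →ₗ[O] rightOrderLT k O n where
  toFun P := ⟨toRightD (toRightD.symm P.1 * fn k O f - fn k O f * toRightD.symm P.1), by
    rw [toRightD_mem, map_sub, map_mul, map_mul]
    exact P.2 f⟩
  map_add' P Q := Subtype.ext <| by
    change toRightD _ = toRightD _ + toRightD _
    rw [← map_add]
    congr 1
    change (toRightD.symm P.1 + toRightD.symm Q.1) * _ - _ * (toRightD.symm P.1 + toRightD.symm Q.1)
      = _
    rw [add_mul, mul_add]
    abel
  map_smul' g P := Subtype.ext <| by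
    change toRightD _ = toRightD (_ * fn k O g)
    congr 1
    change toRightD.symm P.1 * fn k O g * fn k O f - fn k O f * (toRightD.symm P.1 * fn k O g) =
      (toRightD.symm P.1 * fn k O f - fn k O f * toRightD.symm P.1) * fn k O g
    rw [sub_mul, mul_assoc, mul_assoc, mul_assoc, ← map_mul, ← map_mul, mul_comm g f]

/-- Multiplication on the left by a vector field raises the order by one. -/
def vfMul (n : ℕ) (θ : Derivation k O O) :
    rightOrderLT k O (n + 1) →ₗ[O] rightOrderLT k O (n + 2) where
  toFun P := ⟨toRightD (vf θ * toRightD.symm P.1), by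
    rw [toRightD_mem, map_mul]
    have h : (toEnd k O (vf θ)) ∈ diffOpLT k O (1 + 1) := fun f => by
      rw [toEnd_vf, der_comm]
      exact lmul_mem_diffOpLT k O _
    have := mul_mem_diffOpLT k O _ 1 n le_rfl h P.2
    rwa [add_comm 1 n] at this⟩
  map_add' P Q := Subtype.ext (mul_add (vf θ) (toRightD.symm P.1) (toRightD.symm Q.1))
  map_smul' g P := Subtype.ext (mul_assoc (vf θ) (toRightD.symm P.1) (fn k O g)).symm

/-- Euler's relation for the right `O`-module structure: multiplying `[P, xⱼ]` by `θⱼ` on the left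
instead of the right only changes terms of lower order. -/
theorem euler_right_mem {r : ℕ} {x : Fin r → O} {θ : Fin r → Derivation k O O}
    (h : ∀ {M : Type u} [AddCommGroup M] [Module O M] [Module k M]
      [IsScalarTower k O M] (δ : Derivation k O M) (f : O), δ f = ∑ j, θ j f • δ (x j))
    (n : ℕ) (P : rightOrderLT k O (n + 2)) :
    ((n + 1 : ℕ) : O) • (P : RightD k O) -
      ∑ j, (vfMul n (θ j) (commFn (n + 1) (x j) P) : RightD k O) ∈ rightOrderLT k O (n + 1) := by
  obtain ⟨P, hP⟩ := P
  obtain ⟨P, rfl⟩ := toRightD.surjective P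
  rw [toRightD_mem] at hP
  have h1 := euler_sub_mem h (n + 1) _ hP
  have h2 : ∀ j, (θ j : Module.End k O) * (toEnd k O P * Algebra.lmul k O (x j) -
      Algebra.lmul k O (x j) * toEnd k O P) - (toEnd k O P * Algebra.lmul k O (x j) -
      Algebra.lmul k O (x j) * toEnd k O P) * (θ j : Module.End k O) ∈ diffOpLT k O (n + 1) :=
    fun j => der_commutator_mem_diffOpLT (θ j) _ _ (hP (x j))
  have h3 := sub_mem h1 (sum_mem fun j (_ : j ∈ Finset.univ) => h2 j)
  have e : ((n + 1 : ℕ) : O) • toRightD P - ∑ j, (vfMul n (θ j)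
      (commFn (n + 1) (x j) ⟨toRightD P, hP⟩) : RightD k O) =
      toRightD (P * ((n + 1 : ℕ) : D k O) -
        ∑ j, vf (θ j) * (P * fn k O (x j) - fn k O (x j) * P)) := by
    rw [map_sub, map_sum, ← toRightD_mul_fn, map_natCast]
    rfl
  change ((n + 1 : ℕ) : O) • toRightD P - _ ∈ _
  rw [e, toRightD_mem]
  convert h3 using 1
  simp only [map_sub, map_mul, map_sum, map_natCast, toEnd_vf, toEnd_fn]
  rw [Finset.sum_sub_distrib, (Nat.cast_commute (n + 1) (toEnd k O P)).eq]
  abel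

/-- An operator of order `0` is the multiplication by its value at `1`. -/
theorem eq_fn_of_order_zero {P : D k O} (hP : toEnd k O P ∈ diffOpLT k O 1) :
    P = fn k O (toEnd k O P 1) := by
  refine toEnd_injective k O (LinearMap.ext fun f => ?_)
  have h0 : toEnd k O P * Algebra.lmul k O f - Algebra.lmul k O f * toEnd k O P = 0 := hP f
  have h1 : toEnd k O P f - f * toEnd k O P 1 = 0 := by
    simpa using LinearMap.congr_fun h0 1
  rw [sub_eq_zero.1 h1]
  exact mul_comm _ _

theorem exists_mem_rightOrderLT (P : RightD k O) : ∃ n, P ∈ rightOrderLT k O (n + 1) := by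
  obtain ⟨n, hn⟩ := exists_order k O (toRightD.symm P)
  exact ⟨n, diffOpLT_le_succ k O n hn⟩

variable [CharZero k] [Algebra.Smooth k O]

/-- By Euler's relation, the operators of order `≤ n + 1` are a retract of a finite sum of copies
of the operators of order `≤ n`: the maps `P ↦ [P, xⱼ]` and `(Qⱼ) ↦ ∑ θⱼ Qⱼ` compose to the
multiplication by `n + 1`, up to operators of lower order. -/
theorem projective_rightOrderLT (n : ℕ) : Module.Projective O (rightOrderLT k O (n + 1)) := by
  obtain ⟨r, x, θ, h⟩ := exists_dual_basis (k := k) (O := O)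
  induction n with
  | zero =>
    let i : rightOrderLT k O 1 →ₗ[O] O :=
      { toFun P := toEnd k O (toRightD.symm P.1) 1
        map_add' P Q := by
          change toEnd k O (toRightD.symm P.1 + toRightD.symm Q.1) 1 = _
          rw [map_add, LinearMap.add_apply]
        map_smul' f P := by
          obtain ⟨P, hP⟩ := P
          obtain ⟨P, rfl⟩ := toRightD.surjective P
          change toEnd k O (P * fn k O f) 1 = f * toEnd k O P 1
          rw [eq_fn_of_order_zero (P := P) hP, ← map_mul, toEnd_fn, toEnd_fn]
          simp [mul_comm] }
    let s : O →ₗ[O] rightOrderLT k O 1 :=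
      { toFun f := ⟨toRightD (fn k O f), lmul_mem_diffOpLT k O f⟩
        map_add' f g := Subtype.ext (congrArg toRightD (map_add (fn k O) f g))
        map_smul' f g := Subtype.ext (congrArg toRightD (by
          rw [smul_eq_mul, mul_comm, map_mul]; rfl)) }
    exact Module.Projective.of_split i s (LinearMap.ext fun P => Subtype.ext
      (eq_fn_of_order_zero (P := toRightD.symm P.1) P.2).symm)
  | succ n ih =>
    let β : (Fin r → rightOrderLT k O (n + 1)) →ₗ[O] rightOrderLT k O (n + 2) :=
      LinearMap.lsum O _ ℕ fun j => vfMul n (θ j)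
    let α : rightOrderLT k O (n + 2) →ₗ[O] (Fin r → rightOrderLT k O (n + 1)) :=
      LinearMap.pi fun j => commFn (n + 1) (x j)
    have hβα : ∀ P, β (α P) = ∑ j, vfMul n (θ j) (commFn (n + 1) (x j) P) := fun P => by
      simp only [β, LinearMap.lsum_apply, LinearMap.sum_apply]
      rfl
    let ε : rightOrderLT k O (n + 2) →ₗ[O] rightOrderLT k O (n + 1) :=
      LinearMap.codRestrict _ (((n + 1 : ℕ) : O) • (rightOrderLT k O (n + 2)).subtype -
        (rightOrderLT k O (n + 2)).subtype ∘ₗ β ∘ₗ α) (fun P => by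
        have := euler_right_mem h n P
        simp only [LinearMap.sub_apply, LinearMap.smul_apply, LinearMap.comp_apply, hβα, map_sum]
        exact this)
    let ι : rightOrderLT k O (n + 1) →ₗ[O] rightOrderLT k O (n + 2) :=
      Submodule.inclusion (rightOrderLT_mono (Nat.le_succ _))
    let c : O := algebraMap k O ((n + 1 : ℕ) : k)⁻¹
    have hc : c * ((n + 1 : ℕ) : O) = 1 := by
      rw [← map_natCast (algebraMap k O), ← map_mul,
        inv_mul_cancel₀ (Nat.cast_ne_zero.2 (Nat.succ_ne_zero n)), map_one]
    have : Module.Projective O (Fin r → rightOrderLT k O (n + 1)) :=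
      Module.Projective.of_equiv (DFinsupp.linearEquivFunOnFintype (R := O)
        (M := fun _ : Fin r => rightOrderLT k O (n + 1)))
    -- `P = c (β (α P) + ε P)`, where `ε = (n + 1) - β α` takes values in operators of lower order.
    refine Module.Projective.of_split (α.prod ε) (c • (β.coprod ι)) (LinearMap.ext fun P => ?_)
    refine Subtype.ext ?_
    change c • ((β (α P) : RightD k O) + (((n + 1 : ℕ) : O) • (P : RightD k O) - β (α P))) = P
    rw [add_sub_cancel, smul_smul, hc, one_smul]

/-- `𝒟` is flat as a right `O`-module, since it is the increasing union of its projective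
submodules of operators of bounded order. -/
instance flat_rightD : Module.Flat O (RightD k O) := by
  refine Module.Flat.of_forall_isTrivialRelation fun {l f x} hx => ?_
  choose n hn using fun i => exists_mem_rightOrderLT (x i)
  let N := Finset.univ.sup n
  have hN : ∀ i, x i ∈ rightOrderLT k O (N + 1) := fun i =>
    rightOrderLT_mono (Nat.succ_le_succ (Finset.le_sup (Finset.mem_univ i))) (hn i)
  have := projective_rightOrderLT (k := k) (O := O) N
  obtain ⟨m, a, y, h1, h2⟩ := Module.Flat.isTrivialRelation_of_sum_smul_eq_zero
    (f := f) (x := fun i => (⟨x i, hN i⟩ : rightOrderLT k O (N + 1)))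
    (Subtype.ext (by simpa using hx))
  exact ⟨m, a, fun j => y j, fun i => by simpa using congrArg Subtype.val (h1 i), h2⟩

end RightModule

/-! ### A cogenerating injective module -/

section Dual

variable (k O : Type u) [Field k] [CommRing O] [Algebra k O]

/-- The `𝒟`-module of characters `c : 𝒟 → ℚ/ℤ`, where `(P c)(S) = c (S P)`. Its underlying
`O`-module is the character module of the right `O`-module `𝒟`. -/
def charMod : ModuleCat.{u} (D k O) :=
  letI : Module (D k O) (D k O →+ AddCircle (1 : ℚ)) :=
    { smul P c := c.comp (AddMonoidHom.mulRight P)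
      one_smul c := AddMonoidHom.ext fun S => congrArg c (mul_one S)
      mul_smul P Q c := AddMonoidHom.ext fun S => congrArg c (mul_assoc S P Q).symm
      smul_zero _ := rfl
      smul_add _ _ _ := rfl
      add_smul P Q c := AddMonoidHom.ext fun S =>
        (congrArg c (mul_add S P Q)).trans (map_add c _ _)
      zero_smul c := AddMonoidHom.ext fun S => (congrArg c (mul_zero S)).trans (map_zero c) }
  ModuleCat.of (D k O) (D k O →+ AddCircle (1 : ℚ))

variable {k O}

/-- The value of a character at `1`. -/
def evalOne : charMod k O →+ AddCircle (1 : ℚ) := AddMonoidHom.eval (1 : D k O)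

/-- A character of the abelian group `X` corresponds to a `𝒟`-linear map to `charMod`. -/
def coind {X : Type*} [AddCommGroup X] [Module (D k O) X] (c : X →+ AddCircle (1 : ℚ)) :
    X →ₗ[D k O] charMod k O where
  toFun x := (AddMonoidHom.mk' (fun S : D k O => c (S • x)) (fun S T => by
    rw [add_smul, map_add]) : D k O →+ AddCircle (1 : ℚ))
  map_add' x y := AddMonoidHom.ext fun S => by
    change c (S • (x + y)) = c (S • x) + c (S • y)
    rw [smul_add, map_add]
  map_smul' P x := AddMonoidHom.ext fun S => congrArg c (mul_smul S P x).symm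

theorem evalOne_coind {X : Type*} [AddCommGroup X] [Module (D k O) X]
    (c : X →+ AddCircle (1 : ℚ)) (x : X) : evalOne (coind (k := k) (O := O) c x) = c x :=
  congrArg c (one_smul (D k O) x)

theorem coind_eq_zero {X : Type*} [AddCommGroup X] [Module (D k O) X]
    {c : X →+ AddCircle (1 : ℚ)} {x : X} (h : ∀ S : D k O, c (S • x) = 0) :
    coind (k := k) (O := O) c x = 0 :=
  AddMonoidHom.ext h

theorem coind_eq {X Y : Type*} [AddCommGroup X] [Module (D k O) X] [AddCommGroup Y]
    [Module (D k O) Y] {c : X →+ AddCircle (1 : ℚ)} {c' : Y →+ AddCircle (1 : ℚ)} {x : X} {y : Y}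
    (h : ∀ S : D k O, c (S • x) = c' (S • y)) :
    coind (k := k) (O := O) c x = coind (k := k) (O := O) c' y :=
  AddMonoidHom.ext h

/-- The `O`-module underlying `charMod` is injective, because `𝒟` is flat over `O`. -/
theorem charMod_injective [CharZero k] [Algebra.Smooth k O] :
    Module.Injective O (charMod k O) :=
  Module.Flat.iff_characterModule_injective.1 (flat_rightD (k := k) (O := O))

/-- A linear map to an injective module factors through every linear map with smaller kernel. -/
theorem exists_factor_of_ker_le {R : Type u} [CommRing R] {I X Y : Type u} [AddCommGroup I]
    [Module R I] [AddCommGroup X] [Module R X] [AddCommGroup Y] [Module R Y]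
    (hI : Module.Injective R I) (a : X →ₗ[R] Y) (b : X →ₗ[R] I)
    (h : ∀ x, a x = 0 → b x = 0) : ∃ w : Y →ₗ[R] I, ∀ x, w (a x) = b x := by
  have hk : LinearMap.ker a ≤ LinearMap.ker b := h
  obtain ⟨w, hw⟩ := hI.out ((LinearMap.ker a).liftQ a le_rfl)
    (LinearMap.ker_eq_bot.1 (Submodule.ker_liftQ_eq_bot _ _ _ le_rfl))
    ((LinearMap.ker a).liftQ b hk)
  exact ⟨w, fun x => hw (Submodule.Quotient.mk x)⟩

end Dual
end DGD

/-! ### Quasi-isomorphisms in terms of elements -/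

namespace DGD

/-- A map of short complexes of modules is a quasi-isomorphism iff it is injective and surjective on
homology classes. -/
theorem shortComplex_quasiIso_iff {R : Type u} [Ring R] {S T : ShortComplex (ModuleCat.{u} R)}
    (φ : S ⟶ T) : ShortComplex.QuasiIso φ ↔
      (∀ x, S.g.hom x = 0 → ∀ y, T.f.hom y = φ.τ₂.hom x → ∃ x', S.f.hom x' = x) ∧
      (∀ y, T.g.hom y = 0 → ∃ x y', S.g.hom x = 0 ∧ y = T.f.hom y' + φ.τ₂.hom x) := by
  have h1 : ∀ x, T.f.hom (φ.τ₁.hom x) = φ.τ₂.hom (S.f.hom x) := fun x =>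
    LinearMap.congr_fun (congrArg ModuleCat.Hom.hom φ.comm₁₂) x
  have h2 : ∀ x, T.g.hom (φ.τ₂.hom x) = φ.τ₃.hom (S.g.hom x) := fun x =>
    LinearMap.congr_fun (congrArg ModuleCat.Hom.hom φ.comm₂₃) x
  let κ : LinearMap.ker S.g.hom →ₗ[R] LinearMap.ker T.g.hom :=
    φ.τ₂.hom.restrict fun x hx => by
      rw [LinearMap.mem_ker] at hx ⊢
      rw [h2, hx, map_zero]
  have hκ : LinearMap.range S.moduleCatToCycles ≤
      (LinearMap.range T.moduleCatToCycles).comap κ := by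
    rintro _ ⟨x, rfl⟩
    exact ⟨φ.τ₁.hom x, Subtype.ext (h1 x)⟩
  let γ : ShortComplex.LeftHomologyMapData φ S.moduleCatLeftHomologyData
      T.moduleCatLeftHomologyData :=
    { φK := ModuleCat.ofHom κ
      φH := ModuleCat.ofHom (Submodule.mapQ _ _ κ hκ)
      commi := rfl
      commf' := ModuleCat.hom_ext (LinearMap.ext fun x => Subtype.ext (h1 x).symm)
      commπ := rfl }
  rw [γ.quasiIso_iff, ConcreteCategory.isIso_iff_bijective]
  change Function.Bijective (Submodule.mapQ _ _ κ hκ) ↔ _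
  constructor
  · rintro ⟨hi, hs⟩
    refine ⟨fun x hx y hy => ?_, fun y hy => ?_⟩
    · have hz : Submodule.mapQ _ _ κ hκ (Submodule.Quotient.mk ⟨x, hx⟩) = 0 := by
        rw [Submodule.mapQ_apply]
        exact (Submodule.Quotient.mk_eq_zero _).2 ⟨y, Subtype.ext hy⟩
      obtain ⟨x', hx'⟩ := (Submodule.Quotient.mk_eq_zero _).1 (hi (hz.trans (map_zero _).symm))
      exact ⟨x', congrArg Subtype.val hx'⟩
    · obtain ⟨x, hx⟩ := hs (Submodule.Quotient.mk ⟨y, hy⟩)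
      obtain ⟨⟨x, hxk⟩, rfl⟩ := Submodule.Quotient.mk_surjective _ x
      rw [Submodule.mapQ_apply] at hx
      obtain ⟨y', hy'⟩ := (Submodule.Quotient.eq _).1 hx.symm
      refine ⟨x, y', hxk, ?_⟩
      have : T.f.hom y' = y - φ.τ₂.hom x := congrArg Subtype.val hy'
      rw [this, sub_add_cancel]
  · rintro ⟨hi, hs⟩
    refine ⟨(injective_iff_map_eq_zero _).2 fun x hx => ?_, fun y => ?_⟩
    · obtain ⟨⟨x, hxk⟩, rfl⟩ := Submodule.Quotient.mk_surjective _ x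
      rw [Submodule.mapQ_apply] at hx
      obtain ⟨y, hy⟩ := (Submodule.Quotient.mk_eq_zero _).1 hx
      obtain ⟨x', hx'⟩ := hi x hxk y (congrArg Subtype.val hy)
      exact (Submodule.Quotient.mk_eq_zero _).2 ⟨x', Subtype.ext hx'⟩
    · obtain ⟨⟨y, hyk⟩, rfl⟩ := Submodule.Quotient.mk_surjective _ y
      obtain ⟨x, y', hx, hy⟩ := hs y hyk
      refine ⟨Submodule.Quotient.mk ⟨x, hx⟩, ?_⟩
      rw [Submodule.mapQ_apply]
      have hmem : (⟨y, hyk⟩ - κ ⟨x, hx⟩ : LinearMap.ker T.g.hom) ∈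
          LinearMap.range T.moduleCatToCycles := ⟨y', Subtype.ext ?_⟩
      · exact ((Submodule.Quotient.eq _).2 hmem).symm
      change T.f.hom y' = y - φ.τ₂.hom x
      rw [hy, add_sub_cancel_right]

variable {k : Type u} {O : Type u} [Field k] [CommRing O] [Algebra k O]

/-- A map of complexes is a quasi-isomorphism iff it is injective and surjective on homology.
In degree `n = 0` the differential `d n (n - 1)` is zero, so every element counts as a cycle. -/
theorem quasiIso_iff_elements {K L : DGDM k O} (f : K ⟶ L) : QuasiIso f ↔ ∀ n,
    (∀ x, (K.d n (n - 1)).hom x = 0 → ∀ y, (L.d (n + 1) n).hom y = (f.f n).hom x →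
      ∃ x', (K.d (n + 1) n).hom x' = x) ∧
    (∀ y, (L.d n (n - 1)).hom y = 0 → ∃ x y', (K.d n (n - 1)).hom x = 0 ∧
      y = (L.d (n + 1) n).hom y' + (f.f n).hom x) := by
  have h : ∀ n, QuasiIsoAt f n ↔ _ := fun n => (quasiIsoAt_iff' f (n + 1) n (n - 1) (by simp)
    (by cases n <;> simp)).trans (shortComplex_quasiIso_iff _)
  rw [_root_.quasiIso_iff]
  exact forall_congr' h

namespace DGMod

variable [CharZero k] [Algebra.Smooth k O] {A : DGAlg k O}

theorem weakEquivalence_iff {M N : DGMod A} (f : M ⟶ N) :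
    HomotopicalAlgebra.WeakEquivalence f ↔ QuasiIso f.hom :=
  (HomotopicalAlgebra.weakEquivalence_iff f).trans (HomologicalComplex.mem_quasiIso_iff _)

/-- Cofibrant modules have the lifting property with respect to trivial fibrations. -/
theorem exists_lift_of_isCofibrant {M E H : DGMod A} (hM : HomotopicalAlgebra.IsCofibrant M)
    (p : E ⟶ H) (hp : ∀ n : ℕ, 0 < n → Function.Surjective (p.hom.f n).hom)
    (hp' : QuasiIso p.hom) (g : M ⟶ H) : ∃ l : M ⟶ E, l ≫ p = g := by
  have h : (HomotopicalAlgebra.trivialFibrations (DGMod A)).llp (Limits.initial.to M) := hM.mem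
  have : HasLiftingProperty (Limits.initial.to M) p :=
    h p ⟨hp, (HomologicalComplex.mem_quasiIso_iff _).2 hp'⟩
  have sq : CommSq (Limits.initial.to E) (Limits.initial.to M) p g :=
    ⟨Limits.initialIsInitial.hom_ext _ _⟩
  exact ⟨sq.lift, sq.fac_right⟩

end DGMod
end DGD

/-! ### Differential modules graded inside a total space -/

namespace DGD

variable {k : Type u} {O : Type u} [Field k] [CommRing O] [Algebra k O]
variable [CharZero k] [Algebra.Smooth k O]

/-- A differential module over `A` whose graded pieces `piece p` are submodules of one `𝒟`-module
`carrier`, on which the differential and the action of `A` are defined globally. The index `p` is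
only recorded for `p ≥ 0`, but the differential need not vanish on `piece 0`. -/
structure TotalMod (A : DGAlg k O) where
  /-- the total space -/
  carrier : ModuleCat.{u} (D k O)
  /-- the pieces of degree `≥ 0` -/
  piece : ℕ → Submodule (D k O) carrier
  /-- the differential -/
  d : carrier →ₗ[D k O] carrier
  d_d : ∀ x, d (d x) = 0
  d_mem : ∀ {p x}, x ∈ piece (p + 1) → d x ∈ piece p
  /-- the action of `A` -/
  act : ∀ i, A.cx.X i →+ carrier →+ carrier
  act_fn_left : ∀ i (f : O) a x, act i (f • a) x = f • act i a x
  act_fn_right : ∀ i (f : O) a x, act i a (f • x) = f • act i a x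
  vf_act : ∀ i (θ : Derivation k O O) a x,
    vf θ • act i a x = act i (vf θ • a) x + act i a (vf θ • x)
  act_mem : ∀ {i p n}, i + p = n → ∀ a x, x ∈ piece p → act i a x ∈ piece n
  d_act : ∀ i a x, d (act i a x) =
    act (i - 1) ((A.cx.d i (i - 1)).hom a) x + (-1 : ℤ) ^ i • act i a (d x)
  mul_act : ∀ {i j p}, i + j = p → ∀ a b x,
    act p (bilin A.mul i j p a b) x = act i a (act j b x)
  one_act : ∀ x, act 0 (A.one.hom (funOne k O)) x = x

namespace TotalMod

variable {A : DGAlg k O} (T : TotalMod A)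

/-- The degree `p` part of the truncation: `piece p`, with the cycles only for `p = 0`. -/
def trunc (p : ℕ) : Submodule (D k O) T.carrier where
  carrier := {x | x ∈ T.piece p ∧ (p = 0 → T.d x = 0)}
  add_mem' hx hy := ⟨add_mem hx.1 hy.1, fun h => by rw [map_add, hx.2 h, hy.2 h, add_zero]⟩
  zero_mem' := ⟨zero_mem _, fun _ => map_zero _⟩
  smul_mem' c _ hx := ⟨Submodule.smul_mem _ c hx.1, fun h => by rw [map_smul, hx.2 h, smul_zero]⟩

/-- The differential of the truncation (and `0` if `p' + 1 ≠ p`). -/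
def truncD (p p' : ℕ) : T.trunc p →ₗ[D k O] T.trunc p' :=
  if h : p' + 1 = p then
    T.d.restrict fun x hx => ⟨T.d_mem (h ▸ hx.1), fun _ => T.d_d x⟩
  else 0

theorem truncD_of_eq {p p' : ℕ} (h : p' + 1 = p) (x : T.trunc p) :
    (T.truncD p p' x : T.carrier) = T.d x := by
  rw [truncD, dif_pos h]; rfl

theorem truncD_of_ne {p p' : ℕ} (h : p' + 1 ≠ p) : T.truncD p p' = 0 := by
  rw [truncD, dif_neg h]

theorem truncD_pred (p : ℕ) (x : T.trunc p) : (T.truncD p (p - 1) x : T.carrier) = T.d x := by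
  rcases Nat.eq_zero_or_pos p with rfl | hp
  · rw [truncD_of_ne _ (by omega), x.2.2 rfl]; rfl
  · exact T.truncD_of_eq (by omega) x

/-- The complex given by the truncation. -/
def cx : DGDM k O where
  X p := ModuleCat.of (D k O) (T.trunc p)
  d p p' := ModuleCat.ofHom (T.truncD p p')
  shape p p' h := congrArg ModuleCat.ofHom (T.truncD_of_ne h)
  d_comp_d' p p' p'' h h' := ModuleCat.hom_ext (LinearMap.ext fun x => Subtype.ext <| by
    have h : p' + 1 = p := h
    have h' : p'' + 1 = p' := h'
    change (T.truncD p' p'' (T.truncD p p' x) : T.carrier) = 0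
    rw [truncD_of_eq _ h', truncD_of_eq _ h, d_d])

/-- The action of `A` on the truncation (and `0` if `i + p ≠ n`). -/
def truncAct (i p n : ℕ) : A.cx.X i →+ T.trunc p →+ T.trunc n :=
  if h : i + p = n then
    AddMonoidHom.mk' (fun a => AddMonoidHom.mk'
      (fun x => ⟨T.act i a x, T.act_mem h a x x.2.1, fun hn => by
        obtain ⟨rfl, rfl⟩ : i = 0 ∧ p = 0 := by omega
        rw [d_act, d_zero_left, x.2.2 rfl, map_zero, map_zero, AddMonoidHom.zero_apply, smul_zero,
          add_zero]⟩)
      (fun x y => Subtype.ext (map_add (T.act i a) x.1 y.1)))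
      (fun a b => AddMonoidHom.ext fun x => Subtype.ext
        (DFunLike.congr_fun (map_add (T.act i) a b) x.1))
  else 0

theorem truncAct_of_eq {i p n : ℕ} (h : i + p = n) (a : A.cx.X i) (x : T.trunc p) :
    (T.truncAct i p n a x : T.carrier) = T.act i a x := by
  rw [truncAct, dif_pos h]; rfl

theorem truncAct_of_ne {i p n : ℕ} (h : i + p ≠ n) (a : A.cx.X i) (x : T.trunc p) :
    T.truncAct i p n a x = 0 := by
  rw [truncAct, dif_neg h]; rfl

/-- The action of `A` on the truncation, as a morphism of complexes. -/
def actHom : tensorObj A.cx T.cx ⟶ T.cx :=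
  tensorLift (K := A.cx) (L := T.cx) (N := T.cx) T.truncAct
    (fun i j n f a x => by
      by_cases h : i + j = n
      · refine Subtype.ext ?_
        change T.trunc j at x
        change (T.truncAct i j n (f • a) x : T.carrier) = f • (T.truncAct i j n a x : T.carrier)
        rw [truncAct_of_eq _ h, truncAct_of_eq _ h, act_fn_left]
      · exact (T.truncAct_of_ne h _ x).trans
          ((congrArg (fun z : T.cx.X n => f • z) (T.truncAct_of_ne h a x)).trans
            (smul_zero (A := T.cx.X n) f)).symm)
    (fun i j n f a x => by
      by_cases h : i + j = n
      · refine Subtype.ext ?_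
        change T.trunc j at x
        refine (T.truncAct_of_eq h a (fn k O f • x)).trans ?_
        change T.act i a (f • (x : T.carrier)) = f • (T.truncAct i j n a x : T.carrier)
        rw [truncAct_of_eq _ h, act_fn_right]
      · exact (T.truncAct_of_ne h a _).trans
          ((congrArg (fun z : T.cx.X n => f • z) (T.truncAct_of_ne h a x)).trans
            (smul_zero (A := T.cx.X n) f)).symm)
    (fun i j n θ a x => by
      by_cases h : i + j = n
      · refine Subtype.ext ?_
        change T.trunc j at x
        change vf θ • (T.truncAct i j n a x : T.carrier) =
          (T.truncAct i j n (vf θ • a) x : T.carrier) + (T.truncAct i j n a (vf θ • x) : T.carrier)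
        rw [truncAct_of_eq _ h, truncAct_of_eq _ h, truncAct_of_eq _ h, vf_act]
        rfl
      · refine (congrArg (vf θ • ·) (T.truncAct_of_ne h a x)).trans ?_
        refine Eq.trans ?_
          (congrArg₂ (· + ·) (T.truncAct_of_ne h _ x) (T.truncAct_of_ne h a _)).symm
        exact (smul_zero (A := T.trunc n) (vf θ)).trans (add_zero (0 : T.trunc n)).symm)
    (fun i j n n' h h' a x => by
      refine Subtype.ext ?_
      change T.trunc j at x
      change (T.truncD n n' (T.truncAct i j n a x) : T.carrier) =
        (T.truncAct (i - 1) j n' ((A.cx.d i (i - 1)).hom a) x : T.carrier) +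
        (-1 : ℤ) ^ i • (T.truncAct i (j - 1) n' a (T.truncD j (j - 1) x) : T.carrier)
      rw [truncD_of_eq _ h', truncAct_of_eq _ h, d_act]
      congr 1
      · rcases Nat.eq_zero_or_pos i with rfl | hi
        · simp only [d_zero_left, map_zero, AddMonoidHom.zero_apply, ZeroMemClass.coe_zero]
        · rw [truncAct_of_eq _ (by omega)]
      · congr 1
        rcases Nat.eq_zero_or_pos j with rfl | hj
        · rw [x.2.2 rfl, truncD_of_ne _ (by omega), LinearMap.zero_apply, map_zero, map_zero]
          rfl
        · rw [truncAct_of_eq _ (by omega), truncD_pred])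

theorem bilin_actHom {i j n : ℕ} (h : i + j = n) (a : A.cx.X i) (x : T.trunc j) :
    bilin (K := A.cx) (L := T.cx) (N := T.cx) T.actHom i j n a x = T.truncAct i j n a x :=
  bilin_tensorLift (K := A.cx) (L := T.cx) (N := T.cx) _ _ _ _ _ h a x

/-- The truncation in degrees `≥ 0`, as an `A`-module. -/
def toDGMod : DGMod A where
  cx := T.cx
  act := T.actHom
  mul_act := by
    intro i j l p q n hp hq hn a b x
    refine (T.bilin_actHom hn _ x).trans (Eq.trans (Subtype.ext ?_)
      (T.bilin_actHom (by omega) a _).symm)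
    refine (T.truncAct_of_eq hn _ x).trans (Eq.trans ?_ (T.truncAct_of_eq (by omega) a _).symm)
    refine (T.mul_act hp a b x.1).trans (congrArg (T.act i a) ?_)
    exact ((congrArg Subtype.val (T.bilin_actHom hq b x)).trans (T.truncAct_of_eq hq b x)).symm
  one_act := by
    intro i x
    refine (T.bilin_actHom (zero_add i) _ x).trans (Subtype.ext ?_)
    exact (T.truncAct_of_eq (zero_add i) _ x).trans (T.one_act x.1)

/-- The element of the total space given by an element of the truncation. -/
def val (p : ℕ) : T.toDGMod.cx.X p →ₗ[D k O] T.carrier := (T.trunc p).subtype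

theorem val_injective (p : ℕ) : Function.Injective (T.val p) := Subtype.val_injective

theorem val_mem (p : ℕ) (x : T.toDGMod.cx.X p) : T.val p x ∈ T.piece p := x.2.1

theorem exists_val {p : ℕ} {x : T.carrier} (hx : x ∈ T.piece p) (h : p = 0 → T.d x = 0) :
    ∃ y : T.toDGMod.cx.X p, T.val p y = x := ⟨⟨x, hx, h⟩, rfl⟩

theorem val_d {p p' : ℕ} (h : p' + 1 = p) (x : T.toDGMod.cx.X p) :
    T.val p' ((T.toDGMod.cx.d p p').hom x) = T.d (T.val p x) := T.truncD_of_eq h x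

theorem val_d_pred (p : ℕ) (x : T.toDGMod.cx.X p) :
    T.val (p - 1) ((T.toDGMod.cx.d p (p - 1)).hom x) = T.d (T.val p x) := T.truncD_pred p x

theorem val_sm {i p n : ℕ} (h : i + p = n) (a : A.cx.X i) (x : T.toDGMod.cx.X p) :
    T.val n (T.toDGMod.sm i p n a x) = T.act i a (T.val p x) :=
  (congrArg Subtype.val (T.bilin_actHom h a x)).trans (T.truncAct_of_eq h a x)

/-- A morphism to the truncation, from its values in the total space. -/
theorem exists_hom {M : DGMod A} (φ : ∀ j, M.cx.X j →ₗ[D k O] T.carrier)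
    (hφ : ∀ j y, φ j y ∈ T.piece j)
    (hd : ∀ j y, T.d (φ j y) = φ (j - 1) ((M.cx.d j (j - 1)).hom y))
    (ha : ∀ {i j n}, i + j = n → ∀ a y, φ n (M.sm i j n a y) = T.act i a (φ j y)) :
    ∃ g : M ⟶ T.toDGMod, ∀ j y, T.val j ((g.hom.f j).hom y) = φ j y := by
  refine ⟨⟨⟨fun j => ModuleCat.ofHom ((φ j).codRestrict (T.trunc j) fun y =>
    ⟨hφ j y, fun h => ?_⟩), ?_⟩, ?_⟩, fun j y => rfl⟩
  · subst h
    rw [hd, d_zero_left, map_zero]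
  · intro j j' h
    obtain rfl : j' + 1 = j := h
    refine ModuleCat.hom_ext (LinearMap.ext fun y => T.val_injective _ ?_)
    refine (T.val_d rfl _).trans ?_
    exact hd (j' + 1) y
  · intro i j n h a y
    refine T.val_injective _ (Eq.trans ?_ (T.val_sm h a _).symm)
    exact ha h a y

/-- A sufficient condition for the truncation to have zero homology. -/
def IsExact : Prop := ∀ p, ∀ x ∈ T.piece p, T.d x = 0 → ∃ y ∈ T.piece (p + 1), T.d y = x

variable {T} in
theorem IsExact.exists_boundary (hT : T.IsExact) {p : ℕ} {x : T.toDGMod.cx.X p}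
    (hx : (T.toDGMod.cx.d p (p - 1)).hom x = 0) :
    ∃ y, (T.toDGMod.cx.d (p + 1) p).hom y = x := by
  have h : T.d (T.val p x) = 0 := by rw [← val_d_pred, hx, map_zero]
  obtain ⟨y, hy, hyx⟩ := hT p _ (T.val_mem p x) h
  obtain ⟨z, rfl⟩ := T.exists_val hy (fun h => by omega)
  exact ⟨z, T.val_injective p ((T.val_d rfl z).trans hyx)⟩

variable {T} in
theorem IsExact.quasiIso {T' : TotalMod A} (hT : T.IsExact) (hT' : T'.IsExact)
    (f : T.toDGMod ⟶ T'.toDGMod) : QuasiIso f.hom := by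
  refine (quasiIso_iff_elements f.hom).2 fun n => ⟨fun x hx _ _ => hT.exists_boundary hx,
    fun y hy => ?_⟩
  obtain ⟨y', rfl⟩ := hT'.exists_boundary hy
  exact ⟨0, y', map_zero _, by rw [map_zero, add_zero]⟩

/-- Maps between total spaces that respect the gradings, the differentials and the actions. -/
structure Hom (T T' : TotalMod A) where
  /-- the underlying map -/
  map : T.carrier →ₗ[D k O] T'.carrier
  map_mem : ∀ {p x}, x ∈ T.piece p → map x ∈ T'.piece p
  map_d : ∀ x, map (T.d x) = T'.d (map x)
  map_act : ∀ i a x, map (T.act i a x) = T'.act i a (map x)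

/-- The identity. -/
def Hom.id : Hom T T := ⟨LinearMap.id, fun h => h, fun _ => rfl, fun _ _ _ => rfl⟩

variable {T} in
/-- The homotopy fiber of `g`: the pairs `(x, y)` with `y` of degree one more than `x`, with
`d (x, y) = (d x, g x - d y)` and `a (x, y) = (a x, (-1)^|a| a y)`. -/
def fiber {T' : TotalMod A} (g : Hom T T') : TotalMod A where
  carrier := ModuleCat.of (D k O) (T.carrier × T'.carrier)
  piece p := (T.piece p).prod (T'.piece (p + 1))
  d := (T.d ∘ₗ LinearMap.fst (D k O) T.carrier T'.carrier).prod
    (g.map ∘ₗ LinearMap.fst (D k O) T.carrier T'.carrier -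
      T'.d ∘ₗ LinearMap.snd (D k O) T.carrier T'.carrier)
  d_d x := Prod.ext (T.d_d x.1) <| by
    change g.map (T.d x.1) - T'.d (g.map x.1 - T'.d x.2) = 0
    rw [map_sub, d_d, g.map_d, sub_zero, sub_self]
  d_mem hx := ⟨T.d_mem hx.1, sub_mem (g.map_mem hx.1) (T'.d_mem hx.2)⟩
  act i := AddMonoidHom.mk' (fun a => (T.act i a).prodMap ((-1 : ℤ) ^ i • T'.act i a))
    (fun a b => AddMonoidHom.ext fun x => Prod.ext (by simp) (by simp))
  act_fn_left i f a x := Prod.ext (T.act_fn_left i f a x.1) <| by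
    change (-1 : ℤ) ^ i • T'.act i (f • a) x.2 = f • (-1 : ℤ) ^ i • T'.act i a x.2
    rw [act_fn_left, smul_comm]
  act_fn_right i f a x := Prod.ext (T.act_fn_right i f a x.1) <| by
    change (-1 : ℤ) ^ i • T'.act i a (f • x.2) = f • (-1 : ℤ) ^ i • T'.act i a x.2
    rw [act_fn_right, smul_comm]
  vf_act i θ a x := Prod.ext (T.vf_act i θ a x.1) <| by
    change vf θ • (-1 : ℤ) ^ i • T'.act i a x.2 =
      (-1 : ℤ) ^ i • T'.act i (vf θ • a) x.2 + (-1 : ℤ) ^ i • T'.act i a (vf θ • x.2)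
    rw [smul_comm, vf_act, smul_add]
  act_mem h a x hx := ⟨T.act_mem h a x.1 hx.1,
    zsmul_mem (T'.act_mem (by omega) a x.2 hx.2) _⟩
  d_act i a x := Prod.ext (T.d_act i a x.1) <| by
    change g.map (T.act i a x.1) - T'.d ((-1 : ℤ) ^ i • T'.act i a x.2) =
      (-1 : ℤ) ^ (i - 1) • T'.act (i - 1) ((A.cx.d i (i - 1)).hom a) x.2 +
      (-1 : ℤ) ^ i • (-1 : ℤ) ^ i • T'.act i a (g.map x.1 - T'.d x.2)
    have e : (-1 : ℤ) ^ i * (-1 : ℤ) ^ i = 1 := by rw [← mul_pow]; simp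
    rw [map_zsmul, d_act, smul_add, smul_smul, smul_smul, e, one_smul, one_smul, map_sub, g.map_act]
    rcases Nat.eq_zero_or_pos i with rfl | hi
    · rw [d_zero_left, map_zero, AddMonoidHom.zero_apply, smul_zero, zero_add, zero_add]
    · rw [neg_one_pow_pred hi, neg_smul]
      abel
  mul_act h a b x := Prod.ext (T.mul_act h a b x.1) <| by
    rename_i i j p
    change (-1 : ℤ) ^ p • T'.act p _ x.2 =
      (-1 : ℤ) ^ i • T'.act i a ((-1 : ℤ) ^ j • T'.act j b x.2)
    rw [T'.mul_act h, map_zsmul, smul_smul, ← pow_add, h]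
  one_act x := Prod.ext (T.one_act x.1) <| by
    change (-1 : ℤ) ^ 0 • T'.act 0 _ x.2 = x.2
    rw [T'.one_act, pow_zero, one_smul]

/-- The path module, i.e. the homotopy fiber of the identity, is acyclic. -/
theorem isExact_fiber_id : (fiber (Hom.id T)).IsExact := by
  rintro p ⟨x, y⟩ ⟨hx, hy⟩ h
  have h2 : x - T.d y = 0 := congrArg Prod.snd h
  refine ⟨(y, 0), ⟨hy, zero_mem _⟩, Prod.ext (sub_eq_zero.1 h2).symm ?_⟩
  change y - T.d 0 = y
  rw [map_zero, sub_zero]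

/-- The projection from the homotopy fiber of the identity, `(x, y) ↦ x`. -/
theorem exists_fiber_proj : ∃ p : (fiber (Hom.id T)).toDGMod ⟶ T.toDGMod,
    ∀ n x, T.val n ((p.hom.f n).hom x) = ((fiber (Hom.id T)).val n x).1 :=
  T.exists_hom (fun n => LinearMap.fst (D k O) T.carrier T.carrier ∘ₗ (fiber (Hom.id T)).val n)
    (fun n x => ((fiber (Hom.id T)).val_mem n x).1)
    (fun n x => (congrArg Prod.fst ((fiber (Hom.id T)).val_d_pred n x)).symm)
    (fun h a x => congrArg Prod.fst ((fiber (Hom.id T)).val_sm h a x))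

variable {T} in
/-- A morphism from a cofibrant module to a module without homology is homotopic to zero: it lifts
along the trivial fibration `(x, y) ↦ x` from the homotopy fiber of the identity. -/
theorem IsExact.exists_nullhomotopy (hT : T.IsExact) {M : DGMod A}
    (hM : HomotopicalAlgebra.IsCofibrant M) (g : M ⟶ T.toDGMod) :
    ∃ h : ∀ j, M.cx.X j →ₗ[D k O] T.carrier, (∀ j y, h j y ∈ T.piece (j + 1)) ∧
      (∀ j y, T.val j ((g.hom.f j).hom y) =
        T.d (h j y) + h (j - 1) ((M.cx.d j (j - 1)).hom y)) ∧
      (∀ {i j n}, i + j = n → ∀ a y,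
        h n (M.sm i j n a y) = (-1 : ℤ) ^ i • T.act i a (h j y)) := by
  obtain ⟨p, hp⟩ := T.exists_fiber_proj
  let E := fiber (Hom.id T)
  have hsurj : ∀ n : ℕ, 0 < n → Function.Surjective (p.hom.f n).hom := by
    intro n hn x
    obtain ⟨y, hy⟩ := E.exists_val (p := n) (x := (T.val n x, 0)) ⟨T.val_mem n x, zero_mem _⟩
      (fun h => by omega)
    exact ⟨y, T.val_injective n ((hp n y).trans (congrArg Prod.fst hy))⟩
  obtain ⟨l, hl⟩ := DGMod.exists_lift_of_isCofibrant hM p hsurj (T.isExact_fiber_id.quasiIso hT p) g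
  have hg : ∀ j y, T.val j ((g.hom.f j).hom y) = (E.val j ((l.hom.f j).hom y)).1 := fun j y => by
    rw [← hl]
    exact hp j _
  refine ⟨fun j => LinearMap.snd (D k O) T.carrier T.carrier ∘ₗ E.val j ∘ₗ (l.hom.f j).hom,
    fun j y => (E.val_mem j _).2, fun j y => ?_, fun {i j n} h a y => ?_⟩
  · have h1 := congrArg Prod.snd (E.val_d_pred j ((l.hom.f j).hom y))
    rw [hom_d] at h1
    have h2 : (E.val (j - 1) ((l.hom.f (j - 1)).hom ((M.cx.d j (j - 1)).hom y))).2 =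
      (E.val j ((l.hom.f j).hom y)).1 - T.d (E.val j ((l.hom.f j).hom y)).2 := h1
    rw [hg]
    change _ = T.d (E.val j ((l.hom.f j).hom y)).2 + (E.val (j - 1) _).2
    rw [h2, add_sub_cancel]
  · have h1 := congrArg Prod.snd (E.val_sm h a ((l.hom.f j).hom y))
    rw [← l.act_hom h] at h1
    exact h1

end TotalMod
end DGD

namespace DGD

variable {k : Type u} {O : Type u} [Field k] [CommRing O] [Algebra k O]

/-! ### Internal homs -/

section InternalHom

variable (X I : ModuleCat.{u} (D k O))

/-- The action of a vector field on `Hom_O(X, I)`: `(θ φ)(x) = θ (φ x) - φ (θ x)`. -/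
def homVF (θ : Derivation k O O) : (X →ₗ[O] I) →+ (X →ₗ[O] I) :=
  AddMonoidHom.mk' (fun φ =>
    { toFun x := vf θ • φ x - φ (vf θ • x)
      map_add' x y := by simp only [map_add, smul_add]; abel
      map_smul' f x := by
        simp only [map_smul, vf_smul_smul, map_add, RingHom.id_apply, smul_sub]
        abel })
    (fun φ ψ => LinearMap.ext fun x => by
      change vf θ • (φ x + ψ x) - (φ _ + ψ _) = (vf θ • φ x - φ _) + (vf θ • ψ x - ψ _)
      rw [smul_add]; abel)

theorem vf_add_smul {M : ModuleCat.{u} (D k O)} (θ η : Derivation k O O) (x : M) :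
    vf (θ + η) • x = vf θ • x + vf η • x := by
  rw [← add_smul]
  exact congrArg (· • x) ((VFRep.taut k O).t.map_add θ η)

theorem vf_fn_smul {M : ModuleCat.{u} (D k O)} (f : O) (θ : Derivation k O O) (x : M) :
    vf (f • θ) • x = f • vf θ • x := by
  rw [← fn_smul, ← mul_smul]
  exact congrArg (· • x) ((VFRep.taut k O).t_smul f θ)

theorem vf_lie_smul {M : ModuleCat.{u} (D k O)} (θ η : Derivation k O O) (x : M) :
    vf θ • vf η • x = vf η • vf θ • x + vf ⁅θ, η⁆ • x := by
  rw [← mul_smul, ← mul_smul, ← add_smul]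
  exact congrArg (· • x) ((VFRep.taut k O).t_lie θ η)

/-- Functions and vector fields act on `Hom_O(X, I)`. -/
def homRep : VFRep k O (AddMonoid.End (X →ₗ[O] I)) where
  c := Module.toAddMonoidEnd O (X →ₗ[O] I)
  t := AddMonoidHom.mk' (homVF X I) (fun θ η => AddMonoidHom.ext fun φ => LinearMap.ext fun x => by
    change vf (θ + η) • φ x - φ (vf (θ + η) • x) =
      (vf θ • φ x - φ (vf θ • x)) + (vf η • φ x - φ (vf η • x))
    rw [vf_add_smul, vf_add_smul, map_add]
    abel)
  t_c θ f := AddMonoidHom.ext fun φ => LinearMap.ext fun x => by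
    change vf θ • f • φ x - f • φ (vf θ • x) = f • (vf θ • φ x - φ (vf θ • x)) + θ f • φ x
    rw [vf_smul_smul, smul_sub]
    abel
  t_smul f θ := AddMonoidHom.ext fun φ => LinearMap.ext fun x => by
    change vf (f • θ) • φ x - φ (vf (f • θ) • x) = f • (vf θ • φ x - φ (vf θ • x))
    rw [vf_fn_smul, vf_fn_smul, map_smul, smul_sub]
  t_lie θ η := AddMonoidHom.ext fun φ => LinearMap.ext fun x => by
    change vf θ • (vf η • φ x - φ (vf η • x)) - (vf η • φ (vf θ • x) - φ (vf η • vf θ • x)) =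
      (vf η • (vf θ • φ x - φ (vf θ • x)) - (vf θ • φ (vf η • x) - φ (vf θ • vf η • x))) +
      (vf ⁅θ, η⁆ • φ x - φ (vf ⁅θ, η⁆ • x))
    simp only [smul_sub]
    rw [vf_lie_smul θ η (φ x), vf_lie_smul θ η x, map_add]
    abel

variable [CharZero k] [Algebra.Smooth k O]

/-- The `𝒟`-module `Hom_O(X, I)`. -/
def homO : ModuleCat.{u} (D k O) :=
  letI : Module (D k O) (X →ₗ[O] I) := Module.compHom _ (homRep X I).lift
  ModuleCat.of (D k O) (X →ₗ[O] I)

variable {X I}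

/-- The elements of `homO X I` are the `O`-linear maps. -/
def homO.toLin : homO X I ≃+ (X →ₗ[O] I) := AddEquiv.refl _

theorem homO.toLin_smul (f : O) (φ : homO X I) (x : X) :
    homO.toLin (f • φ) x = f • homO.toLin φ x := by
  change ((homRep X I).lift (fn k O f) (homO.toLin φ)) x = f • homO.toLin φ x
  rw [VFRep.lift_fn]
  rfl

theorem homO.toLin_vf (θ : Derivation k O O) (φ : homO X I) (x : X) :
    homO.toLin (vf θ • φ) x = vf θ • homO.toLin φ x - homO.toLin φ (vf θ • x) := by
  change ((homRep X I).lift (vf θ) (homO.toLin φ)) x = _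
  rw [VFRep.lift_vf]
  rfl

theorem homO.ext {φ ψ : homO X I} (h : ∀ x, homO.toLin φ x = homO.toLin ψ x) : φ = ψ :=
  homO.toLin.injective (LinearMap.ext h)

/-- Precomposition with a `𝒟`-linear map. -/
def homO.preComp {Y : ModuleCat.{u} (D k O)} (g : X →ₗ[D k O] Y) : homO Y I →ₗ[D k O] homO X I :=
  mkLinear
    (AddMonoidHom.mk' (fun φ => homO.toLin.symm
      { toFun x := homO.toLin φ (g x)
        map_add' x y := by rw [map_add, map_add]
        map_smul' f x := by rw [map_smulO, map_smul, RingHom.id_apply] })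
      (fun _ _ => rfl))
    (fun f φ => homO.ext fun x => by
      rw [homO.toLin_smul]
      exact homO.toLin_smul f φ (g x))
    (fun θ φ => homO.ext fun x => by
      rw [homO.toLin_vf]
      refine (homO.toLin_vf θ φ (g x)).trans ?_
      rw [← g.map_smul]
      rfl)

end InternalHom

section HomProd

variable [CharZero k] [Algebra.Smooth k O]

/-- The `𝒟`-module `∏ᵢ Hom_O(Kᵢ, I)`. -/
def homProd (K : DGDM k O) (I : ModuleCat.{u} (D k O)) : ModuleCat.{u} (D k O) :=
  ModuleCat.of (D k O) (∀ i, homO (K.X i) I)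

variable {K L : DGDM k O} {I : ModuleCat.{u} (D k O)}

/-- The value at `x : Kᵢ` of a family of maps. -/
def homEv (i : ℕ) (x : K.X i) : homProd K I →+ I :=
  AddMonoidHom.mk' (fun φ : ∀ i, homO (K.X i) I => homO.toLin (φ i) x) (fun _ _ => rfl)

/-- The component `Kᵢ → I` of a family of maps. -/
def homComp (i : ℕ) (φ : homProd K I) : K.X i →ₗ[O] I :=
  homO.toLin ((φ : ∀ i, homO (K.X i) I) i)

theorem homComp_apply (i : ℕ) (φ : homProd K I) (x : K.X i) : homComp i φ x = homEv i x φ := rfl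

theorem homEv_add (i : ℕ) (x y : K.X i) (φ : homProd K I) :
    homEv i (x + y) φ = homEv i x φ + homEv i y φ :=
  map_add (homComp i φ) x y

theorem homEv_zsmul (i : ℕ) (c : ℤ) (x : K.X i) (φ : homProd K I) :
    homEv i (c • x) φ = c • homEv i x φ :=
  map_zsmul (homComp i φ) c x

theorem homEv_zero (i : ℕ) (φ : homProd K I) : homEv i (0 : K.X i) φ = 0 := map_zero (homComp i φ)

theorem homEv_smul_left (i : ℕ) (f : O) (x : K.X i) (φ : homProd K I) :
    homEv i (f • x) φ = f • homEv i x φ := map_smul (homComp i φ) f x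

theorem homEv_smul_right (i : ℕ) (f : O) (x : K.X i) (φ : homProd K I) :
    homEv i x (f • φ) = f • homEv i x φ := homO.toLin_smul f _ x

theorem homEv_vf (i : ℕ) (θ : Derivation k O O) (x : K.X i) (φ : homProd K I) :
    homEv i x (vf θ • φ) = vf θ • homEv i x φ - homEv i (vf θ • x) φ := homO.toLin_vf θ _ x

theorem homProd_ext {φ ψ : homProd K I} (h : ∀ i x, homEv i x φ = homEv i x ψ) : φ = ψ :=
  funext fun i => homO.ext fun x => h i x

/-- The family of maps given by its components. -/
def ofHomComp (φ : ∀ i, K.X i →ₗ[O] I) : homProd K I :=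
  fun i => homO.toLin.symm (φ i)

theorem homEv_ofHomComp (φ : ∀ i, K.X i →ₗ[O] I) (i : ℕ) (x : K.X i) :
    homEv i x (ofHomComp φ) = φ i x := rfl

/-- The families of maps that vanish on `Kᵢ` for `i + p ≠ m`, i.e. the maps `K → I[m]` of
degree `p`. -/
def homPiece (K : DGDM k O) (I : ModuleCat.{u} (D k O)) (m p : ℕ) :
    Submodule (D k O) (homProd K I) where
  carrier := {φ | ∀ i, i + p ≠ m → (φ : ∀ i, homO (K.X i) I) i = 0}
  add_mem' {φ ψ} hφ hψ i hi := by
    change (φ : ∀ i, homO (K.X i) I) i + (ψ : ∀ i, homO (K.X i) I) i = 0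
    rw [hφ i hi, hψ i hi, add_zero]
  zero_mem' _ _ := rfl
  smul_mem' c φ hφ i hi := by
    change c • (φ : ∀ i, homO (K.X i) I) i = 0
    rw [hφ i hi, smul_zero]

theorem mem_homPiece {m p : ℕ} {φ : homProd K I} :
    φ ∈ homPiece K I m p ↔ ∀ i, i + p ≠ m → ∀ x, homEv i x φ = 0 :=
  forall_congr' fun _ => forall_congr' fun _ =>
    ⟨fun h x => congrArg (fun φ => homO.toLin φ x) h, fun h => homO.ext h⟩

/-- The differential `(d φ)(x) = (-1)^(|x| + 1) φ (d x)`. -/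
def homD (K : DGDM k O) (I : ModuleCat.{u} (D k O)) : homProd K I →ₗ[D k O] homProd K I :=
  LinearMap.pi (φ := fun i => homO (K.X i) I) fun i =>
    (-1 : ℤ) ^ (i + 1) • (homO.preComp (K.d i (i - 1)).hom ∘ₗ
      LinearMap.proj (φ := fun i => homO (K.X i) I) (i - 1))

theorem homEv_homD (i : ℕ) (x : K.X i) (φ : homProd K I) :
    homEv i x (homD K I φ) = (-1 : ℤ) ^ (i + 1) • homEv (i - 1) ((K.d i (i - 1)).hom x) φ := rfl

/-- Precomposition with a map of complexes. -/
def homPre (f : K ⟶ L) : homProd L I →ₗ[D k O] homProd K I :=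
  LinearMap.pi (φ := fun i => homO (K.X i) I) fun i =>
    homO.preComp (f.f i).hom ∘ₗ LinearMap.proj (φ := fun i => homO (L.X i) I) i

theorem homEv_homPre (f : K ⟶ L) (i : ℕ) (x : K.X i) (φ : homProd L I) :
    homEv i x (homPre f φ) = homEv i ((f.f i).hom x) φ := rfl

/-- The sign operator `φ ↦ (x ↦ (-1)^|x| φ x)`. -/
def homSign (K : DGDM k O) (I : ModuleCat.{u} (D k O)) : homProd K I →ₗ[D k O] homProd K I :=
  LinearMap.pi (φ := fun i => homO (K.X i) I) fun i =>
    (-1 : ℤ) ^ i • LinearMap.proj (φ := fun i => homO (K.X i) I) i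

theorem homEv_homSign (i : ℕ) (x : K.X i) (φ : homProd K I) :
    homEv i x (homSign K I φ) = (-1 : ℤ) ^ i • homEv i x φ := rfl

end HomProd

section HomTotal

variable [CharZero k] [Algebra.Smooth k O] {A : DGAlg k O}

/-- The action `(a φ)(x) = (-1)^(|a| |x|) φ (a x)`. -/
def homAct (N : DGMod A) (I : ModuleCat.{u} (D k O)) (i : ℕ) :
    A.cx.X i →+ homProd N.cx I →+ homProd N.cx I :=
  AddMonoidHom.mk' (fun a => AddMonoidHom.mk' (fun φ => ofHomComp fun l =>
      (-1 : ℤ) ^ (i * l) • (homComp (i + l) φ ∘ₗ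
        { toFun x := N.sm i l (i + l) a x
          map_add' := map_add _
          map_smul' f x := bilin_smul_right N.act i l (i + l) f a x }))
    (fun φ ψ => homProd_ext fun l x => by
      rw [map_add]
      change (-1 : ℤ) ^ (i * l) • homEv (i + l) _ (φ + ψ) =
        (-1 : ℤ) ^ (i * l) • homEv (i + l) _ φ + (-1 : ℤ) ^ (i * l) • homEv (i + l) _ ψ
      rw [map_add, smul_add]))
    (fun a b => AddMonoidHom.ext fun φ => homProd_ext fun l x => by
      rw [AddMonoidHom.add_apply, map_add]
      change (-1 : ℤ) ^ (i * l) • homEv (i + l) (N.sm i l (i + l) (a + b) x) φ =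
        (-1 : ℤ) ^ (i * l) • homEv (i + l) (N.sm i l (i + l) a x) φ +
        (-1 : ℤ) ^ (i * l) • homEv (i + l) (N.sm i l (i + l) b x) φ
      rw [map_add, AddMonoidHom.add_apply, homEv_add, smul_add])

variable {N N' : DGMod A} {I : ModuleCat.{u} (D k O)}

theorem homEv_homAct {i l n : ℕ} (h : i + l = n) (a : A.cx.X i) (x : N.cx.X l)
    (φ : homProd N.cx I) :
    homEv l x (homAct N I i a φ) = (-1 : ℤ) ^ (i * l) • homEv n (N.sm i l n a x) φ := by
  subst h
  rfl

variable (N I) in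
/-- The `A`-module of maps `N → I[m]`. -/
def homTotal (m : ℕ) : TotalMod A where
  carrier := homProd N.cx I
  piece := homPiece N.cx I m
  d := homD N.cx I
  d_d φ := homProd_ext fun i x => by
    rw [homEv_homD, homEv_homD, d_d, homEv_zero, smul_zero, smul_zero, map_zero]
  d_mem {p φ} hφ := mem_homPiece.2 fun i hi x => by
    rw [homEv_homD]
    rcases Nat.eq_zero_or_pos i with rfl | hi'
    · rw [d_zero_left, homEv_zero, smul_zero]
    · rw [mem_homPiece.1 hφ (i - 1) (by omega), smul_zero]
  act := homAct N I
  act_fn_left i f a φ := homProd_ext fun l x => by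
    rw [homEv_smul_right, homEv_homAct rfl, homEv_homAct rfl, bilin_smul_left,
      homEv_smul_left, smul_comm]
  act_fn_right i f a φ := homProd_ext fun l x => by
    rw [homEv_smul_right, homEv_homAct rfl, homEv_homAct rfl, homEv_smul_right, smul_comm]
  vf_act i θ a φ := homProd_ext fun l x => by
    rw [homEv_vf, map_add, homEv_homAct rfl, homEv_homAct rfl, homEv_homAct rfl,
      homEv_homAct rfl, homEv_vf, vf_bilin, homEv_add, smul_comm]
    simp only [smul_sub, smul_add]
    abel
  act_mem {i p n} h a φ hφ := mem_homPiece.2 fun l hl x => by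
    rw [homEv_homAct rfl, mem_homPiece.1 hφ _ (by omega), smul_zero]
  d_act i a φ := homProd_ext fun l x => by
    obtain ⟨n, hn⟩ : ∃ n, i + l = n := ⟨_, rfl⟩
    rw [homEv_homD, map_add, map_zsmul, homEv_homAct hn, homEv_homD, d_bilin' _ hn,
      homEv_add, homEv_zsmul]
    have E₁ : homEv l x (homAct N I (i - 1) ((A.cx.d i (i - 1)).hom a) φ) =
        ((-1 : ℤ) ^ (i * l) * (-1) ^ l) •
          homEv (n - 1) (N.sm (i - 1) l (n - 1) ((A.cx.d i (i - 1)).hom a) x) φ := by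
      rcases Nat.eq_zero_or_pos i with rfl | hi
      · rw [d_zero_left, map_zero, map_zero, AddMonoidHom.zero_apply, AddMonoidHom.zero_apply,
          homEv_zero, smul_zero, map_zero]
      · rw [homEv_homAct (show i - 1 + l = n - 1 by omega)]
        congr 1
        obtain ⟨i, rfl⟩ := Nat.exists_eq_succ_of_ne_zero hi.ne'
        rw [Nat.succ_sub_one, Nat.succ_mul, pow_add, mul_assoc, ← pow_add, ← two_mul, pow_mul]
        simp
    have E₂ : homEv (l - 1) ((N.cx.d l (l - 1)).hom x) (homAct N I i a φ) =
        ((-1 : ℤ) ^ (i * l) * (-1) ^ i) •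
          homEv (n - 1) (N.sm i (l - 1) (n - 1) a ((N.cx.d l (l - 1)).hom x)) φ := by
      rcases Nat.eq_zero_or_pos l with rfl | hl
      · rw [d_zero_left, homEv_zero, map_zero, homEv_zero, smul_zero]
      · rw [homEv_homAct (show i + (l - 1) = n - 1 by omega)]
        congr 1
        obtain ⟨l, rfl⟩ := Nat.exists_eq_succ_of_ne_zero hl.ne'
        rw [Nat.succ_sub_one, Nat.mul_succ, pow_add, mul_assoc, ← pow_add, ← two_mul, pow_mul]
        simp
    rw [E₁, E₂, smul_add, smul_add, smul_add, smul_smul, smul_smul, smul_smul, smul_smul, smul_smul,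
      smul_smul, ← add_assoc, ← add_smul, ← hn]
    have e1 : (-1 : ℤ) ^ i * (-1) ^ i = 1 := by rw [← mul_pow]; simp
    have c1 : (-1 : ℤ) ^ (i * l) * (-1) ^ l +
        (-1) ^ i * (-1) ^ (i * l) * (-1) ^ (i + l + 1) = 0 := by
      rw [pow_succ, pow_add]
      linear_combination (-(-1 : ℤ) ^ (i * l) * (-1) ^ l) * e1
    have c2 : (-1 : ℤ) ^ (l + 1) * ((-1) ^ (i * l) * (-1) ^ i) =
        (-1) ^ i * (-1) ^ (i * l) * (-1) ^ (i + l + 1) * (-1) ^ i := by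
      rw [pow_succ, pow_succ, pow_add]
      linear_combination ((-1 : ℤ) ^ (i * l) * (-1) ^ l * (-1) ^ i) * e1
    rw [c1, c2, zero_smul, zero_add]
  mul_act {i j p} h a b φ := homProd_ext fun l x => by
    obtain ⟨q, hq⟩ : ∃ q, i + l = q := ⟨_, rfl⟩
    obtain ⟨n, hn⟩ : ∃ n, p + l = n := ⟨_, rfl⟩
    rw [homEv_homAct hn, homEv_homAct hq, homEv_homAct (show j + q = n by omega),
      ← N.mul_act (show j + i = p by omega) hq hn, A.mul_comm h, map_zsmul,
      AddMonoidHom.zsmul_apply, homEv_zsmul, smul_smul, smul_smul]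
    congr 1
    rw [← hq, ← h, add_mul, mul_add, pow_add, pow_add, mul_comm j i]
    ring
  one_act φ := homProd_ext fun l x => by
    rw [homEv_homAct (zero_add l), N.one_act, zero_mul, pow_zero, one_smul]

/-- Precomposition with a morphism of `A`-modules. -/
def homTotalPre (f : N ⟶ N') (m : ℕ) : TotalMod.Hom (homTotal N' I m) (homTotal N I m) where
  map := homPre f.hom
  map_mem hφ := mem_homPiece.2 fun i hi _ => mem_homPiece.1 hφ i hi _
  map_d φ := homProd_ext fun i x => by
    change homProd N'.cx I at φ
    change homEv i x (homPre f.hom (homD N'.cx I φ)) = homEv i x (homD N.cx I (homPre f.hom φ))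
    rw [homEv_homPre, homEv_homD, homEv_homD, homEv_homPre, hom_d]
  map_act i a φ := homProd_ext fun l x => by
    change homProd N'.cx I at φ
    change homEv l x (homPre f.hom (homAct N' I i a φ)) =
      homEv l x (homAct N I i a (homPre f.hom φ))
    rw [homEv_homPre, homEv_homAct rfl, homEv_homAct rfl, homEv_homPre, f.act_hom rfl]

theorem homSign_homAct (i : ℕ) (a : A.cx.X i) (φ : homProd N.cx I) :
    homSign N.cx I (homAct N I i a φ) = (-1 : ℤ) ^ i • homAct N I i a (homSign N.cx I φ) :=
  homProd_ext fun l x => by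
    rw [homEv_homSign, map_zsmul, homEv_homAct rfl, homEv_homAct rfl, homEv_homSign, smul_smul,
      smul_smul, smul_smul]
    congr 1
    have e : (-1 : ℤ) ^ i * (-1) ^ i = 1 := by rw [← mul_pow]; simp
    rw [pow_add]
    linear_combination (-(-1 : ℤ) ^ l * (-1) ^ (i * l)) * e

end HomTotal
end DGD

namespace DGD

variable {k : Type u} {O : Type u} [Field k] [CommRing O] [Algebra k O]
/-- A `𝒟`-linear map, as an `O`-linear map. -/
def linO {X Y : ModuleCat.{u} (D k O)} (g : X →ₗ[D k O] Y) : X →ₗ[O] Y where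
  toFun := g
  map_add' := map_add g
  map_smul' f x := map_smulO g f x

variable [CharZero k] [Algebra.Smooth k O]

/-! ### Exactness of the maps into an injective module -/

section Exactness

variable {K : DGDM k O} {I : ModuleCat.{u} (D k O)}

/-- The family with the homSingle component `φ : Kₑ → I`. -/
def homSingle (e : ℕ) (φ : K.X e →ₗ[O] I) : homProd K I :=
  ofHomComp (Pi.single (M := fun i => K.X i →ₗ[O] I) e φ)

theorem homEv_homSingle (e : ℕ) (φ : K.X e →ₗ[O] I) (x : K.X e) :
    homEv e x (homSingle e φ) = φ x := by
  rw [homSingle, homEv_ofHomComp, Pi.single_eq_same]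

theorem homEv_homSingle_of_ne {e i : ℕ} (h : i ≠ e) (φ : K.X e →ₗ[O] I) (x : K.X i) :
    homEv i x (homSingle e φ) = 0 := by
  rw [homSingle, homEv_ofHomComp, Pi.single_eq_of_ne h]
  rfl

theorem homSingle_mem {e m p : ℕ} (h : e + p = m) (φ : K.X e →ₗ[O] I) :
    homSingle e φ ∈ homPiece K I m p :=
  mem_homPiece.2 fun i hi x => homEv_homSingle_of_ne (by omega) φ x

variable {A : DGAlg k O} {P Q : DGMod A}

/-- In the mapping cone of a quasi-isomorphism `f : P → Q`, a cocycle `(ψ, s)` with values in an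
injective module `I` is a coboundary: the functional `(q, p) ↦ ± ψ q + s p` on `Qₑ₊₁ × Pₑ` factors
through `(q, p) ↦ (d q + f p, d p)`. -/
theorem exists_cobounding (hI : Module.Injective O I) (f : P ⟶ Q) (hf : QuasiIso f.hom) (e : ℕ)
    (ψ : Q.cx.X (e + 1) →ₗ[O] I) (s : P.cx.X e →ₗ[O] I)
    (hψ : ∀ q, ψ ((Q.cx.d (e + 2) (e + 1)).hom q) = 0)
    (hs : ∀ p, ψ ((f.hom.f (e + 1)).hom p) = (-1 : ℤ) ^ e • s ((P.cx.d (e + 1) e).hom p)) :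
    ∃ (χ : Q.cx.X e →ₗ[O] I) (t : P.cx.X (e - 1) →ₗ[O] I),
      (∀ q, χ ((Q.cx.d (e + 1) e).hom q) = (-1 : ℤ) ^ e • ψ q) ∧
      (∀ p, χ ((f.hom.f e).hom p) + t ((P.cx.d e (e - 1)).hom p) = s p) := by
  rw [quasiIso_iff_elements] at hf
  have esq : (-1 : ℤ) ^ e * (-1) ^ e = 1 := by rw [← mul_pow]; simp
  let a : (Q.cx.X (e + 1) × P.cx.X e) →ₗ[O] (Q.cx.X e × P.cx.X (e - 1)) :=
    (LinearMap.coprod (linO (Q.cx.d (e + 1) e).hom) (linO (f.hom.f e).hom)).prod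
      (linO (P.cx.d e (e - 1)).hom ∘ₗ LinearMap.snd _ _ _)
  let b : (Q.cx.X (e + 1) × P.cx.X e) →ₗ[O] I := LinearMap.coprod ((-1 : ℤ) ^ e • ψ) s
  have ha : ∀ q p, a (q, p) = ((Q.cx.d (e + 1) e).hom q + (f.hom.f e).hom p,
      (P.cx.d e (e - 1)).hom p) := fun _ _ => rfl
  have hb : ∀ q p, b (q, p) = (-1 : ℤ) ^ e • ψ q + s p := fun q p => by
    simp only [b, LinearMap.coprod_apply, LinearMap.smul_apply]
  obtain ⟨w, hw⟩ := exists_factor_of_ker_le hI a b (by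
    rintro ⟨q, p⟩ h
    rw [ha] at h
    have h1 : (Q.cx.d (e + 1) e).hom q + (f.hom.f e).hom p = 0 := congrArg Prod.fst h
    have h2 : (P.cx.d e (e - 1)).hom p = 0 := congrArg Prod.snd h
    obtain ⟨p', rfl⟩ := (hf e).1 p h2 (-q) (by
      rw [map_neg]; exact neg_eq_of_add_eq_zero_right h1)
    have h3 : (Q.cx.d (e + 1) (e + 1 - 1)).hom (q + (f.hom.f (e + 1)).hom p') = 0 := by
      rw [Nat.add_sub_cancel, map_add, hom_d, h1]
    obtain ⟨z, q', hz, hq⟩ := (hf (e + 1)).2 _ h3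
    rw [Nat.add_sub_cancel] at hz
    have h4 : ψ q + (-1 : ℤ) ^ e • s ((P.cx.d (e + 1) e).hom p') = 0 := by
      have := congrArg ψ hq
      rwa [map_add, map_add, hψ, hs, hs, hz, map_zero, smul_zero, add_zero] at this
    rw [hb, eq_neg_of_add_eq_zero_left h4, smul_neg, smul_smul, esq, one_smul, neg_add_cancel])
  refine ⟨w ∘ₗ LinearMap.inl _ _ _, w ∘ₗ LinearMap.inr _ _ _, fun q => ?_, fun p => ?_⟩
  · have := hw (q, 0)
    rw [ha, hb, map_zero, map_zero, map_zero, add_zero, add_zero] at this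
    exact this
  · have := hw (0, p)
    rw [ha, hb, map_zero, map_zero, smul_zero, zero_add, zero_add] at this
    rw [← this, LinearMap.comp_apply, LinearMap.comp_apply, ← map_add, LinearMap.inl_apply,
      LinearMap.inr_apply, Prod.mk_add_mk, add_zero, zero_add]

/-- If `f : P → Q` is a quasi-isomorphism and `I` is injective, the maps from the mapping cone of
`f` to `I[m]`, i.e. the homotopy fiber of `Hom(Q, I[m]) → Hom(P, I[m])`, form an acyclic module. -/
theorem isExact_fiber_homTotalPre (hI : Module.Injective O I) (f : P ⟶ Q) (hf : QuasiIso f.hom)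
    (m : ℕ) : (TotalMod.fiber (homTotalPre (I := I) f m)).IsExact := by
  rintro p ⟨ψ, s⟩ ⟨hψm, hsm⟩ hd
  change homProd Q.cx I at ψ
  change homProd P.cx I at s
  replace hψm : ∀ i, i + p ≠ m → ∀ x, homEv i x ψ = 0 := mem_homPiece.1 hψm
  replace hsm : ∀ i, i + (p + 1) ≠ m → ∀ x, homEv i x s = 0 := mem_homPiece.1 hsm
  have h1 : homD Q.cx I ψ = 0 := congrArg Prod.fst hd
  have h2 : homPre f.hom ψ = homD P.cx I s := sub_eq_zero.1 (congrArg Prod.snd hd)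
  have h1' : ∀ i (q : Q.cx.X (i + 1)), homEv i ((Q.cx.d (i + 1) i).hom q) ψ = 0 := fun i q => by
    have := congrArg (homEv (i + 1) q) h1
    rw [homEv_homD, map_zero] at this
    exact (((isUnit_one (M := ℤ)).neg.pow _).smul_eq_zero).1 this
  have h2' : ∀ i (x : P.cx.X i), homEv i ((f.hom.f i).hom x) ψ =
      (-1 : ℤ) ^ (i + 1) • homEv (i - 1) ((P.cx.d i (i - 1)).hom x) s := fun i x => by
    rw [← homEv_homPre, h2, homEv_homD]
  suffices h : ∃ χ ∈ homPiece Q.cx I m (p + 1), ∃ t ∈ homPiece P.cx I m (p + 1 + 1),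
      homD Q.cx I χ = ψ ∧ homPre f.hom χ - homD P.cx I t = s by
    obtain ⟨χ, hχ, t, ht, e1, e2⟩ := h
    exact ⟨(χ, t), ⟨hχ, ht⟩, Prod.ext e1 e2⟩
  rcases lt_trichotomy m p with hmp | rfl | hmp
  · refine ⟨0, zero_mem _, 0, zero_mem _, homProd_ext fun i x => ?_, homProd_ext fun i x => ?_⟩
    · rw [map_zero, map_zero, hψm i (by omega)]
    · rw [map_zero, map_zero, sub_zero, map_zero, hsm i (by omega)]
  · -- In degree `0`, every element of `Q` is a cycle, hence in the image of `f` up to a boundary.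
    have hψ0 : ∀ x : Q.cx.X 0, homEv 0 x ψ = 0 := fun x => by
      obtain ⟨y, x', -, rfl⟩ := ((quasiIso_iff_elements f.hom).1 hf 0).2 x (d_zero_left _ _ _)
      rw [homEv_add, h1', h2', d_zero_left, homEv_zero, smul_zero, add_zero]
    refine ⟨0, zero_mem _, 0, zero_mem _, homProd_ext fun i x => ?_, homProd_ext fun i x => ?_⟩
    · rw [map_zero, map_zero]
      rcases Nat.eq_zero_or_pos i with rfl | hi
      · rw [hψ0]
      · rw [hψm i (by omega)]
    · rw [map_zero, map_zero, sub_zero, map_zero, hsm i (by omega)]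
  · obtain ⟨e, he⟩ : ∃ e, e + 1 + p = m := ⟨m - p - 1, by omega⟩
    obtain ⟨χ, t, hχ, ht⟩ := exists_cobounding hI f hf e (homComp (e + 1) ψ) (homComp e s)
      (fun q => h1' (e + 1) q) (fun x => by
        have := h2' (e + 1) x
        rwa [pow_add (-1 : ℤ) e 2, show (-1 : ℤ) ^ 2 = 1 by norm_num, mul_one] at this)
    have esq : (-1 : ℤ) ^ e * (-1) ^ e = 1 := by rw [← mul_pow]; simp
    refine ⟨homSingle e χ, homSingle_mem (by omega) χ,
      if e = 0 then 0 else homSingle (e - 1) ((-1 : ℤ) ^ e • t), ?_,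
      homProd_ext fun i x => ?_, homProd_ext fun i x => ?_⟩
    · split_ifs with h0
      · exact zero_mem _
      · exact homSingle_mem (by omega) _
    · rw [homEv_homD]
      by_cases hi : i = e + 1
      · subst hi
        rw [pow_add (-1 : ℤ) e 2, show (-1 : ℤ) ^ 2 = 1 by norm_num, mul_one]
        refine (congrArg _ ((homEv_homSingle e χ _).trans (hχ x))).trans ?_
        rw [smul_smul, esq, one_smul, homComp_apply]
      · rw [hψm i (by omega)]
        rcases Nat.eq_zero_or_pos i with rfl | hi'
        · rw [d_zero_left, homEv_zero, smul_zero]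
        · rw [homEv_homSingle_of_ne (by omega), smul_zero]
    · rw [map_sub, homEv_homPre, homEv_homD]
      by_cases hi : i = e
      · subst hi
        rw [homEv_homSingle, ← homComp_apply i s, ← ht, sub_eq_add_neg]
        congr 1
        rcases Nat.eq_zero_or_pos i with rfl | hi'
        · rw [if_pos rfl, map_zero, smul_zero, neg_zero, d_zero_left, map_zero]
        · rw [if_neg hi'.ne', homEv_homSingle, LinearMap.smul_apply, smul_smul, pow_succ, mul_assoc,
            mul_comm (-1 : ℤ), ← mul_assoc, esq, one_mul, neg_smul, one_smul, neg_neg]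
      · rw [homEv_homSingle_of_ne hi, hsm i (by omega), zero_sub, neg_eq_zero]
        rcases Nat.eq_zero_or_pos i with rfl | hi'
        · rw [d_zero_left, homEv_zero, smul_zero]
        · split_ifs with h0
          · rw [map_zero, smul_zero]
          · rw [homEv_homSingle_of_ne (by omega), smul_zero]

end Exactness

/-! ### The adjunction between tensor product and internal hom -/

section Adjunction

open DGMod

variable {A : DGAlg k O} {P Q M : DGMod A} {I : ModuleCat.{u} (D k O)}

/-- The map `M → ∏ᵢ Hom_O(Pᵢ, I)`, `y ↦ (x ↦ Ψ (x ⊗ y))` given by `Ψ : (P ⊗_A M)ₘ → I`, as an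
additive map. -/
def overCurryAdd {m : ℕ} (Ψ : overX P M m →ₗ[D k O] I) (j : ℕ) : M.cx.X j →+ homProd P.cx I where
  toFun y := ofHomComp fun i =>
    { toFun x := Ψ (qelt i j m x y)
      map_add' x x' := by rw [(qelt i j m).map_add, AddMonoidHom.add_apply, Ψ.map_add]
      map_smul' f x := by rw [qelt_smul_left, map_smulO, RingHom.id_apply] }
  map_zero' := homProd_ext fun i x =>
    (congrArg Ψ (qelt (P := P) (M := M) i j m x).map_zero).trans Ψ.map_zero
  map_add' y y' := homProd_ext fun i x =>
    (congrArg Ψ ((qelt (P := P) (M := M) i j m x).map_add y y')).trans (Ψ.map_add _ _)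

theorem homEv_overCurryAdd {m : ℕ} (Ψ : overX P M m →ₗ[D k O] I) (i j : ℕ) (x : P.cx.X i)
    (y : M.cx.X j) : homEv i x (overCurryAdd Ψ j y) = Ψ (qelt i j m x y) := rfl

/-- The map `M → ∏ᵢ Hom_O(Pᵢ, I)`, `y ↦ (x ↦ Ψ (x ⊗ y))` given by `Ψ : (P ⊗_A M)ₘ → I`. -/
def overCurry {m : ℕ} (Ψ : overX P M m →ₗ[D k O] I) (j : ℕ) :
    M.cx.X j →ₗ[D k O] homProd P.cx I :=
  mkLinear (overCurryAdd Ψ j)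
    (fun f y => homProd_ext fun i x => by
      rw [homEv_smul_right, homEv_overCurryAdd, homEv_overCurryAdd, qelt_smul_right, map_smulO])
    (fun θ y => homProd_ext fun i x => by
      rw [homEv_vf, homEv_overCurryAdd, homEv_overCurryAdd, homEv_overCurryAdd,
        ← Ψ.map_smul, vf_qelt, Ψ.map_add, add_sub_cancel_left])

theorem homEv_overCurry {m : ℕ} (Ψ : overX P M m →ₗ[D k O] I) (i j : ℕ) (x : P.cx.X i)
    (y : M.cx.X j) : homEv i x (overCurry Ψ j y) = Ψ (qelt i j m x y) := rfl

theorem overCurry_mem {m p : ℕ} (Ψ : overX P M p →ₗ[D k O] I) (j n : ℕ) (y : M.cx.X j)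
    (h : ∀ i, i + n ≠ m → i + j ≠ p) : overCurry Ψ j y ∈ homPiece P.cx I m n :=
  mem_homPiece.2 fun i hi x => by rw [homEv_overCurry, qelt_of_ne (h i hi), map_zero]

theorem overCurry_act {m i j n : ℕ} (Ψ : overX P M m →ₗ[D k O] I) (h : i + j = n) (a : A.cx.X i)
    (y : M.cx.X j) : overCurry Ψ n (M.sm i j n a y) = homAct P I i a (overCurry Ψ j y) :=
  homProd_ext fun l x => by
    rw [homEv_overCurry, homEv_homAct rfl, homEv_overCurry, qelt_act h rfl, map_zsmul]

/-- A compatible family of maps `χ : Mⱼ → ∏ᵢ Hom_O(Pᵢ, I)` gives a map `(P ⊗_A M)ₘ → I`,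
`x ⊗ y ↦ χ(y)(x)`. -/
theorem exists_overUncurry (m : ℕ) (χ : ∀ j, M.cx.X j →ₗ[D k O] homProd P.cx I)
    (hχ : ∀ {i j n}, i + j = n → ∀ a y, χ n (M.sm i j n a y) = homAct P I i a (χ j y)) :
    ∃ X : overX P M m →ₗ[D k O] I, ∀ i j, i + j = m → ∀ x y,
      X (qelt i j m x y) = homEv i x (χ j y) := by
  let b : ∀ i j, P.cx.X i →+ M.cx.X j →+ I := fun i j =>
    AddMonoidHom.mk' (fun x => (homEv i x).comp (χ j).toAddMonoidHom)
      (fun x x' => AddMonoidHom.ext fun y => homEv_add i x x' _)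
  have hb : ∀ i j x y, b i j x y = homEv i x (χ j y) := fun _ _ _ _ => rfl
  let X₀ : tensX P.cx M.cx m →ₗ[D k O] I := tensXDesc m fun i j => tensLift (b i j)
    (fun f x y => by rw [hb, hb, homEv_smul_left])
    (fun f x y => by rw [hb, hb, map_smulO, homEv_smul_right])
    (fun θ x y => by rw [hb, hb, hb, (χ j).map_smul, homEv_vf, add_sub_cancel])
  have hX₀ : ∀ i j, i + j = m → ∀ x y, X₀ (elt i j m x y) = homEv i x (χ j y) :=
    fun i j h x y => (tensXDesc_elt _ h x y).trans (tensLift_tmul _ _ _ _ x y)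
  have hrel : rel P M m ≤ LinearMap.ker X₀ := by
    refine Submodule.span_le.2 ?_
    rintro _ ⟨i, j, l, a, x, y, rfl⟩
    change X₀ _ = 0
    by_cases h : i + j + l = m
    · rw [map_sub, map_zsmul, hX₀ _ _ (by omega), hX₀ _ _ h, hχ rfl, homEv_homAct rfl, sub_self]
    · rw [elt_of_ne (by omega), elt_of_ne h, smul_zero, sub_zero, map_zero]
  exact ⟨(rel P M m).liftQ X₀ hrel, hX₀⟩

theorem overD_qelt_pred {i j n : ℕ} (h : i + j = n) (x : P.cx.X i) (y : M.cx.X j) :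
    overD P M n (n - 1) (qelt i j n x y) = qelt (i - 1) j (n - 1) ((P.cx.d i (i - 1)).hom x) y +
      (-1 : ℤ) ^ i • qelt i (j - 1) (n - 1) x ((M.cx.d j (j - 1)).hom y) := by
  rcases Nat.eq_zero_or_pos n with rfl | hn
  · obtain ⟨rfl, rfl⟩ : i = 0 ∧ j = 0 := by omega
    simp only [d_zero_left, map_zero, AddMonoidHom.zero_apply, smul_zero, add_zero]
    exact d_zero_left (overCx P M) _ _
  · exact overD_qelt (by omega) i j x y


end Adjunction
end DGD

/-! ### Homology of the tensor product with a cofibrant module -/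

namespace DGD

variable {k : Type u} {O : Type u} [Field k] [CommRing O] [Algebra k O]
variable [CharZero k] [Algebra.Smooth k O] {A : DGAlg k O} {P Q M : DGMod A}
  {I : ModuleCat.{u} (D k O)}

open DGMod

/-- Currying commutes with the differentials, up to the values on boundaries. -/
theorem d_overCurry {m n : ℕ} (h : n + 1 = m) (Ψ : overX P M n →ₗ[D k O] I) (j : ℕ)
    (y : M.cx.X j) : homD P.cx I (overCurry Ψ j y) =
      overCurry Ψ (j - 1) ((M.cx.d j (j - 1)).hom y) -
        homSign P.cx I (overCurry (Ψ ∘ₗ overD P M m n) j y) :=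
  homProd_ext fun i x => by
    have e : (-1 : ℤ) ^ i * (-1) ^ i = 1 := by rw [← mul_pow]; simp
    rw [homEv_homD, map_sub, homEv_homSign, homEv_overCurry, homEv_overCurry, homEv_overCurry,
      LinearMap.comp_apply, overD_qelt h, Ψ.map_add, map_zsmul, smul_add, smul_smul, e, one_smul,
      pow_succ, mul_neg_one, neg_smul]
    abel

theorem overUncurry_overD {m : ℕ} {χ : ∀ j, M.cx.X j →ₗ[D k O] homProd P.cx I}
    {X : overX P M (m - 1) →ₗ[D k O] I} (hX : ∀ i j, i + j = m - 1 → ∀ x y,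
      X (qelt i j (m - 1) x y) = homEv i x (χ j y)) {i j : ℕ} (h : i + j = m) (x : P.cx.X i)
    (y : M.cx.X j) : X (overD P M m (m - 1) (qelt i j m x y)) =
      homEv (i - 1) ((P.cx.d i (i - 1)).hom x) (χ j y) +
        (-1 : ℤ) ^ i • homEv i x (χ (j - 1) ((M.cx.d j (j - 1)).hom y)) := by
  rw [overD_qelt_pred h, X.map_add, map_zsmul]
  congr 1
  · rcases Nat.eq_zero_or_pos i with rfl | hi
    · rw [d_zero_left, homEv_zero, map_zero, AddMonoidHom.zero_apply, X.map_zero]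
    · rw [hX _ _ (by omega)]
  · congr 1
    rcases Nat.eq_zero_or_pos j with rfl | hj
    · simp only [d_zero_left, map_zero]
    · rw [hX _ _ (by omega)]

/-- A cocycle `(ψ, s)` on the mapping cone of `f ⊗_A M` with values in an injective module kills
the cycles `(z, w)` of the cone. Indeed, it corresponds to a map from `M` to the module of maps from
the cone of `f`, which is exact; since `M` is cofibrant, this map is homotopic to zero. -/
theorem cocycle_eq_zero (hI : Module.Injective O I) (f : P ⟶ Q) (hf : QuasiIso f.hom)
    (hM : HomotopicalAlgebra.IsCofibrant M) (m : ℕ) (ψ : overX Q M m →ₗ[D k O] I)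
    (s : overX P M (m - 1) →ₗ[D k O] I) (hψ : ∀ x, ψ (overD Q M (m + 1) m x) = 0)
    (hs : ∀ x, ψ (overMapX f M m x) = s (overD P M m (m - 1) x)) (h0 : m = 0 → s = 0)
    (z : overX Q M m) (w : overX P M (m - 1))
    (hz : overD Q M m (m - 1) z + overMapX f M (m - 1) w = 0)
    (hw : overD P M (m - 1) (m - 1 - 1) w = 0) : ψ z + s w = 0 := by
  let T := TotalMod.fiber (homTotalPre (I := I) f m)
  have hsq : ∀ i : ℕ, (-1 : ℤ) ^ i * (-1) ^ i = 1 := fun i => by rw [← mul_pow]; simp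
  -- The map `y ↦ (ψ(- ⊗ y), ± s(- ⊗ y))`, where the sign `(-1)^|x|` makes it commute with the
  -- differentials and with the action of `A`.
  obtain ⟨g, hg⟩ := T.exists_hom (M := M) (fun j => (overCurry ψ j).prod
      (homSign P.cx I ∘ₗ overCurry s j))
    (fun j y => by
      refine ⟨overCurry_mem ψ j j y fun i hi => hi, ?_⟩
      refine mem_homPiece.2 fun i hi x => ?_
      change homEv i x (homSign P.cx I (overCurry s j y)) = 0
      rw [homEv_homSign, homEv_overCurry]
      rcases Nat.eq_zero_or_pos m with hm | hm
      · rw [h0 hm, LinearMap.zero_apply, smul_zero]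
      · rw [qelt_of_ne (by omega), s.map_zero, smul_zero])
    (fun j y => by
      refine Prod.ext ?_ ?_
      · change homD Q.cx I (overCurry ψ j y) = overCurry ψ (j - 1) _
        have h : ψ ∘ₗ overD Q M (m + 1) m = 0 := LinearMap.ext hψ
        rw [d_overCurry rfl, h]
        have h' : overCurry (0 : overX Q M (m + 1) →ₗ[D k O] I) j y = 0 :=
          homProd_ext fun i x => rfl
        rw [h', map_zero, sub_zero]
      · change homPre f.hom (overCurry ψ j y) - homD P.cx I (homSign P.cx I (overCurry s j y)) =
          homSign P.cx I (overCurry s (j - 1) _)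
        refine homProd_ext fun i x => ?_
        rw [map_sub, homEv_homPre, homEv_homD, homEv_homSign, homEv_homSign, homEv_overCurry,
          homEv_overCurry, homEv_overCurry, ← overMapX_qelt, hs]
        by_cases h : i + j = m
        · rw [overD_qelt_pred h, s.map_add, map_zsmul, smul_smul]
          rcases Nat.eq_zero_or_pos i with rfl | hi
          · rw [d_zero_left, map_zero, AddMonoidHom.zero_apply, s.map_zero, smul_zero, sub_zero,
              zero_add]
          · rw [pow_succ, neg_one_pow_pred hi]
            have e := hsq (i - 1)
            have e' : -(-1 : ℤ) ^ (i - 1) * -1 * (-1) ^ (i - 1) = 1 := by linear_combination e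
            rw [e', one_smul, add_sub_cancel_left]
        · have h1 : s (qelt i (j - 1) (m - 1) x ((M.cx.d j (j - 1)).hom y)) = 0 := by
            rcases Nat.eq_zero_or_pos m with hm | hm
            · rw [h0 hm, LinearMap.zero_apply]
            · rcases Nat.eq_zero_or_pos j with rfl | hj
              · rw [d_zero_left, map_zero, s.map_zero]
              · rw [qelt_of_ne (by omega), s.map_zero]
          have h2 : s (qelt (i - 1) j (m - 1) ((P.cx.d i (i - 1)).hom x) y) = 0 := by
            rcases Nat.eq_zero_or_pos m with hm | hm
            · rw [h0 hm, LinearMap.zero_apply]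
            · rcases Nat.eq_zero_or_pos i with rfl | hi
              · rw [d_zero_left, map_zero, AddMonoidHom.zero_apply, s.map_zero]
              · rw [qelt_of_ne (by omega), s.map_zero]
          rw [h1, h2, qelt_of_ne h, map_zero, s.map_zero, smul_zero, smul_zero, smul_zero,
            sub_zero])
    (fun {i j n} h a y => by
      refine Prod.ext (overCurry_act ψ h a y) ?_
      change homSign P.cx I (overCurry s n _) =
        (-1 : ℤ) ^ i • homAct P I i a (homSign P.cx I (overCurry s j y))
      rw [overCurry_act s h, homSign_homAct])
  obtain ⟨η, -, hη, hη'⟩ := TotalMod.IsExact.exists_nullhomotopy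
    (isExact_fiber_homTotalPre hI f hf m) hM g
  let χ : ∀ j, M.cx.X j →ₗ[D k O] homProd Q.cx I := fun j =>
    LinearMap.fst (D k O) (homProd Q.cx I) (homProd P.cx I) ∘ₗ η j
  let t : ∀ j, M.cx.X j →ₗ[D k O] homProd P.cx I := fun j =>
    LinearMap.snd (D k O) (homProd Q.cx I) (homProd P.cx I) ∘ₗ η j
  have hχ : ∀ j y, overCurry ψ j y =
      homD Q.cx I (χ j y) + χ (j - 1) ((M.cx.d j (j - 1)).hom y) := fun j y =>
    congrArg Prod.fst ((hg j y).symm.trans (hη j y))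
  have ht : ∀ j y, homSign P.cx I (overCurry s j y) = homPre f.hom (χ j y) -
      homD P.cx I (t j y) + t (j - 1) ((M.cx.d j (j - 1)).hom y) := fun j y =>
    congrArg Prod.snd ((hg j y).symm.trans (hη j y))
  have hχ' : ∀ {i j n}, i + j = n → ∀ (a : A.cx.X i) (y : M.cx.X j),
      χ n (M.sm i j n a y) = (-1 : ℤ) ^ i • homAct Q I i a (χ j y) := fun h a y =>
    congrArg Prod.fst (hη' h a y)
  have ht' : ∀ {i j n}, i + j = n → ∀ (a : A.cx.X i) (y : M.cx.X j),
      t n (M.sm i j n a y) = homAct P I i a (t j y) := fun {i j n} h a y => by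
    refine (congrArg Prod.snd (hη' h a y)).trans ?_
    change (-1 : ℤ) ^ i • (-1 : ℤ) ^ i • homAct P I i a (t j y) = _
    rw [smul_smul, hsq, one_smul]
  -- A null-homotopy is a pair `(χ, t)`; it uncurries to functionals `X` and `Y` with
  -- `ψ = X d` and `s = X f + Y d`.
  obtain ⟨X, hX⟩ := exists_overUncurry (m - 1) (fun j => homSign Q.cx I ∘ₗ χ j)
    (fun {i j n} h a y => by
      rw [LinearMap.comp_apply, hχ' h, map_zsmul, homSign_homAct, smul_smul, hsq, one_smul,
        LinearMap.comp_apply])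
  obtain ⟨Y, hY⟩ := exists_overUncurry (m - 1 - 1) t ht'
  have h1 : ∀ z, ψ z = X (overD Q M m (m - 1) z) := fun z => by
    induction z using overX_induction with
    | h0 => rw [map_zero, map_zero, map_zero]
    | ha x y hx hy => rw [map_add, map_add, map_add, hx, hy]
    | ht i j hij x y =>
      rw [overUncurry_overD hX hij, ← homEv_overCurry, hχ, map_add, homEv_homD,
        LinearMap.comp_apply, LinearMap.comp_apply, homEv_homSign, homEv_homSign, smul_smul,
        hsq, one_smul]
      congr 1
      rcases Nat.eq_zero_or_pos i with rfl | hi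
      · rw [d_zero_left, homEv_zero, smul_zero, smul_zero]
      · rw [pow_succ, neg_one_pow_pred hi, mul_neg_one, neg_neg]
  have h2 : ∀ w, s w = X (overMapX f M (m - 1) w) + Y (overD P M (m - 1) (m - 1 - 1) w) :=
      fun w => by
    induction w using overX_induction with
    | h0 => simp only [map_zero, add_zero]
    | ha x y hx hy => simp only [map_add, hx, hy]; abel
    | ht i j hij x y =>
      have e := congrArg (fun φ => (-1 : ℤ) ^ i • homEv i x φ) (ht j y)
      simp only [map_add, map_sub] at e
      rw [homEv_homSign, homEv_homPre, homEv_homD, smul_smul, hsq, one_smul, homEv_overCurry] at e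
      rw [e, overMapX_qelt, hX _ _ hij, overUncurry_overD hY hij, LinearMap.comp_apply,
        homEv_homSign, smul_add, smul_sub, smul_smul, pow_succ, ← mul_assoc, hsq, one_mul,
        neg_one_smul, sub_neg_eq_add, add_assoc]
  rw [h1, h2, hw, Y.map_zero, add_zero, ← X.map_add, hz, X.map_zero]

/-- The mapping cone of `f ⊗_A M` is exact: cycles are separated from boundaries by characters,
which extend to cocycles with values in `charMod`. -/
theorem exists_overCone_boundary (f : P ⟶ Q) (hf : QuasiIso f.hom)
    (hM : HomotopicalAlgebra.IsCofibrant M) (m : ℕ) (z : overX Q M m) (w : overX P M (m - 1))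
    (hz : overD Q M m (m - 1) z + overMapX f M (m - 1) w = 0)
    (hw : overD P M (m - 1) (m - 1 - 1) w = 0) (h0 : m = 0 → w = 0) :
    ∃ z' w', overD Q M (m + 1) m z' + overMapX f M m w' = z ∧ -overD P M m (m - 1) w' = w := by
  let δ : (overX Q M (m + 1) × overX P M m) →+ (overX Q M m × overX P M (m - 1)) :=
    AddMonoidHom.prod
      ((overD Q M (m + 1) m).toAddMonoidHom.coprod (overMapX f M m).toAddMonoidHom)
      (-((overD P M m (m - 1)).toAddMonoidHom.comp (AddMonoidHom.snd _ _)))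
  have hδ : ∀ z' w', δ (z', w') =
      (overD Q M (m + 1) m z' + overMapX f M m w', -overD P M m (m - 1) w') := fun _ _ => rfl
  by_contra hne
  have hmem : (QuotientAddGroup.mk (z, w) :
      (overX Q M m × overX P M (m - 1)) ⧸ δ.range) ≠ 0 := fun h => by
    obtain ⟨⟨z', w'⟩, h'⟩ := (QuotientAddGroup.eq_zero_iff _).1 h
    rw [hδ] at h'
    exact hne ⟨z', w', congrArg Prod.fst h', congrArg Prod.snd h'⟩
  obtain ⟨c, hc⟩ := CharacterModule.exists_character_apply_ne_zero_of_ne_zero hmem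
  let c' : (overX Q M m × overX P M (m - 1)) →+ AddCircle (1 : ℚ) :=
    AddMonoidHom.comp c (QuotientAddGroup.mk' δ.range)
  have hc' : ∀ z' w', c' (overD Q M (m + 1) m z' + overMapX f M m w',
      -overD P M m (m - 1) w') = 0 := fun z' w' => by
    have : (QuotientAddGroup.mk (δ (z', w')) :
      (overX Q M m × overX P M (m - 1)) ⧸ δ.range) = 0 :=
      (QuotientAddGroup.eq_zero_iff _).2 ⟨_, rfl⟩
    rw [← hδ]
    exact (congrArg c this).trans (map_zero (c : _ →+ AddCircle (1 : ℚ)))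
  -- For `m = 0` the second factor is `(P ⊗_A M)₀` instead of `0`, since `0 - 1 = 0`; the character
  -- is replaced by `0` there.
  let cψ := c'.comp (AddMonoidHom.inl _ _)
  let cs : overX P M (m - 1) →+ AddCircle (1 : ℚ) :=
    if m = 0 then 0 else c'.comp (AddMonoidHom.inr _ _)
  have hsum : cψ z + cs w = c' (z, w) := by
    have e : c' (z, w) = cψ z + c'.comp (AddMonoidHom.inr _ _) w := by
      change _ = c' (z, 0) + c' (0, w)
      rw [← map_add, Prod.mk_add_mk, add_zero, zero_add]
    rw [e]
    by_cases hm : m = 0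
    · rw [h0 hm, map_zero, map_zero]
    · simp only [cs, if_neg hm]
  refine hc (Eq.trans hsum.symm ?_)
  have key := cocycle_eq_zero charMod_injective f hf hM m (coind cψ) (coind cs)
    (fun x => coind_eq_zero fun S => by
      have := hc' (S • x) 0
      rw [map_zero, map_zero, add_zero, neg_zero, map_smul] at this
      exact this)
    (fun x => coind_eq fun S => by
      have := hc' 0 (S • x)
      rw [map_zero, zero_add, map_smul, map_smul] at this
      have e : cψ (S • overMapX f M m x) =
          c'.comp (AddMonoidHom.inr _ _) (S • overD P M m (m - 1) x) := by
        rw [← sub_eq_zero, sub_eq_add_neg, ← map_neg]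
        change c' (S • overMapX f M m x, 0) + c' (0, -(S • overD P M m (m - 1) x)) = 0
        rw [← map_add, Prod.mk_add_mk, add_zero, zero_add]
        exact this
      rw [e]
      by_cases hm : m = 0
      · subst hm
        have h3 : overD P M 0 (0 - 1) x = 0 := d_zero_left (overCx P M) _ _
        rw [h3, smul_zero, map_zero, map_zero]
      · simp only [cs, if_neg hm])
    (fun hm => by
      simp only [cs, if_pos hm]
      exact LinearMap.ext fun x => coind_eq_zero fun _ => rfl)
    z w hz hw
  have := congrArg evalOne key
  rwa [map_add, evalOne_coind, evalOne_coind, map_zero] at this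

end DGD
end

theorem propositionP {k O : Type u} [Field k] [IsAlgClosed k] [CharZero k] [CommRing O]
    [Algebra k O] [Algebra.Smooth k O] (A : DGD.DGAlg k O) (M : DGD.DGMod A)
    (hM : HomotopicalAlgebra.IsCofibrant M) {P Q : DGD.DGMod A} (f : P ⟶ Q)
    (hf : HomotopicalAlgebra.WeakEquivalence f) :
    HomotopicalAlgebra.WeakEquivalence ((DGD.DGMod.tensorRight M).map f) := by
  have hf' := (DGD.DGMod.weakEquivalence_iff f).1 hf
  refine (DGD.DGMod.weakEquivalence_iff _).2 ?_
  refine (DGD.quasiIso_iff_elements (DGD.DGMod.overMapCx f M)).2 fun n => ⟨?_, ?_⟩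
  · intro (x : P.overX M n) hx (y : Q.overX M (n + 1)) hy
    have h : DGD.DGMod.overD Q M (n + 1) n (-y) + DGD.DGMod.overMapX f M n x = 0 := by
      rw [map_neg]
      exact neg_add_eq_zero.2 hy
    obtain ⟨-, w, -, hw⟩ := DGD.exists_overCone_boundary f hf' hM (n + 1) (-y) x h hx
      (fun h => by omega)
    exact ⟨-w, (map_neg (DGD.DGMod.overD P M (n + 1) n) w).trans hw⟩
  · intro y hy
    obtain ⟨z, w, hz, hw⟩ := DGD.exists_overCone_boundary f hf' hM n y 0
      (by rw [map_zero, add_zero]; exact hy) (map_zero _) (fun _ => rfl)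
    exact ⟨w, z, neg_eq_zero.1 hw, hz.symm⟩
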